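/- Let $\gamma>0$, $\lambda>0$ and $0<\mu<2$. Let $Q=H^1(\mathbb R^+)\oplus H^1(\mathbb R^-)$ with $\|\psi\|_Q^2=\|\psi\|_{L^2}^2+\|\psi'\|_{L^2}^2$ ($\psi'$ being the weak derivative on $\mathbb R\setminus\{0\}$), and let $H_\gamma$ be the self-adjoint operator on $L^2(\mathbb R)$ with domain $$D(H_\gamma)=\{\psi\in H^2(\mathbb R\setminus\{0\}):\ \psi'(0+)=\psi'(0-),\ \psi(0+)-\psi(0-)=-\gamma\,\psi'(0+)\},\qquad H_\gamma\psi=-\psi''\ \text{ on }\mathbb R\setminus\{0\}.$$ For $\psi_0\in Q$ and $0<T\le\infty$, a weak solution on $[0,T)$ is a function $\psi\in C^0([0,T),Q)$ with $$\psi(t)=e^{-iH_\gamma t}\psi_0+i\lambda\int_0^t e^{-iH_\gamma(t-s)}|\psi(s)|^{2\mu}\psi(s)\,ds\qquad\text{for all }t\in[0,T).$$ Then, for every $\psi_0\in Q$, all weak solutions are globally defined in time: every maximal weak solution (one that no weak solution on a longer interval extends) is defined on $[0,\infty)$. More precisely, there is a weak solution $\Psi\in C^0([0,\infty),Q)\cap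 C^1([0,\infty),Q^\star)$ on $[0,\infty)$, where $Q\subset Q^\star$ through the scalar product of $L^2(\mathbb R)$, and every weak solution on an interval $[0,T)$, $0<T\le\infty$, with the same initial datum $\psi_0$ is the restriction of $\Psi$ to $[0,T)$. -/

import Mathlib

open MeasureTheory Filter Topology Set
open scoped ENNReal ContDiff

namespace DeltaPrimeNLS

noncomputable section

/-- The Hilbert space `L²(ℝ; ℂ)`. -/
abbrev L2 : Type := Lp ℂ 2 (volume : Measure ℝ)

/-- `g` is the weak (distributional) derivative of `f` on `ℝ ∖ {0}`: the test functions are the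
smooth functions with compact support contained in `ℝ ∖ {0}`. -/
def IsWeakDeriv (f g : L2) : Prop :=
  ∀ φ : ℝ → ℝ, ContDiff ℝ ∞ φ → HasCompactSupport φ → tsupport φ ⊆ {0}ᶜ →
    ∫ x, deriv φ x • f x = -∫ x, φ x • g x

/-- `f (0+) = a`: the essential right limit of `f` at the origin is `a`, that is, the limit off a
null set.  For `f ∈ H¹(ℝ⁺)` this is the right limit of the continuous representative. -/
def HasRightTrace (f : L2) (a : ℂ) : Prop :=
  Tendsto f (𝓝[>] (0 : ℝ) ⊓ ae volume) (𝓝 a)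

/-- `f (0-) = a`: the essential left limit of `f` at the origin is `a`. -/
def HasLeftTrace (f : L2) (a : ℂ) : Prop :=
  Tendsto f (𝓝[<] (0 : ℝ) ⊓ ae volume) (𝓝 a)

theorem integrable_test {φ : ℝ → ℝ} (hφ : Continuous φ) (hc : HasCompactSupport φ) (f : L2) :
    Integrable (fun x => φ x • f x) :=
  ((Lp.memLp f).locallyIntegrable (by norm_num)).integrable_smul_left_of_hasCompactSupport hφ hc

theorem IsWeakDeriv.zero : IsWeakDeriv 0 0 := by
  intro φ _ _ _
  have h : ∀ c : ℝ → ℝ, ∫ x, c x • (0 : L2) x = 0 := fun c => by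
    simp
  rw [h, h, neg_zero]

theorem IsWeakDeriv.add {f₁ g₁ f₂ g₂ : L2} (h₁ : IsWeakDeriv f₁ g₁) (h₂ : IsWeakDeriv f₂ g₂) :
    IsWeakDeriv (f₁ + f₂) (g₁ + g₂) := by
  intro φ hφ hc hs
  have key : ∀ c : ℝ → ℝ, Continuous c → HasCompactSupport c → ∀ u v : L2,
      ∫ x, c x • (u + v) x = (∫ x, c x • u x) + ∫ x, c x • v x := by
    intro c hcont hcs u v
    rw [← integral_add (integrable_test hcont hcs u) (integrable_test hcont hcs v)]
    refine integral_congr_ae ?_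
    filter_upwards [Lp.coeFn_add u v] with x hx
    simp only [hx, Pi.add_apply, smul_add]
  rw [key _ (hφ.continuous_deriv (by simp)) hc.deriv, key _ hφ.continuous hc,
    h₁ φ hφ hc hs, h₂ φ hφ hc hs, neg_add]

theorem IsWeakDeriv.smul {f g : L2} (c : ℂ) (h : IsWeakDeriv f g) :
    IsWeakDeriv (c • f) (c • g) := by
  intro φ hφ hc hs
  have key : ∀ (d : ℝ → ℝ) (u : L2), ∫ x, d x • (c • u) x = c • ∫ x, d x • u x := by
    intro d u
    rw [← integral_smul]
    refine integral_congr_ae ?_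
    filter_upwards [Lp.coeFn_smul c u] with x hx
    simp only [hx, Pi.smul_apply]
    exact smul_comm _ _ _
  rw [key, key, h φ hφ hc hs, smul_neg]

/-- The weak derivative is unique. -/
theorem IsWeakDeriv.eq_zero {g : L2} (h : IsWeakDeriv 0 g) : g = 0 := by
  have h0 : ∀ᵐ x ∂(volume : Measure ℝ), x ∈ ({0}ᶜ : Set ℝ) → g x = 0 := by
    refine isOpen_compl_singleton.ae_eq_zero_of_integral_contDiff_smul_eq_zero
      (((Lp.memLp g).locallyIntegrable (by norm_num)).locallyIntegrableOn _) ?_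
    intro φ hφ hc hs
    have h1 := h φ hφ hc hs
    have h2 : ∫ x, deriv φ x • (0 : L2) x = 0 := by
      simp
    rw [h2] at h1
    exact neg_eq_zero.mp h1.symm
  rw [Lp.eq_zero_iff_ae_eq_zero]
  have h3 : ∀ᵐ x ∂(volume : Measure ℝ), x ≠ 0 := by
    simp [ae_iff]
  filter_upwards [h0, h3] with x hx hx0
  exact hx hx0

theorem tendsto_zero_of_le_ae {l : Filter ℝ} (hl : l ≤ ae volume) :
    Tendsto (0 : L2) l (𝓝 0) :=
  tendsto_const_nhds.congr' (((Lp.coeFn_zero ℂ 2 (volume : Measure ℝ)).symm).filter_mono hl)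

theorem tendsto_add_of_le_ae {l : Filter ℝ} (hl : l ≤ ae volume) {f g : L2} {a b : ℂ}
    (hf : Tendsto f l (𝓝 a)) (hg : Tendsto g l (𝓝 b)) :
    Tendsto (f + g : L2) l (𝓝 (a + b)) :=
  (hf.add hg).congr' (((Lp.coeFn_add f g).symm).filter_mono hl)

theorem tendsto_smul_of_le_ae {l : Filter ℝ} (hl : l ≤ ae volume) (c : ℂ) {f : L2} {a : ℂ}
    (hf : Tendsto f l (𝓝 a)) : Tendsto (c • f : L2) l (𝓝 (c * a)) :=
  (hf.const_smul c).congr' (((Lp.coeFn_smul c f).symm).filter_mono hl)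

/-! ### The energy space -/

/-- The graph of the weak derivative on `ℝ ∖ {0}`, inside the Hilbert space `L² ⊕ L²`. -/
def energySubmodule : Submodule ℂ (WithLp 2 (L2 × L2)) where
  carrier := {p | IsWeakDeriv p.fst p.snd}
  zero_mem' := IsWeakDeriv.zero
  add_mem' h₁ h₂ := IsWeakDeriv.add h₁ h₂
  smul_mem' c _ h := IsWeakDeriv.smul c h

/-- The energy space `Q = H¹(ℝ⁺) ⊕ H¹(ℝ⁻)`.  An element is a function `ψ ∈ L²(ℝ)` together with its
(unique) weak derivative `ψ' ∈ L²(ℝ)` on `ℝ ∖ {0}`; the norm is `‖ψ‖_Q² = ‖ψ‖² + ‖ψ'‖²`. -/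
abbrev Q : Type := energySubmodule

/-- The underlying `L²` function of an element of `Q`. -/
def Q.toL2 : Q →L[ℂ] L2 :=
  (WithLp.fstL 2 ℂ L2 L2).comp energySubmodule.subtypeL

/-- The embedding of `Q` into its dual `Q*`, `u ↦ (u, ·)_{L²}` (antilinear, as the scalar
product is antilinear on the left). -/
def Q.toDual (u : Q) : Q →L[ℂ] ℂ :=
  (innerSL ℂ (Q.toL2 u)).comp Q.toL2

/-! ### The Hamiltonian -/

/-- The graph of `H_γ`: pairs `(ψ, η)` with `ψ ∈ H²(ℝ ∖ {0})`, `ψ'(0+) = ψ'(0-)`,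
`ψ(0+) - ψ(0-) = -γ ψ'(0+)` and `η = -ψ''` away from the origin. -/
def hamiltonianGraph (γ : ℝ) : Submodule ℂ (L2 × L2) where
  carrier := {p | ∃ g : L2, IsWeakDeriv p.1 g ∧ IsWeakDeriv g (-p.2) ∧
    ∃ a b c : ℂ, HasRightTrace p.1 a ∧ HasLeftTrace p.1 b ∧
      HasRightTrace g c ∧ HasLeftTrace g c ∧ a - b = -(γ : ℂ) * c}
  zero_mem' :=
    ⟨0, IsWeakDeriv.zero, by simpa using IsWeakDeriv.zero, 0, 0, 0,
      tendsto_zero_of_le_ae inf_le_right, tendsto_zero_of_le_ae inf_le_right,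
      tendsto_zero_of_le_ae inf_le_right, tendsto_zero_of_le_ae inf_le_right, by simp⟩
  add_mem' := by
    rintro p q ⟨g, hg, hg', a, b, c, ha, hb, hc, hc', h⟩ ⟨k, hk, hk', a', b', d, ha', hb', hd, hd', h'⟩
    refine ⟨g + k, hg.add hk, ?_, a + a', b + b', c + d, tendsto_add_of_le_ae inf_le_right ha ha',
      tendsto_add_of_le_ae inf_le_right hb hb', tendsto_add_of_le_ae inf_le_right hc hd,
      tendsto_add_of_le_ae inf_le_right hc' hd', ?_⟩
    · have := hg'.add hk'
      rwa [← neg_add] at this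
    · linear_combination h + h'
  smul_mem' := by
    rintro z p ⟨g, hg, hg', a, b, c, ha, hb, hc, hc', h⟩
    refine ⟨z • g, hg.smul z, ?_, z * a, z * b, z * c, tendsto_smul_of_le_ae inf_le_right z ha,
      tendsto_smul_of_le_ae inf_le_right z hb, tendsto_smul_of_le_ae inf_le_right z hc,
      tendsto_smul_of_le_ae inf_le_right z hc', ?_⟩
    · have := hg'.smul z
      rwa [smul_neg] at this
    · linear_combination z * h

/-- The Hamiltonian `H_γ` with a `δ'` interaction of strength `γ` at the origin, as an unbounded
operator on `L²(ℝ)`. -/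
def hamiltonian (γ : ℝ) : L2 →ₗ.[ℂ] L2 := (hamiltonianGraph γ).toLinearPMap

/-- The operator `hamiltonian γ` does have the graph that it is defined by. -/
theorem graph_hamiltonian (γ : ℝ) : (hamiltonian γ).graph = hamiltonianGraph γ := by
  refine Submodule.toLinearPMap_graph_eq _ ?_
  rintro ⟨f, e⟩ ⟨g, hg, hg', -⟩ (rfl : f = 0)
  obtain rfl := hg.eq_zero
  exact neg_eq_zero.mp hg'.eq_zero

/-! ### The propagator -/

/-- `U` is the strongly continuous one-parameter unitary group `t ↦ e^{-iHt}` with infinitesimal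
generator `-iH`: the map `t ↦ U t x` has the derivative `y` at `0` exactly when `x ∈ D(H)` and
`y = -i H x`. -/
structure IsUnitaryGroupOf (H : L2 →ₗ.[ℂ] L2) (U : ℝ → L2 →L[ℂ] L2) : Prop where
  map_zero : U 0 = ContinuousLinearMap.id ℂ L2
  map_add : ∀ s t, U (s + t) = (U s).comp (U t)
  norm_map : ∀ t x, ‖U t x‖ = ‖x‖
  continuous : ∀ x, Continuous fun t => U t x
  generator : ∀ x y, HasDerivAt (fun t => U t x) y 0 ↔
    ∃ hx : x ∈ H.domain, y = -(Complex.I • H ⟨x, hx⟩)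

open scoped Classical in
/-- The unitary group `e^{-iHt}`.  By Stone's theorem it exists (and it is unique) for every
self-adjoint `H`; for the other operators the value is irrelevant. -/
def propagator (H : L2 →ₗ.[ℂ] L2) : ℝ → L2 →L[ℂ] L2 :=
  if h : ∃ U, IsUnitaryGroupOf H U then h.choose else 0

/-! ### Weak solutions -/

open scoped Classical in
/-- The function `|f|^{2μ} f` as an element of `L²(ℝ)`.  It does belong to `L²` when `f ∈ Q`, since
then `f` is bounded. -/
def nonlinearity (μ : ℝ) (f : L2) : L2 :=
  if h : MemLp (fun x => (‖f x‖ ^ (2 * μ) : ℝ) • f x) 2 (volume : Measure ℝ) then h.toLp _ else 0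

/-- The interval `[0, T)`, where `T` may be `∞`. -/
def timeInterval (T : EReal) : Set ℝ := {t | 0 ≤ t ∧ (t : EReal) < T}

/-- `ψ` is a weak solution on `[0, T)`, `0 < T ≤ ∞`: it belongs to `C⁰([0, T), Q)` and solves
`ψ(t) = e^{-iH_γ t} ψ₀ + iλ ∫₀ᵗ e^{-iH_γ (t-s)} |ψ(s)|^{2μ} ψ(s) ds` for every `t ∈ [0, T)`.
The values of `ψ` outside `[0, T)` are irrelevant. -/
structure IsWeakSolution (γ lam μ : ℝ) (ψ₀ : Q) (T : EReal) (ψ : ℝ → Q) : Prop where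
  pos : 0 < T
  continuousOn : ContinuousOn ψ (timeInterval T)
  duhamel : ∀ t ∈ timeInterval T,
    (ψ t).toL2 = propagator (hamiltonian γ) t ψ₀.toL2 +
      (Complex.I * lam) • ∫ s in (0 : ℝ)..t,
        propagator (hamiltonian γ) (t - s) (nonlinearity μ (ψ s).toL2)

/-- `ψ` is a maximal weak solution, with existence time `T`: it is a weak solution on `[0, T)`, and
no weak solution on a longer interval extends it. -/
structure IsMaximalWeakSolution (γ lam μ : ℝ) (ψ₀ : Q) (T : EReal) (ψ : ℝ → Q) : Prop where
  isWeakSolution : IsWeakSolution γ lam μ ψ₀ T ψ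
  maximal : ∀ (T' : EReal) (ψ' : ℝ → Q), IsWeakSolution γ lam μ ψ₀ T' ψ' →
    EqOn ψ' ψ (timeInterval T) → T' ≤ T

end

end DeltaPrimeNLS

/-!
The quadratic form `⟨u', v'⟩ + m⟨u, v⟩ - γ⁻¹ [u]^* [v]` of `H_γ + m`, where `[u] = u(0+) - u(0-)`
is the jump at the origin, is for large `m` an inner product on `Q` equivalent to the given one. If
`J` is the embedding of `Q` into `L²` and the adjoint is taken for this inner product, then
`J J† = (H_γ + m)⁻¹`. Functional calculus for the bounded self-adjoint operators `J† J` and `J J†`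
gives the groups `e^{-iH_γ t}` on `Q` and on `L²`, intertwined by `J`.

Truncating `|z|^{2μ} z` for large `|z|` yields a `C¹` function with bounded derivative. The
operator it defines is globally Lipschitz on `L²`. On `Q` it need not be Lipschitz, since its
derivative is only uniformly continuous, but bounded sequences in `Q` that converge in `L²`
converge uniformly, so that the Picard iterates of the truncated Duhamel equation still converge in
`Q`, globally in time.

The truncated flow conserves the `L²` norm and the energy. As `‖u‖²_∞` is bounded by a multiple of
`‖u‖_{L²} ‖u‖_Q`, the potential energy grows at most like `‖u‖_Q^μ`, where `μ < 2`. The two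
conservation laws therefore bound `‖u‖_∞`, independently of the level of truncation. A truncation
above that bound has no effect, which gives a global solution. Uniqueness is Gronwall's lemma in
`L²`.
-/

namespace DeltaPrimeNLS

noncomputable section

/-! ### Isometric groups -/

section DenseOrbits

variable {X Y : Type*} [NormedAddCommGroup X] [NormedSpace ℂ X] [NormedAddCommGroup Y]
  [NormedSpace ℂ Y]

theorem continuous_apply_of_denseRange {α ι : Type*} [TopologicalSpace α] {A : α → X →L[ℂ] Y}
    (hA : ∀ t x, ‖A t x‖ ≤ ‖x‖) {e : ι → X} (he : DenseRange e)
    (hcont : ∀ z, Continuous fun t => A t (e z)) (x : X) : Continuous fun t => A t x := by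
  refine continuous_of_uniform_approx_of_continuous fun u hu => ?_
  obtain ⟨ε, hε, hεu⟩ := Metric.mem_uniformity_dist.mp hu
  obtain ⟨z, hz⟩ := Metric.denseRange_iff.mp he x ε hε
  refine ⟨_, hcont z, fun t => hεu ?_⟩
  calc dist (A t x) (A t (e z)) = ‖A t (x - e z)‖ := by rw [dist_eq_norm, map_sub]
    _ ≤ dist x (e z) := (hA t _).trans_eq (dist_eq_norm x _).symm
    _ < ε := hz

theorem hasDerivAt_zero_of_denseRange {ι : Type*} {A : ℝ → X →L[ℂ] Y} {B : X →L[ℂ] Y} {C : ℝ}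
    (hA : ∀ t x, ‖A t x - A 0 x‖ ≤ C * |t| * ‖x‖) {e : ι → X} (he : DenseRange e)
    (hderiv : ∀ z, HasDerivAt (fun t => A t (e z)) (B (e z)) 0) (x : X) :
    HasDerivAt (fun t => A t x) (B x) 0 := by
  refine he.induction_on (p := fun x => HasDerivAt (fun t => A t x) (B x) 0) x ?_ hderiv
  refine isClosed_of_closure_subset fun x hx => ?_
  rw [mem_ofPred_eq, hasDerivAt_iff_isLittleO, Asymptotics.isLittleO_iff]
  intro c hc
  have hK : 0 < |C| + ‖B‖ + 1 := by positivity
  obtain ⟨z, hz, hxz⟩ := Metric.mem_closure_iff.mp hx (c / 2 / (|C| + ‖B‖ + 1)) (by positivity)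
  have hsmall : (|C| + ‖B‖) * ‖x - z‖ ≤ c / 2 := by
    rw [dist_eq_norm, lt_div_iff₀ hK] at hxz
    nlinarith [norm_nonneg (x - z)]
  filter_upwards [(hasDerivAt_iff_isLittleO.mp hz).def (half_pos hc)] with t ht
  rw [sub_zero] at ht ⊢
  have hsplit : A t x - A 0 x - t • B x =
      (A t (x - z) - A 0 (x - z)) - t • B (x - z) + (A t z - A 0 z - t • B z) := by
    simp only [map_sub, smul_sub]; abel
  have hB : ‖t • B (x - z)‖ ≤ |t| * (‖B‖ * ‖x - z‖) := by
    rw [norm_smul, Real.norm_eq_abs]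
    gcongr
    exact B.le_opNorm _
  have hC : C * |t| * ‖x - z‖ ≤ |C| * |t| * ‖x - z‖ := by
    gcongr
    exact le_abs_self C
  rw [Real.norm_eq_abs] at ht ⊢
  calc ‖A t x - A 0 x - t • B x‖
      ≤ ‖A t (x - z) - A 0 (x - z)‖ + ‖t • B (x - z)‖ + ‖A t z - A 0 z - t • B z‖ := by
        rw [hsplit]
        exact (norm_add_le _ _).trans (by gcongr; exact norm_sub_le _ _)
    _ ≤ |t| * ((|C| + ‖B‖) * ‖x - z‖) + c / 2 * |t| := by linarith [hA t (x - z)]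
    _ ≤ c * |t| := by nlinarith [abs_nonneg t]

end DenseOrbits

/-- A strongly continuous one-parameter group of linear isometries. -/
structure IsIsometricGroup {X : Type*} [NormedAddCommGroup X] [NormedSpace ℂ X]
    (U : ℝ → X →L[ℂ] X) : Prop where
  map_zero : U 0 = ContinuousLinearMap.id ℂ X
  map_add : ∀ s t, U (s + t) = (U s).comp (U t)
  norm_map : ∀ t x, ‖U t x‖ = ‖x‖
  continuous : ∀ x, Continuous fun t => U t x

theorem IsUnitaryGroupOf.isIsometricGroup {H : L2 →ₗ.[ℂ] L2} {U : ℝ → L2 →L[ℂ] L2}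
    (hU : IsUnitaryGroupOf H U) : IsIsometricGroup U :=
  ⟨hU.map_zero, hU.map_add, hU.norm_map, hU.continuous⟩

namespace IsIsometricGroup

variable {X Y : Type*} [NormedAddCommGroup X] [NormedSpace ℂ X] [NormedAddCommGroup Y]
  [NormedSpace ℂ Y] {U : ℝ → X →L[ℂ] X} {V : ℝ → Y →L[ℂ] Y}

theorem zero_apply (hU : IsIsometricGroup U) (x : X) : U 0 x = x := by
  rw [hU.map_zero, ContinuousLinearMap.id_apply]

theorem apply_apply (hU : IsIsometricGroup U) (s t : ℝ) (x : X) : U s (U t x) = U (s + t) x := by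
  rw [hU.map_add, ContinuousLinearMap.comp_apply]

theorem apply_neg_apply (hU : IsIsometricGroup U) (t : ℝ) (x : X) : U t (U (-t) x) = x := by
  rw [hU.apply_apply, add_neg_cancel, hU.zero_apply]

theorem inner_map_map {X : Type*} [NormedAddCommGroup X] [InnerProductSpace ℂ X]
    {U : ℝ → X →L[ℂ] X} (hU : IsIsometricGroup U) (t : ℝ) (x y : X) :
    inner ℂ (U t x) (U t y) = inner ℂ x y :=
  LinearIsometry.inner_map_map ⟨(U t).toLinearMap, hU.norm_map t⟩ x y

theorem continuous_uncurry (hU : IsIsometricGroup U) :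
    Continuous fun p : ℝ × X => U p.1 p.2 :=
  continuous_prod_of_continuous_lipschitzWith' (fun p : ℝ × X => U p.1 p.2) 1
    (fun t => LipschitzWith.of_dist_le_mul fun x y => by
      rw [dist_eq_norm, dist_eq_norm, ← map_sub, hU.norm_map, NNReal.coe_one, one_mul])
    hU.continuous

theorem hasDerivAt_of_hasDerivAt_zero (hU : IsIsometricGroup U) {x y : X}
    (h : HasDerivAt (fun t => U t x) y 0) (t : ℝ) : HasDerivAt (fun t => U t x) (U t y) t := by
  have hshift : HasDerivAt (fun s => U (s - t) x) y t :=
    HasDerivAt.comp_sub_const t t (f := fun t => U t x) (by simpa only [sub_self] using h)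
  refine (((U t).restrictScalars ℝ).hasFDerivAt.comp_hasDerivAt t hshift).congr_of_eventuallyEq
    (Eventually.of_forall fun s => ?_)
  simp only [Function.comp_apply, ContinuousLinearMap.coe_restrictScalars', hU.apply_apply,
    add_sub_cancel]

theorem exp_smul (hU : IsIsometricGroup U) (m : ℝ) :
    IsIsometricGroup fun t => Complex.exp (Complex.I * (m * t : ℝ)) • U t where
  map_zero := by simp [hU.map_zero]
  map_add s t := by
    ext x
    simp only [smul_apply, ContinuousLinearMap.comp_apply, map_smul, smul_smul, hU.apply_apply,
      ← Complex.exp_add]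
    congr 2
    push_cast
    ring
  norm_map t x := by
    rw [smul_apply, norm_smul, mul_comm Complex.I, Complex.norm_exp_ofReal_mul_I, one_mul,
      hU.norm_map]
  continuous x := by
    have := hU.continuous x
    simp only [smul_apply]
    fun_prop

/-- The curve `s ↦ V (t - s) (J (U s (R z)))` joining `V t (J (R z))` to `J (U t (R z))` is
constant, since its derivative is `V (t - s)` applied to `J B - J B = 0`. -/
theorem apply_map_eq_map_apply (hU : IsIsometricGroup U) (hV : IsIsometricGroup V)
    {J : X →L[ℂ] Y} {R B : X →L[ℂ] X} (hR : DenseRange R) (hRU : ∀ t x, U t (R x) = R (U t x))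
    (hUR : ∀ x, HasDerivAt (fun t => U t (R x)) (B x) 0)
    (hVR : ∀ x, HasDerivAt (fun t => V t (J (R x))) (J (B x)) 0) (t : ℝ) (x : X) :
    J (U t x) = V t (J x) := by
  refine hR.induction_on x (isClosed_eq (by fun_prop) (by fun_prop)) fun z => ?_
  have hderiv (s : ℝ) : HasDerivAt (fun s => V (t - s) (J (U s (R z)))) 0 s := by
    have hzero : HasDerivAt (fun h => J (U h (R (U s z))) - V h (J (R (U s z)))) 0 0 := by
      have hJU : HasDerivAt (fun h => J (U h (R (U s z)))) (J (B (U s z))) 0 :=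
        (J.restrictScalars ℝ).hasFDerivAt.comp_hasDerivAt _ (hUR (U s z))
      simpa only [sub_self] using! hJU.sub (hVR (U s z))
    have hshift : HasDerivAt (fun r => J (U (r - s) (R (U s z))) - V (r - s) (J (R (U s z)))) 0 s :=
      HasDerivAt.comp_sub_const s s
        (f := fun h => J (U h (R (U s z))) - V h (J (R (U s z))))
        (by simpa only [sub_self] using hzero)
    rw [hasDerivAt_iff_isLittleO] at hshift ⊢
    refine Asymptotics.isLittleO_norm_left.mp
      ((Asymptotics.isLittleO_norm_left.mpr hshift).congr_left fun r => ?_)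
    have hUr : U r (R z) = U (r - s) (R (U s z)) := by
      rw [← hRU, hU.apply_apply, sub_add_cancel]
    have hVs : V (t - s) (J (U s (R z))) = V (t - r) (V (r - s) (J (R (U s z)))) := by
      rw [hV.apply_apply, sub_add_sub_cancel, hRU]
    rw [hUr, hVs, ← map_sub, smul_zero, sub_zero, sub_zero, hV.norm_map]
    simp [hU.map_zero, hV.map_zero]
  simpa [hV.map_zero, hU.map_zero] using is_const_of_deriv_eq_zero
    (fun s => (hderiv s).differentiableAt) (fun s => (hderiv s).deriv) t 0

end IsIsometricGroup

/-- `U` is the isometric group with infinitesimal generator `-i(R⁻¹ - m)`, where `R` is injective.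
The generator is described on its domain, the range of `R`. -/
structure IsShiftedInverseGroup {X : Type*} [NormedAddCommGroup X] [NormedSpace ℂ X]
    (m : ℝ) (R : X →L[ℂ] X) (U : ℝ → X →L[ℂ] X) : Prop
    extends IsIsometricGroup U where
  apply_comm : ∀ t x, U t (R x) = R (U t x)
  hasDerivAt_zero : ∀ x, HasDerivAt (fun t => U t (R x)) (-(Complex.I • (x - (m : ℂ) • R x))) 0

theorem IsShiftedInverseGroup.hasDerivAt_zero_iff {X : Type*} [NormedAddCommGroup X]
    [NormedSpace ℂ X] {m : ℝ} {R : X →L[ℂ] X} {U : ℝ → X →L[ℂ] X}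
    (hU : IsShiftedInverseGroup m R U) (x y : X) :
    HasDerivAt (fun t => U t x) y 0 ↔ ∃ w, x = R w ∧ y = -(Complex.I • (w - (m : ℂ) • x)) := by
  constructor
  · intro h
    have hRy : HasDerivAt (fun t => U t (R x)) (R y) 0 :=
      ((R.restrictScalars ℝ).hasFDerivAt.comp_hasDerivAt _ h).congr_of_eventuallyEq
        (Eventually.of_forall fun t => hU.apply_comm t x)
    have hx : x = R (Complex.I • y + (m : ℂ) • x) := by
      rw [map_add, map_smul, map_smul, hRy.unique (hU.hasDerivAt_zero x), smul_neg, smul_smul,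
        Complex.I_mul_I, neg_one_smul, neg_neg, sub_add_cancel]
    refine ⟨_, hx, ?_⟩
    rw [add_sub_cancel_right, smul_smul, Complex.I_mul_I, neg_one_smul, neg_neg]
  · rintro ⟨w, rfl, rfl⟩
    exact hU.hasDerivAt_zero w

/-! ### Unitary groups generated by the inverse of a bounded self-adjoint operator -/

/-- The function `x ↦ x e^{-it/x}`, which vanishes at `x = 0`. The factor `x` tames the oscillation
at the origin, so that the function is continuous and the functional calculus applies to it. -/
def dampedPhase (t x : ℝ) : ℂ := x * Complex.exp (Complex.I * (-(t / x) : ℝ))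

theorem dampedPhase_zero (x : ℝ) : dampedPhase 0 x = x := by simp [dampedPhase]

theorem norm_dampedPhase (t x : ℝ) : ‖dampedPhase t x‖ = |x| := by
  rw [dampedPhase, norm_mul, mul_comm Complex.I, Complex.norm_exp_ofReal_mul_I, mul_one,
    Complex.norm_real, Real.norm_eq_abs]

theorem star_dampedPhase_mul_self (t x : ℝ) : star (dampedPhase t x) * dampedPhase t x = x * x := by
  rw [Complex.star_def, Complex.conj_mul', norm_dampedPhase, ← Complex.ofReal_pow, sq_abs, sq,
    Complex.ofReal_mul]

theorem dampedPhase_mul (s t x : ℝ) :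
    dampedPhase s x * dampedPhase t x = x * dampedPhase (s + t) x := by
  unfold dampedPhase
  rw [mul_mul_mul_comm, ← Complex.exp_add, mul_assoc]
  congr 3
  push_cast
  ring

theorem continuous_dampedPhase (t : ℝ) : Continuous (dampedPhase t) := by
  rw [continuous_iff_continuousAt]
  intro x
  rcases eq_or_ne x 0 with rfl | hx
  · rw [ContinuousAt, show dampedPhase t 0 = 0 by simp [dampedPhase]]
    refine squeeze_zero_norm (a := fun x => |x|) (fun x => (norm_dampedPhase t x).le) ?_
    simpa using (continuous_abs (G := ℝ)).tendsto 0
  · have hphase : ContinuousAt (fun x : ℝ => ((-(t / x) : ℝ) : ℂ)) x :=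
      Complex.continuous_ofReal.continuousAt.comp (continuousAt_const.div continuousAt_id hx).neg
    exact Complex.continuous_ofReal.continuousAt.mul (continuousAt_const.mul hphase).cexp

theorem norm_dampedPhase_sub_le (s t x : ℝ) : ‖dampedPhase s x - dampedPhase t x‖ ≤ |s - t| := by
  rcases eq_or_ne x 0 with rfl | hx
  · simp [dampedPhase]
  have hfactor : dampedPhase s x - dampedPhase t x =
      dampedPhase t x * (Complex.exp (Complex.I * (-((s - t) / x) : ℝ)) - 1) := by
    rw [dampedPhase, dampedPhase, mul_sub, mul_assoc, ← Complex.exp_add, mul_one]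
    congr 3
    push_cast
    ring
  calc ‖dampedPhase s x - dampedPhase t x‖
      = |x| * ‖Complex.exp (Complex.I * (-((s - t) / x) : ℝ)) - 1‖ := by
        rw [hfactor, norm_mul, norm_dampedPhase]
    _ ≤ |x| * ‖-((s - t) / x)‖ := by gcongr; exact Real.norm_exp_I_mul_ofReal_sub_one_le
    _ = |s - t| := by
        rw [norm_neg, norm_div, Real.norm_eq_abs, Real.norm_eq_abs,
          mul_div_cancel₀ _ (abs_ne_zero.mpr hx)]

theorem norm_exp_I_mul_sub_one_sub_le (y : ℝ) :
    ‖Complex.exp (Complex.I * y) - 1 - Complex.I * y‖ ≤ 2 * y ^ 2 := by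
  have hy : ‖Complex.I * (y : ℂ)‖ = |y| := by simp
  rcases le_or_gt |y| 1 with hsmall | hlarge
  · have := Complex.norm_exp_sub_one_sub_id_le (x := Complex.I * y) (by rwa [hy])
    rw [hy, sq_abs] at this
    nlinarith [sq_nonneg y]
  · calc ‖Complex.exp (Complex.I * y) - 1 - Complex.I * y‖
        ≤ ‖Complex.exp (Complex.I * y) - 1‖ + ‖Complex.I * (y : ℂ)‖ := norm_sub_le _ _
      _ ≤ |y| + |y| := by rw [hy]; gcongr; exact Real.norm_exp_I_mul_ofReal_sub_one_le
      _ ≤ 2 * y ^ 2 := by rw [← sq_abs y]; nlinarith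

theorem norm_dampedPhase_sub_add_mul_le (t x : ℝ) :
    ‖(dampedPhase t x - x + Complex.I * t) * x‖ ≤ 2 * t ^ 2 := by
  rcases eq_or_ne x 0 with rfl | hx
  · rw [Complex.ofReal_zero, mul_zero, norm_zero]
    positivity
  have hxc : (x : ℂ) ≠ 0 := Complex.ofReal_ne_zero.mpr hx
  have hfactor : (dampedPhase t x - x + Complex.I * t) * x = (x : ℂ) ^ 2 *
      (Complex.exp (Complex.I * (-(t / x) : ℝ)) - 1 - Complex.I * (-(t / x) : ℝ)) := by
    unfold dampedPhase
    push_cast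
    field_simp
    ring
  calc ‖(dampedPhase t x - x + Complex.I * t) * x‖
      ≤ x ^ 2 * (2 * (-(t / x)) ^ 2) := by
        rw [hfactor, norm_mul, norm_pow, Complex.norm_real, Real.norm_eq_abs, sq_abs]
        gcongr
        exact norm_exp_I_mul_sub_one_sub_le _
    _ = 2 * t ^ 2 := by field_simp

section InverseGroup

variable {X : Type*} [NormedAddCommGroup X] [InnerProductSpace ℂ X] [CompleteSpace X]

theorem norm_apply_eq_of_star_mul_self_eq {A B : X →L[ℂ] X} (h : star A * A = star B * B) (x : X) :
    ‖A x‖ = ‖B x‖ := by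
  rw [A.apply_norm_eq_sqrt_inner_adjoint_left, B.apply_norm_eq_sqrt_inner_adjoint_left]
  exact congrArg (fun T : X →L[ℂ] X => √(RCLike.re (inner ℂ (T x) x))) h

/-- The operator `R e^{-itR⁻¹}`, for a bounded self-adjoint `R`. -/
def dampedGroup (R : X →L[ℂ] X) (t : ℝ) : X →L[ℂ] X := cfc (fun z : ℂ => dampedPhase t z.re) R

/-- The unitary group `e^{-itR⁻¹}`, for an injective bounded self-adjoint `R`: it is the extension
of `R x ↦ R e^{-itR⁻¹} x` from the range of `R`, which is dense. -/
def inverseGroup (R : X →L[ℂ] X) (t : ℝ) : X →L[ℂ] X :=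
  (dampedGroup R t).toLinearMap.extendOfNorm R.toLinearMap

variable {R : X →L[ℂ] X}

theorem continuous_dampedPhase_re (t : ℝ) : Continuous fun z : ℂ => dampedPhase t z.re :=
  (continuous_dampedPhase t).comp Complex.continuous_re

theorem continuous_ofReal_re : Continuous fun z : ℂ => (z.re : ℂ) :=
  Complex.continuous_ofReal.comp Complex.continuous_re

theorem cfc_ofReal_re (hR : IsSelfAdjoint R) : cfc (fun z : ℂ => (z.re : ℂ)) R = R := by
  rw [cfc_congr (g := id) fun z hz => (hR.mem_spectrum_eq_re hz).symm, cfc_id ℂ R hR.isStarNormal]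

theorem cfc_mul_self (hR : IsSelfAdjoint R) {f : ℂ → ℂ} (hf : Continuous f) :
    cfc (fun z => f z * z.re) R = cfc f R * R := by
  rw [cfc_mul (hf := hf.continuousOn) (hg := continuous_ofReal_re.continuousOn), cfc_ofReal_re hR]

theorem dampedGroup_zero (hR : IsSelfAdjoint R) : dampedGroup R 0 = R := by
  simp only [dampedGroup, dampedPhase_zero, cfc_ofReal_re hR]

theorem dampedGroup_mul (hR : IsSelfAdjoint R) (s t : ℝ) :
    dampedGroup R s * dampedGroup R t = dampedGroup R (s + t) * R := by
  simp only [dampedGroup, ← cfc_mul_self hR (continuous_dampedPhase_re (s + t)),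
    ← cfc_mul _ _ R (continuous_dampedPhase_re s).continuousOn
      (continuous_dampedPhase_re t).continuousOn, dampedPhase_mul, mul_comm]

theorem dampedGroup_commute (hR : IsSelfAdjoint R) (t : ℝ) :
    R * dampedGroup R t = dampedGroup R t * R := by
  simpa only [dampedGroup_zero hR, zero_add] using dampedGroup_mul hR 0 t

theorem norm_dampedGroup_apply (hR : IsSelfAdjoint R) (t : ℝ) (x : X) :
    ‖dampedGroup R t x‖ = ‖R x‖ := by
  refine norm_apply_eq_of_star_mul_self_eq ?_ x
  rw [dampedGroup, ← cfc_star, ← cfc_mul _ _ R (continuous_dampedPhase_re t).star.continuousOn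
    (continuous_dampedPhase_re t).continuousOn]
  simp only [star_dampedPhase_mul_self, cfc_mul_self hR continuous_ofReal_re, cfc_ofReal_re hR,
    hR.star_eq]

theorem norm_dampedGroup_sub_le (s t : ℝ) :
    ‖dampedGroup R s - dampedGroup R t‖ ≤ |s - t| := by
  rw [dampedGroup, dampedGroup, ← cfc_sub (hf := (continuous_dampedPhase_re s).continuousOn)
    (hg := (continuous_dampedPhase_re t).continuousOn)]
  exact norm_cfc_le (abs_nonneg _) fun z _ => norm_dampedPhase_sub_le s t z.re

theorem continuous_dampedGroup (R : X →L[ℂ] X) : Continuous (dampedGroup R) :=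
  (LipschitzWith.of_dist_le_mul (K := 1) fun s t => by
    simpa only [dist_eq_norm, NNReal.coe_one, one_mul, Real.norm_eq_abs]
      using norm_dampedGroup_sub_le s t).continuous

theorem norm_dampedGroup_sub_add_le (hR : IsSelfAdjoint R) (t : ℝ) (x : X) :
    ‖dampedGroup R t (R x) - R (R x) + (Complex.I * t) • R x‖ ≤ 2 * t ^ 2 * ‖x‖ := by
  have hsub : Continuous fun z : ℂ => dampedPhase t z.re - z.re :=
    (continuous_dampedPhase_re t).sub continuous_ofReal_re
  have hcfc : (dampedGroup R t - R + algebraMap ℂ _ (Complex.I * t)) * R =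
      cfc (fun z : ℂ => (dampedPhase t z.re - z.re + Complex.I * t) * z.re) R := by
    rw [cfc_mul_self (f := fun z => dampedPhase t z.re - z.re + Complex.I * t) hR
      (hsub.add continuous_const), cfc_add_const (hf := hsub.continuousOn),
      cfc_sub (hf := (continuous_dampedPhase_re t).continuousOn)
        (hg := continuous_ofReal_re.continuousOn), cfc_ofReal_re hR, dampedGroup]
  have happly : dampedGroup R t (R x) - R (R x) + (Complex.I * t) • R x =
      ((dampedGroup R t - R + algebraMap ℂ _ (Complex.I * t)) * R) x := by
    simp [Algebra.algebraMap_eq_smul_one]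
  rw [happly, hcfc]
  refine ContinuousLinearMap.le_of_opNorm_le _ ?_ _
  exact norm_cfc_le (by positivity) fun z _ => norm_dampedPhase_sub_add_mul_le t z.re

theorem denseRange_of_isSelfAdjoint_of_injective (hR : IsSelfAdjoint R)
    (hinj : Function.Injective R) : DenseRange R := by
  have hclosure : (LinearMap.range R.toLinearMap).topologicalClosure = ⊤ := by
    rw [Submodule.topologicalClosure_eq_top_iff, ContinuousLinearMap.orthogonal_range,
      ← ContinuousLinearMap.star_eq_adjoint, hR.star_eq]
    exact LinearMap.ker_eq_bot.mpr hinj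
  exact Submodule.dense_iff_topologicalClosure_eq_top.mpr hclosure

theorem hasDerivAt_dampedGroup_zero (hR : IsSelfAdjoint R) (hinj : Function.Injective R) (x : X) :
    HasDerivAt (fun t => dampedGroup R t x) (-(Complex.I • x)) 0 := by
  refine hasDerivAt_zero_of_denseRange (B := -(Complex.I • ContinuousLinearMap.id ℂ X)) (C := 1)
    (fun t y => ?_) (denseRange_of_isSelfAdjoint_of_injective hR hinj) (fun z => ?_) x
  · rw [← sub_apply, one_mul]
    simpa only [sub_zero] using
      ContinuousLinearMap.le_of_opNorm_le _ (norm_dampedGroup_sub_le t 0) y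
  · rw [hasDerivAt_iff_isLittleO]
    refine Asymptotics.IsBigO.trans_isLittleO (g := fun t : ℝ => t ^ 2) ?_ ?_
    · refine Asymptotics.IsBigO.of_bound (2 * ‖z‖) (Eventually.of_forall fun t => ?_)
      calc _ = ‖dampedGroup R t (R z) - R (R z) + (Complex.I * t) • R z‖ := by
            congr 1
            rw [dampedGroup_zero hR, sub_zero, neg_apply, smul_neg, sub_neg_eq_add, mul_comm,
              mul_smul]
            rfl
        _ ≤ 2 * t ^ 2 * ‖z‖ := norm_dampedGroup_sub_add_le hR t z
        _ = 2 * ‖z‖ * ‖t ^ 2‖ := by rw [Real.norm_of_nonneg (sq_nonneg t)]; ring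
    · simpa only [sub_zero, one_lt_two, pow_one] using
        Asymptotics.isLittleO_pow_pow (𝕜 := ℝ) one_lt_two

theorem inverseGroup_apply (hR : IsSelfAdjoint R) (hinj : Function.Injective R) (t : ℝ) (x : X) :
    inverseGroup R t (R x) = dampedGroup R t x :=
  LinearMap.extendOfNorm_eq (f := (dampedGroup R t).toLinearMap) (e := R.toLinearMap)
    (denseRange_of_isSelfAdjoint_of_injective hR hinj)
    ⟨1, fun x => by simpa using (norm_dampedGroup_apply hR t x).le⟩ x

theorem norm_inverseGroup_apply (hR : IsSelfAdjoint R) (hinj : Function.Injective R) (t : ℝ)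
    (x : X) : ‖inverseGroup R t x‖ = ‖x‖ := by
  refine (denseRange_of_isSelfAdjoint_of_injective hR hinj).induction_on x
    (isClosed_eq (by fun_prop) (by fun_prop)) fun y => ?_
  rw [inverseGroup_apply hR hinj, norm_dampedGroup_apply hR]

theorem inverseGroup_apply_comm (hR : IsSelfAdjoint R) (hinj : Function.Injective R) (t : ℝ)
    (x : X) : inverseGroup R t (R x) = R (inverseGroup R t x) := by
  refine (denseRange_of_isSelfAdjoint_of_injective hR hinj).induction_on x
    (isClosed_eq (by fun_prop) (by fun_prop)) fun y => ?_
  rw [inverseGroup_apply hR hinj, inverseGroup_apply hR hinj]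
  exact (DFunLike.congr_fun (dampedGroup_commute hR t) y).symm

theorem inverseGroup_add (hR : IsSelfAdjoint R) (hinj : Function.Injective R) (s t : ℝ) :
    inverseGroup R (s + t) = (inverseGroup R s).comp (inverseGroup R t) := by
  have hdense := denseRange_of_isSelfAdjoint_of_injective hR hinj
  ext x
  refine (hdense.comp hdense R.continuous).induction_on x
    (isClosed_eq (by fun_prop) (by fun_prop)) fun y => ?_
  simp only [Function.comp_apply, ContinuousLinearMap.comp_apply]
  rw [inverseGroup_apply hR hinj, inverseGroup_apply_comm hR hinj t, inverseGroup_apply hR hinj,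
    inverseGroup_apply hR hinj]
  exact (DFunLike.congr_fun (dampedGroup_mul hR s t) y).symm

theorem inverseGroup_zero (hR : IsSelfAdjoint R) (hinj : Function.Injective R) :
    inverseGroup R 0 = ContinuousLinearMap.id ℂ X := by
  ext x
  refine (denseRange_of_isSelfAdjoint_of_injective hR hinj).induction_on x
    (isClosed_eq (by fun_prop) (by fun_prop)) fun y => ?_
  rw [inverseGroup_apply hR hinj, dampedGroup_zero hR, ContinuousLinearMap.id_apply]

theorem isIsometricGroup_inverseGroup (hR : IsSelfAdjoint R) (hinj : Function.Injective R) :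
    IsIsometricGroup (inverseGroup R) where
  map_zero := inverseGroup_zero hR hinj
  map_add := inverseGroup_add hR hinj
  norm_map := norm_inverseGroup_apply hR hinj
  continuous := continuous_apply_of_denseRange (fun t y => (norm_inverseGroup_apply hR hinj t y).le)
    (denseRange_of_isSelfAdjoint_of_injective hR hinj) fun z => by
      simp only [inverseGroup_apply hR hinj]
      exact (continuous_dampedGroup R).clm_apply continuous_const

theorem exists_isShiftedInverseGroup (m : ℝ) (hR : IsSelfAdjoint R) (hinj : Function.Injective R) :
    ∃ U, IsShiftedInverseGroup m R U := by
  refine ⟨_, (isIsometricGroup_inverseGroup hR hinj).exp_smul m, fun t x => ?_, fun x => ?_⟩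
  · simp only [smul_apply, inverseGroup_apply_comm hR hinj, map_smul]
  · have hphase : HasDerivAt (fun t : ℝ => Complex.exp (Complex.I * (m * t : ℝ)))
        (Complex.I * m) 0 := by
      simpa using (((hasDerivAt_id (0 : ℝ)).const_mul m).ofReal_comp.const_mul Complex.I).cexp
    have hgroup : HasDerivAt (fun t => inverseGroup R t (R x)) (-(Complex.I • x)) 0 := by
      simpa only [inverseGroup_apply hR hinj] using hasDerivAt_dampedGroup_zero hR hinj x
    refine (hphase.smul hgroup).congr_deriv ?_
    simp only [mul_zero, Complex.ofReal_zero, Complex.exp_zero, inverseGroup_zero hR hinj, one_smul,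
      ContinuousLinearMap.id_apply, smul_sub, smul_smul]
    abel

end InverseGroup

/-! ### Intertwined groups -/

section GroupPair

open scoped InnerProduct

/-- The isometric group `U` with generator `-i((J† J)⁻¹ - m)`, together with an isometric group `V`
that the bounded operator `J` intertwines with `U`. -/
structure IsGroupPair {X Y : Type*} [NormedAddCommGroup X] [InnerProductSpace ℂ X]
    [CompleteSpace X] [NormedAddCommGroup Y] [InnerProductSpace ℂ Y] [CompleteSpace Y]
    (m : ℝ) (J : X →L[ℂ] Y) (U : ℝ → X →L[ℂ] X) (V : ℝ → Y →L[ℂ] Y) : Prop where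
  source : IsShiftedInverseGroup m (J† ∘L J) U
  target : IsIsometricGroup V
  map_apply : ∀ t x, J (U t x) = V t (J x)

variable {X Y : Type*} [NormedAddCommGroup X] [InnerProductSpace ℂ X] [CompleteSpace X]
  [NormedAddCommGroup Y] [InnerProductSpace ℂ Y] [CompleteSpace Y]

theorem isSelfAdjoint_adjoint_comp_self (J : X →L[ℂ] Y) : IsSelfAdjoint (J† ∘L J) := by
  rw [ContinuousLinearMap.isSelfAdjoint_iff', ContinuousLinearMap.adjoint_comp,
    ContinuousLinearMap.adjoint_adjoint]

theorem isSelfAdjoint_self_comp_adjoint (J : X →L[ℂ] Y) : IsSelfAdjoint (J ∘L J†) := by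
  simpa only [ContinuousLinearMap.adjoint_adjoint] using isSelfAdjoint_adjoint_comp_self (J†)

theorem self_comp_adjoint_injective {J : X →L[ℂ] Y} (hJ : ∀ y, (∀ x, inner ℂ y (J x) = 0) → y = 0) :
    Function.Injective (J ∘L J†) := by
  refine J.self_comp_adjoint_injective_iff.mpr ((injective_iff_map_eq_zero _).mpr ?_)
  refine fun y hy => hJ y fun x => ?_
  rw [← ContinuousLinearMap.adjoint_inner_left, hy, inner_zero_left]

theorem exists_isGroupPair {m : ℝ} {J : X →L[ℂ] Y} (hJ : Function.Injective J)
    {V : ℝ → Y →L[ℂ] Y} (hV : IsIsometricGroup V)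
    (hVJ : ∀ y, HasDerivAt (fun t => V t ((J ∘L J†) y))
      (-(Complex.I • (y - (m : ℂ) • (J ∘L J†) y))) 0) :
    ∃ U, IsGroupPair m J U V := by
  have hR := isSelfAdjoint_adjoint_comp_self J
  have hinj : Function.Injective (J† ∘L J) := J.adjoint_comp_self_injective_iff.mpr hJ
  obtain ⟨U, hU⟩ := exists_isShiftedInverseGroup m hR hinj
  refine ⟨U, hU, hV, hU.apply_map_eq_map_apply hV
    (B := -(Complex.I • (ContinuousLinearMap.id ℂ X - (m : ℂ) • (J† ∘L J))))
    (denseRange_of_isSelfAdjoint_of_injective hR hinj) hU.apply_comm hU.hasDerivAt_zero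
    fun x => (hVJ (J x)).congr_deriv ?_⟩
  simp

end GroupPair

section Resolvent

variable {H : L2 →ₗ.[ℂ] L2}

/-- Here `R` is the resolvent `(H + m)⁻¹`. -/
theorem IsShiftedInverseGroup.isUnitaryGroupOf {m : ℝ} {R : L2 →L[ℂ] L2} {U : ℝ → L2 →L[ℂ] L2}
    (hU : IsShiftedInverseGroup m R U)
    (hH : ∀ x y, (x, y) ∈ H.graph ↔ x = R (y + (m : ℂ) • x)) : IsUnitaryGroupOf H U where
  __ := hU.toIsIsometricGroup
  generator x y := by
    refine (hU.hasDerivAt_zero_iff x y).trans ⟨?_, ?_⟩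
    · rintro ⟨w, hw, rfl⟩
      obtain ⟨z, rfl, hz⟩ := (LinearPMap.mem_graph_iff H (x := (x, w - (m : ℂ) • x))).mp
        ((hH _ _).mpr (by rwa [sub_add_cancel]))
      exact ⟨z.2, by rw [hz]⟩
    · rintro ⟨hx, rfl⟩
      exact ⟨_, (hH _ _).mp (H.mem_graph ⟨x, hx⟩), by rw [add_sub_cancel_right]⟩

theorem IsUnitaryGroupOf.isUnitaryGroupOf_propagator {U : ℝ → L2 →L[ℂ] L2}
    (hU : IsUnitaryGroupOf H U) : IsUnitaryGroupOf H (propagator H) := by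
  have hex : ∃ U, IsUnitaryGroupOf H U := ⟨U, hU⟩
  rw [propagator, dif_pos hex]
  exact hex.choose_spec

end Resolvent

/-- `H + m` being represented by the form associated with the embedding `J`, the propagator of `H`
is transported to the form domain. -/
theorem exists_isGroupPair_propagator {X : Type*} [NormedAddCommGroup X] [InnerProductSpace ℂ X]
    [CompleteSpace X] {H : L2 →ₗ.[ℂ] L2} {m : ℝ} {J : X →L[ℂ] L2} (hJ : Function.Injective J)
    (hJ' : ∀ f, (∀ x, inner ℂ f (J x) = 0) → f = 0)
    (hH : ∀ f e, (f, e) ∈ H.graph ↔ f = J (J.adjoint (e + (m : ℂ) • f))) :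
    ∃ U, IsGroupPair m J U (propagator H) := by
  obtain ⟨U, hU⟩ := exists_isShiftedInverseGroup m (isSelfAdjoint_self_comp_adjoint J)
    (self_comp_adjoint_injective hJ')
  have hUH := hU.isUnitaryGroupOf hH
  have hprop := hUH.isUnitaryGroupOf_propagator
  exact exists_isGroupPair hJ hprop.isIsometricGroup fun y =>
    (hprop.generator _ _).mpr ((hUH.generator _ _).mp (hU.hasDerivAt_zero y))

/-! ### Primitives of locally integrable functions -/

section Prim

variable {E F : Type*} [NormedAddCommGroup E] [NormedAddCommGroup F]

theorem intervalIntegrable_of_locallyIntegrable {g : ℝ → E} (hg : LocallyIntegrable g) (a b : ℝ) :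
    IntervalIntegrable g volume a b :=
  intervalIntegrable_iff.mpr ((hg.integrableOn_isCompact isCompact_uIcc).mono_set uIoc_subset_uIcc)

theorem locallyIntegrable_norm {g : ℝ → E} (hg : LocallyIntegrable g) :
    LocallyIntegrable fun x => ‖g x‖ := by
  rw [locallyIntegrable_iff] at hg ⊢
  exact fun k hk => (hg k hk).norm

variable [NormedSpace ℝ E] [NormedSpace ℝ F]

/-- The primitive of `g` with the value `a` at `0`. -/
def prim (a : E) (g : ℝ → E) (x : ℝ) : E := a + ∫ t in (0 : ℝ)..x, g t

@[simp] theorem prim_zero (a : E) (g : ℝ → E) : prim a g 0 = a := by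
  rw [prim, intervalIntegral.integral_same, add_zero]

theorem prim_sub_prim (a : E) {g : ℝ → E} (hg : LocallyIntegrable g) (x y : ℝ) :
    prim a g x - prim a g y = ∫ t in y..x, g t := by
  rw [prim, prim, add_sub_add_left_eq_sub, intervalIntegral.integral_interval_sub_left
    (intervalIntegrable_of_locallyIntegrable hg _ _)
    (intervalIntegrable_of_locallyIntegrable hg _ _)]

theorem continuous_prim (a : E) {g : ℝ → E} (hg : LocallyIntegrable g) : Continuous (prim a g) :=
  continuous_const.add (intervalIntegral.continuous_primitive
    (fun _ _ => intervalIntegrable_of_locallyIntegrable hg _ _) 0)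

theorem ae_hasDerivAt_prim [CompleteSpace E] (a : E) {g : ℝ → E} (hg : LocallyIntegrable g) :
    ∀ᵐ x, HasDerivAt (prim a g) (g x) x := by
  filter_upwards [LocallyIntegrable.ae_hasDerivAt_integral hg] with x hx
  exact (hx 0).const_add a

theorem absolutelyContinuousOnInterval_of_dist_le {X Y : Type*} [PseudoMetricSpace X]
    [PseudoMetricSpace Y] {f : ℝ → X} {h : ℝ → Y} {a b C : ℝ}
    (hh : AbsolutelyContinuousOnInterval h a b)
    (hd : ∀ x ∈ uIcc a b, ∀ y ∈ uIcc a b, dist (f x) (f y) ≤ C * dist (h x) (h y)) :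
    AbsolutelyContinuousOnInterval f a b := by
  have hCh := Filter.Tendsto.const_mul C hh
  rw [mul_zero] at hCh
  refine squeeze_zero' (Eventually.of_forall fun _ => Finset.sum_nonneg fun _ _ => dist_nonneg)
    ?_ hCh
  refine eventually_inf_principal.mpr (Eventually.of_forall fun I hI => ?_)
  rw [Finset.mul_sum]
  exact Finset.sum_le_sum fun i hi => hd _ (hI.1 i hi).1 _ (hI.1 i hi).2

theorem absolutelyContinuousOnInterval_prim (a : E) {g : ℝ → E} (hg : LocallyIntegrable g)
    (p q : ℝ) : AbsolutelyContinuousOnInterval (prim a g) p q := by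
  have h_int := intervalIntegrable_of_locallyIntegrable (locallyIntegrable_norm hg)
  refine absolutelyContinuousOnInterval_of_dist_le (C := 1)
    ((h_int p q).absolutelyContinuousOnInterval_intervalIntegral left_mem_uIcc) fun x _ y _ => ?_
  rw [one_mul, dist_eq_norm, prim_sub_prim a hg, dist_eq_norm,
    intervalIntegral.integral_interval_sub_left (h_int _ _) (h_int _ _)]
  exact intervalIntegral.norm_integral_le_abs_integral_norm

theorem prim_prodMk [CompleteSpace E] [CompleteSpace F] (a : E) (b : F) {g : ℝ → E} {h : ℝ → F}
    (hgh : LocallyIntegrable fun t => (g t, h t)) (x : ℝ) :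
    prim (a, b) (fun t => (g t, h t)) x = (prim a g x, prim b h x) := by
  have h_int := intervalIntegrable_of_locallyIntegrable hgh 0 x
  ext
  · simpa [prim] using ((ContinuousLinearMap.fst ℝ E F).intervalIntegral_comp_comm h_int).symm
  · simpa [prim] using ((ContinuousLinearMap.snd ℝ E F).intervalIntegral_comp_comm h_int).symm

theorem locallyIntegrable_fderiv_prim {Φ : E → F} (hΦ : ContDiff ℝ 1 Φ) (a : E) {g : ℝ → E}
    (hg : LocallyIntegrable g) : LocallyIntegrable fun x => fderiv ℝ Φ (prim a g x) (g x) := by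
  have hc : Continuous fun x => fderiv ℝ Φ (prim a g x) :=
    (hΦ.continuous_fderiv one_ne_zero).comp (continuous_prim a hg)
  rw [locallyIntegrable_iff]
  intro k hk
  obtain ⟨C, hC⟩ := (hk.image hc).isBounded.exists_norm_le
  refine Integrable.mono' (((hg.integrableOn_isCompact hk).norm).const_mul C) ?_ ?_
  · exact (ContinuousLinearMap.id ℝ (E →L[ℝ] F)).aestronglyMeasurable_comp₂
      hc.aestronglyMeasurable (hg.integrableOn_isCompact hk).aestronglyMeasurable
  · refine (ae_restrict_iff' hk.measurableSet).mpr (Eventually.of_forall fun x hx => ?_)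
    exact ContinuousLinearMap.le_of_opNorm_le _ (hC _ (mem_image_of_mem _ hx)) _

theorem exists_norm_sub_le_of_contDiff [CompleteSpace E] {Φ : E → F} (hΦ : ContDiff ℝ 1 Φ)
    {K : Set E} (hK : IsCompact K) : ∃ C, ∀ x ∈ K, ∀ y ∈ K, ‖Φ x - Φ y‖ ≤ C * ‖x - y‖ := by
  have hL : IsCompact (closure (convexHull ℝ K)) :=
    (totallyBounded_convexHull.mpr hK.totallyBounded).closure.isCompact_of_isClosed isClosed_closure
  obtain ⟨C, hC⟩ := (hL.image (hΦ.continuous_fderiv one_ne_zero)).isBounded.exists_norm_le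
  have hKL : K ⊆ closure (convexHull ℝ K) := (subset_convexHull ℝ K).trans subset_closure
  exact ⟨C, fun x hx y hy => (convex_convexHull ℝ K).closure.norm_image_sub_le_of_norm_fderiv_le
    (fun z _ => hΦ.differentiable one_ne_zero z) (fun z hz => hC _ (mem_image_of_mem _ hz))
    (hKL hy) (hKL hx)⟩

theorem comp_prim [CompleteSpace E] [CompleteSpace F] {Φ : E → F} (hΦ : ContDiff ℝ 1 Φ) (a : E)
    {g : ℝ → E} (hg : LocallyIntegrable g) (x : ℝ) :
    Φ (prim a g x) = prim (Φ a) (fun t => fderiv ℝ Φ (prim a g t) (g t)) x := by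
  have hl := locallyIntegrable_fderiv_prim hΦ a hg
  set D := prim (Φ a) (fun t => fderiv ℝ Φ (prim a g t) (g t))
  obtain ⟨C, hC⟩ := exists_norm_sub_le_of_contDiff hΦ
    ((isCompact_uIcc (a := 0) (b := x)).image (continuous_prim a hg))
  have hac : AbsolutelyContinuousOnInterval (fun t => Φ (prim a g t)) 0 x := by
    refine absolutelyContinuousOnInterval_of_dist_le (C := C)
      (absolutelyContinuousOnInterval_prim a hg 0 x) fun s hs t ht => ?_
    rw [dist_eq_norm, dist_eq_norm]
    exact hC _ (mem_image_of_mem _ hs) _ (mem_image_of_mem _ ht)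
  have hderiv : ∀ᵐ t, HasDerivAt (fun t => Φ (prim a g t) - D t) 0 t := by
    filter_upwards [ae_hasDerivAt_prim a hg, ae_hasDerivAt_prim (Φ a) hl] with t hprim hD
    simpa only [Function.comp_apply, sub_self] using!
      ((hΦ.differentiable one_ne_zero (prim a g t)).hasFDerivAt.comp_hasDerivAt t hprim).sub hD
  have hsub := hac.sub (absolutelyContinuousOnInterval_prim (Φ a) hl 0 x)
  obtain ⟨c, hc⟩ := hsub.const_of_ae_hasDerivAt_zero (hderiv.mono fun _ h _ => h)
  have hzero : 0 = c := by simpa only [Pi.sub_apply, prim_zero, sub_self] using hc 0 left_mem_uIcc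
  exact sub_eq_zero.mp ((hc x right_mem_uIcc).trans hzero.symm)

theorem intervalIntegral_eq_of_ae_pos {g₁ g₂ : ℝ → E} (h : ∀ᵐ x, 0 < x → g₁ x = g₂ x) {x : ℝ}
    (hx : 0 < x) : ∫ t in (0 : ℝ)..x, g₁ t = ∫ t in (0 : ℝ)..x, g₂ t := by
  refine intervalIntegral.integral_congr_ae (h.mono fun t ht ht0x => ht ?_)
  rw [uIoc_of_le hx.le] at ht0x
  exact ht0x.1

theorem intervalIntegral_eq_of_ae_neg {g₁ g₂ : ℝ → E} (h : ∀ᵐ x, x < 0 → g₁ x = g₂ x) {x : ℝ}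
    (hx : x < 0) : ∫ t in (0 : ℝ)..x, g₁ t = ∫ t in (0 : ℝ)..x, g₂ t := by
  refine intervalIntegral.integral_congr_ae ?_
  filter_upwards [h, Measure.ae_ne volume 0] with t ht ht0 htx
  rw [uIoc_of_ge hx.le] at htx
  exact ht (lt_of_le_of_ne htx.2 ht0)

theorem integral_Ioi_eq_neg_of_integrableOn_prim [CompleteSpace E] {a : E} {g : ℝ → E}
    (hg : IntegrableOn g (Ioi 0)) (hprim : IntegrableOn (prim a g) (Ioi 0)) :
    ∫ x in Ioi (0 : ℝ), g x = -a := by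
  have hlim : Tendsto (prim a g) atTop (𝓝 (a + ∫ x in Ioi (0 : ℝ), g x)) :=
    (intervalIntegral_tendsto_integral_Ioi 0 hg tendsto_id).const_add a
  refine eq_neg_of_add_eq_zero_right (IntegrableAtFilter.eq_zero_of_tendsto
    ⟨Ioi 0, Ioi_mem_atTop 0, hprim⟩ (fun s hs => ?_) hlim)
  obtain ⟨y, hy⟩ := mem_atTop_sets.mp hs
  exact measure_mono_top (fun x hx => hy x hx) (Real.volume_Ici (a := y))

theorem integral_Iic_eq_of_integrableOn_prim [CompleteSpace E] {a : E} {g : ℝ → E}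
    (hg : IntegrableOn g (Iic 0)) (hprim : IntegrableOn (prim a g) (Iic 0)) :
    ∫ x in Iic (0 : ℝ), g x = a := by
  have hlim : Tendsto (prim a g) atBot (𝓝 (a - ∫ x in Iic (0 : ℝ), g x)) := by
    refine ((intervalIntegral_tendsto_integral_Iic 0 hg tendsto_id).const_sub a).congr fun x => ?_
    rw [prim, intervalIntegral.integral_symm x 0, ← sub_eq_add_neg, id]
  refine (sub_eq_zero.mp (IntegrableAtFilter.eq_zero_of_tendsto
    ⟨Iic 0, Iic_mem_atBot 0, hprim⟩ (fun s hs => ?_) hlim)).symm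
  obtain ⟨y, hy⟩ := mem_atBot_sets.mp hs
  exact measure_mono_top (fun x hx => hy x hx) (Real.volume_Iic (a := y))

end Prim

/-! ### Primitives on the two half-lines -/

/-- The function `f` is a primitive of `g` on each of the half-lines `x > 0` and `x < 0`, with the
boundary values `a` at `0+` and `b` at `0-`. -/
structure IsHalfLinePrimitive {E : Type*} [NormedAddCommGroup E] [NormedSpace ℝ E] (f g : ℝ → E)
    (a b : E) : Prop where
  locallyIntegrable : LocallyIntegrable g
  ae_eq_of_pos : ∀ᵐ x, 0 < x → f x = prim a g x
  ae_eq_of_neg : ∀ᵐ x, x < 0 → f x = prim b g x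

section HalfLinePrimitive

variable {E F G : Type*} [NormedAddCommGroup E] [NormedSpace ℝ E] [NormedAddCommGroup F]
  [NormedSpace ℝ F] [NormedAddCommGroup G] [NormedSpace ℝ G]

theorem isHalfLinePrimitive_of_ae_eq_prim {f g g₁ g₂ : ℝ → E} {a b : E}
    (hg₁ : LocallyIntegrable g₁) (hg₂ : LocallyIntegrable g₂)
    (hpos : ∀ᵐ x, 0 < x → g x = g₁ x ∧ f x = prim a g₁ x)
    (hneg : ∀ᵐ x, x < 0 → g x = g₂ x ∧ f x = prim b g₂ x) : IsHalfLinePrimitive f g a b where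
  locallyIntegrable := by
    refine ((hg₁.indicator measurableSet_Ioi).add (hg₂.indicator measurableSet_Iio)).congr
      (f := (Ioi (0 : ℝ)).indicator g₁ + (Iio (0 : ℝ)).indicator g₂) ?_
    filter_upwards [hpos, hneg, Measure.ae_ne volume 0] with x hp hn hx
    rcases lt_or_gt_of_ne hx with hx | hx
    · simp [hx, hx.le, (hn hx).1]
    · simp [hx, hx.le, (hp hx).1]
  ae_eq_of_pos := by
    filter_upwards [hpos] with x h hx
    rw [(h hx).2, prim, prim, intervalIntegral_eq_of_ae_pos (hpos.mono fun _ h hx => (h hx).1) hx]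
  ae_eq_of_neg := by
    filter_upwards [hneg] with x h hx
    rw [(h hx).2, prim, prim, intervalIntegral_eq_of_ae_neg (hneg.mono fun _ h hx => (h hx).1) hx]

theorem isHalfLinePrimitive_prim (a : E) {g : ℝ → E} (hg : LocallyIntegrable g) :
    IsHalfLinePrimitive (prim a g) g a a :=
  ⟨hg, Eventually.of_forall fun _ _ => rfl, Eventually.of_forall fun _ _ => rfl⟩

theorem isHalfLinePrimitive_of_contDiff [CompleteSpace E] {f : ℝ → E} (hf : ContDiff ℝ 1 f) :
    IsHalfLinePrimitive f (deriv f) (f 0) (f 0) := by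
  have hprim : prim (f 0) (deriv f) = f := by
    ext x
    rw [prim, intervalIntegral.integral_deriv_eq_sub
      (fun t _ => hf.differentiable one_ne_zero t)
      (hf.continuous_deriv_one.intervalIntegrable _ _), add_sub_cancel]
  simpa only [hprim] using
    isHalfLinePrimitive_prim (f 0) hf.continuous_deriv_one.locallyIntegrable

namespace IsHalfLinePrimitive

variable {f g : ℝ → E} {h k : ℝ → F} {a b : E} {c d : F}

theorem congr {f' g' : ℝ → E} (hf : IsHalfLinePrimitive f g a b) (hff' : f =ᵐ[volume] f')
    (hgg' : g =ᵐ[volume] g') : IsHalfLinePrimitive f' g' a b := by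
  refine isHalfLinePrimitive_of_ae_eq_prim hf.locallyIntegrable hf.locallyIntegrable ?_ ?_
  · filter_upwards [hf.ae_eq_of_pos, hff', hgg'] with x h hfx hgx hx
    exact ⟨hgx.symm, hfx ▸ h hx⟩
  · filter_upwards [hf.ae_eq_of_neg, hff', hgg'] with x h hfx hgx hx
    exact ⟨hgx.symm, hfx ▸ h hx⟩

theorem indicator_Ioi (hf : IsHalfLinePrimitive f g a b) :
    IsHalfLinePrimitive ((Ioi 0).indicator f) ((Ioi 0).indicator g) a 0 := by
  refine isHalfLinePrimitive_of_ae_eq_prim hf.locallyIntegrable locallyIntegrable_zero ?_ ?_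
  · filter_upwards [hf.ae_eq_of_pos] with x h hx
    rw [indicator_of_mem (mem_Ioi.mpr hx), indicator_of_mem (mem_Ioi.mpr hx)]
    exact ⟨rfl, h hx⟩
  · refine Eventually.of_forall fun x hx => ?_
    have hx' : x ∉ Ioi (0 : ℝ) := notMem_Ioi.mpr hx.le
    simp [prim, hx']

theorem contDiff_comp [CompleteSpace E] [CompleteSpace F] (hf : IsHalfLinePrimitive f g a b)
    {Φ : E → F} (hΦ : ContDiff ℝ 1 Φ) :
    IsHalfLinePrimitive (fun x => Φ (f x)) (fun x => fderiv ℝ Φ (f x) (g x)) (Φ a) (Φ b) := by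
  refine isHalfLinePrimitive_of_ae_eq_prim
    (locallyIntegrable_fderiv_prim hΦ a hf.locallyIntegrable)
    (locallyIntegrable_fderiv_prim hΦ b hf.locallyIntegrable) ?_ ?_
  · filter_upwards [hf.ae_eq_of_pos] with x hx hpos
    rw [hx hpos, comp_prim hΦ a hf.locallyIntegrable]
    exact ⟨rfl, rfl⟩
  · filter_upwards [hf.ae_eq_of_neg] with x hx hneg
    rw [hx hneg, comp_prim hΦ b hf.locallyIntegrable]
    exact ⟨rfl, rfl⟩

theorem prodMk [CompleteSpace E] [CompleteSpace F] (hf : IsHalfLinePrimitive f g a b)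
    (hh : IsHalfLinePrimitive h k c d) :
    IsHalfLinePrimitive (fun x => (f x, h x)) (fun x => (g x, k x)) (a, c) (b, d) := by
  have hgk : LocallyIntegrable fun x => (g x, k x) := by
    have hg := locallyIntegrable_iff.mp hf.locallyIntegrable
    have hk := locallyIntegrable_iff.mp hh.locallyIntegrable
    exact locallyIntegrable_iff.mpr fun K hK => (hg K hK).prodMk (hk K hK)
  refine ⟨hgk, ?_, ?_⟩
  · filter_upwards [hf.ae_eq_of_pos, hh.ae_eq_of_pos] with x hfx hhx hx
    rw [hfx hx, hhx hx, prim_prodMk a c hgk]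
  · filter_upwards [hf.ae_eq_of_neg, hh.ae_eq_of_neg] with x hfx hhx hx
    rw [hfx hx, hhx hx, prim_prodMk b d hgk]

theorem bilin [CompleteSpace E] [CompleteSpace F] [CompleteSpace G]
    (hf : IsHalfLinePrimitive f g a b) (hh : IsHalfLinePrimitive h k c d)
    (B : E →L[ℝ] F →L[ℝ] G) :
    IsHalfLinePrimitive (fun x => B (f x) (h x)) (fun x => B (f x) (k x) + B (g x) (h x)) (B a c)
      (B b d) := by
  simpa only [B.isBoundedBilinearMap.fderiv, IsBoundedBilinearMap.deriv_apply] using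
    (hf.prodMk hh).contDiff_comp (B.isBoundedBilinearMap.contDiff (n := 1))

theorem integral_eq_sub [CompleteSpace E] (hf : IsHalfLinePrimitive f g a b) (hfi : Integrable f)
    (hgi : Integrable g) : ∫ x, g x = b - a := by
  have hpos : IntegrableOn (prim a g) (Ioi 0) := hfi.integrableOn.congr_fun_ae
    ((ae_restrict_iff' measurableSet_Ioi).mpr hf.ae_eq_of_pos)
  have hneg : IntegrableOn (prim b g) (Iic 0) :=
    (integrableOn_Iic_iff_integrableOn_Iio (by finiteness)).mpr <| hfi.integrableOn.congr_fun_ae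
      ((ae_restrict_iff' measurableSet_Iio).mpr hf.ae_eq_of_neg)
  rw [← intervalIntegral.integral_Iic_add_Ioi hgi.integrableOn hgi.integrableOn,
    integral_Iic_eq_of_integrableOn_prim hgi.integrableOn hneg,
    integral_Ioi_eq_neg_of_integrableOn_prim hgi.integrableOn hpos, sub_eq_add_neg]

theorem integral_deriv_smul [CompleteSpace E] (hf : IsHalfLinePrimitive f g a b)
    (hfl : LocallyIntegrable f) {φ : ℝ → ℝ} (hφ : ContDiff ℝ 1 φ) (hc : HasCompactSupport φ) :
    ∫ x, deriv φ x • f x = φ 0 • (b - a) - ∫ x, φ x • g x := by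
  have hφf := hfl.integrable_smul_left_of_hasCompactSupport hφ.continuous hc
  have hφg := hf.locallyIntegrable.integrable_smul_left_of_hasCompactSupport hφ.continuous hc
  have hφ'f := hfl.integrable_smul_left_of_hasCompactSupport hφ.continuous_deriv_one hc.deriv
  have hprod : IsHalfLinePrimitive (fun x => φ x • f x) (fun x => φ x • g x + deriv φ x • f x)
      (φ 0 • a) (φ 0 • b) :=
    (isHalfLinePrimitive_of_contDiff hφ).bilin hf (ContinuousLinearMap.lsmul ℝ ℝ)
  rw [smul_sub, ← hprod.integral_eq_sub hφf (hφg.add hφ'f), integral_add hφg hφ'f,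
    add_sub_cancel_left]

end IsHalfLinePrimitive

end HalfLinePrimitive

/-! ### Functions with a weak derivative on `ℝ ∖ {0}` -/

section WeakDeriv

theorem exists_contDiff_deriv_eq {E : Type*} [NormedAddCommGroup E] [NormedSpace ℝ E]
    [CompleteSpace E] {U : Set ℝ} (hU : U.OrdConnected) {θ : ℝ → E} (hθ : ContDiff ℝ ∞ θ)
    (hc : HasCompactSupport θ) (hs : tsupport θ ⊆ U) (h_int : ∫ x, θ x = 0) :
    ∃ Θ : ℝ → E, ContDiff ℝ ∞ Θ ∧ HasCompactSupport Θ ∧ tsupport Θ ⊆ U ∧ deriv Θ = θ := by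
  have hθi : Integrable θ := hθ.continuous.integrable_of_hasCompactSupport hc
  have hderiv (x : ℝ) : HasDerivAt (prim (∫ t in Iic (0 : ℝ), θ t) θ) (θ x) x :=
    (hθ.continuous.integral_hasStrictDerivAt 0 x).hasDerivAt.const_add _
  have hIic (x : ℝ) : prim (∫ t in Iic (0 : ℝ), θ t) θ x = ∫ t in Iic x, θ t := by
    rw [prim, ← intervalIntegral.integral_Iic_sub_Iic hθi.integrableOn hθi.integrableOn,
      add_sub_cancel]
  have hzero (t : ℝ) (ht : t ∉ tsupport θ) : θ t = 0 := image_eq_zero_of_notMem_tsupport ht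
  obtain ⟨u, v, hsuv, huvU⟩ : ∃ u v, tsupport θ ⊆ Icc u v ∧ Icc u v ⊆ U := by
    rcases (tsupport θ).eq_empty_or_nonempty with hempty | hne
    · exact ⟨1, 0, by simp [hempty]⟩
    · exact ⟨sInf (tsupport θ), sSup (tsupport θ),
        fun t ht => ⟨csInf_le hc.isCompact.bddBelow ht, le_csSup hc.isCompact.bddAbove ht⟩,
        hU.out (hs (hc.isCompact.sInf_mem hne)) (hs (hc.isCompact.sSup_mem hne))⟩
  have hsupp (x : ℝ) (hx : x ∉ Icc u v) : prim (∫ t in Iic (0 : ℝ), θ t) θ x = 0 := by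
    rw [hIic]
    rcases lt_or_ge x u with hxu | hux
    · exact setIntegral_eq_zero_of_forall_eq_zero fun t ht =>
        hzero t fun hts => hxu.not_ge ((hsuv hts).1.trans ht)
    · rw [setIntegral_eq_integral_of_forall_compl_eq_zero fun t ht => hzero t fun hts => ?_, h_int]
      exact ht ((hsuv hts).2.trans (not_le.mp fun hxv => hx ⟨hux, hxv⟩).le)
  refine ⟨prim (∫ t in Iic (0 : ℝ), θ t) θ, ?_, HasCompactSupport.intro isCompact_Icc hsupp, ?_,
    funext fun x => (hderiv x).deriv⟩
  · rw [contDiff_infty_iff_deriv, funext fun x => (hderiv x).deriv]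
    exact ⟨fun x => (hderiv x).differentiableAt, hθ⟩
  · refine (closure_minimal (fun x hx => ?_) isClosed_Icc).trans huvU
    by_contra hxuv
    exact hx (hsupp x hxuv)

theorem ae_const_of_integral_deriv_eq_zero {E : Type*} [NormedAddCommGroup E] [NormedSpace ℝ E]
    [CompleteSpace E] {U : Set ℝ} (hU : IsOpen U) (hoc : U.OrdConnected)
    {h : ℝ → E} (hh : LocallyIntegrable h)
    (H : ∀ φ : ℝ → ℝ, ContDiff ℝ ∞ φ → HasCompactSupport φ → tsupport φ ⊆ U →
      ∫ x, deriv φ x • h x = 0) : ∃ c, ∀ᵐ x, x ∈ U → h x = c := by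
  rcases U.eq_empty_or_nonempty with rfl | ⟨p, hp⟩
  · exact ⟨0, by simp⟩
  obtain ⟨r, hr, hrU⟩ := Metric.nhds_basis_closedBall.mem_iff.mp (hU.mem_nhds hp)
  let bump : ContDiffBump p := ⟨r / 2, r, by positivity, by linarith⟩
  let ρ : ℝ → ℝ := bump.normed volume
  have hρs : ContDiff ℝ ∞ ρ := bump.contDiff_normed
  have hρc : HasCompactSupport ρ := bump.hasCompactSupport_normed
  have hρU : tsupport ρ ⊆ U := bump.tsupport_normed_eq.trans_subset hrU
  have hρh := hh.integrable_smul_left_of_hasCompactSupport hρs.continuous hρc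
  have horth (φ : ℝ → ℝ) (hφ : ContDiff ℝ ∞ φ) (hφc : HasCompactSupport φ) (hφU : tsupport φ ⊆ U) :
      ∫ x, φ x • (h x - ∫ y, ρ y • h y) = 0 := by
    have hφi : Integrable φ := hφ.continuous.integrable_of_hasCompactSupport hφc
    have hφh := hh.integrable_smul_left_of_hasCompactSupport hφ.continuous hφc
    have hρi : Integrable fun x => (∫ y, φ y) • ρ x :=
      bump.integrable_normed.smul (∫ y, φ y)
    have hmean : ∫ x, (φ x - (∫ y, φ y) • ρ x) = 0 := by
      rw [integral_sub hφi hρi, integral_smul, bump.integral_normed, smul_eq_mul, mul_one, sub_self]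
    obtain ⟨Θ, hΘ, hΘc, hΘU, hΘd⟩ := exists_contDiff_deriv_eq hoc (hφ.sub (hρs.const_smul _))
      (hφc.sub hρc.smul_left)
      ((tsupport_sub _ _).trans (union_subset hφU
        ((closure_mono (Function.support_const_smul_subset _ _)).trans hρU))) hmean
    have hΘh := H Θ hΘ hΘc hΘU
    simp only [hΘd, sub_smul, smul_assoc] at hΘh
    rw [integral_sub hφh (g := fun x => (∫ y, φ y) • ρ x • h x) (hρh.smul _),
      integral_smul] at hΘh
    simp only [smul_sub]
    rw [integral_sub hφh (hφi.smul_const _), integral_smul_const, hΘh]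
  refine ⟨∫ x, ρ x • h x, (hU.ae_eq_zero_of_integral_contDiff_smul_eq_zero
    ((hh.sub (locallyIntegrable_const _)).locallyIntegrableOn U) horth).mono fun x hx hxU => ?_⟩
  exact sub_eq_zero.mp (hx hxU)

theorem locallyIntegrable_coeFn (f : L2) : LocallyIntegrable f :=
  (Lp.memLp f).locallyIntegrable (by norm_num)

theorem IsHalfLinePrimitive.isWeakDeriv {f g : L2} {a b : ℂ} (h : IsHalfLinePrimitive f g a b) :
    IsWeakDeriv f g := by
  intro φ hφ hc hs
  have hφ0 : φ 0 = 0 := image_eq_zero_of_notMem_tsupport fun h => hs h rfl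
  rw [h.integral_deriv_smul (locallyIntegrable_coeFn f) (hφ.of_le (by simp)) hc, hφ0, zero_smul,
    zero_sub]

theorem IsWeakDeriv.exists_isHalfLinePrimitive {f g : L2} (h : IsWeakDeriv f g) :
    ∃ a b, IsHalfLinePrimitive f g a b := by
  have hg := locallyIntegrable_coeFn g
  have hprim := (continuous_prim (0 : ℂ) hg).locallyIntegrable (μ := volume)
  have hconst (U : Set ℝ) (hU : IsOpen U) (hoc : U.OrdConnected) (hU0 : U ⊆ {0}ᶜ) :
      ∃ a, ∀ᵐ x, x ∈ U → f x = prim a g x := by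
    obtain ⟨a, ha⟩ := ae_const_of_integral_deriv_eq_zero hU hoc
      ((locallyIntegrable_coeFn f).sub hprim) fun φ hφ hφc hs => by
        have hφ1 : ContDiff ℝ 1 φ := hφ.of_le (by simp)
        simp only [Pi.sub_apply, smul_sub]
        rw [integral_sub (integrable_test hφ1.continuous_deriv_one hφc.deriv f)
          (hprim.integrable_smul_left_of_hasCompactSupport hφ1.continuous_deriv_one hφc.deriv),
          h φ hφ hφc (hs.trans hU0),
          (isHalfLinePrimitive_prim 0 hg).integral_deriv_smul hprim hφ1 hφc, sub_self, smul_zero,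
          zero_sub, sub_self]
    refine ⟨a, ha.mono fun x hx hxU => ?_⟩
    rw [← sub_add_cancel (f x) (prim 0 g x), ← Pi.sub_apply, hx hxU, prim, zero_add, prim]
  obtain ⟨a, ha⟩ := hconst (Ioi 0) isOpen_Ioi ordConnected_Ioi fun x hx => ne_of_gt hx
  obtain ⟨b, hb⟩ := hconst (Iio 0) isOpen_Iio ordConnected_Iio fun x hx => ne_of_lt hx
  exact ⟨a, b, hg, ha, hb⟩

end WeakDeriv

/-! ### Traces, the supremum bound and Green's identity -/

section Traces

theorem neBot_nhdsWithin_inf_ae {X : Type*} [TopologicalSpace X] [MeasurableSpace X]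
    (μ : Measure X) [μ.IsOpenPosMeasure] {s : Set X} (hs : IsOpen s) {x : X} (hx : x ∈ closure s) :
    (𝓝[s] x ⊓ ae μ).NeBot := by
  refine inf_neBot_iff.mpr fun {u} hu {t} ht => ?_
  obtain ⟨o, ho, hxo, hou⟩ := mem_nhdsWithin.mp hu
  obtain ⟨y, hy, hyt⟩ := (Measure.dense_of_ae ht).inter_open_nonempty _ (ho.inter hs)
    (mem_closure_iff.mp hx o ho hxo)
  exact ⟨y, hou hy, hyt⟩

theorem HasRightTrace.unique {f : L2} {a b : ℂ} (ha : HasRightTrace f a) (hb : HasRightTrace f b) :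
    a = b :=
  haveI := neBot_nhdsWithin_inf_ae volume (isOpen_Ioi (a := (0 : ℝ))) (x := 0) (by simp)
  tendsto_nhds_unique ha hb

theorem HasLeftTrace.unique {f : L2} {a b : ℂ} (ha : HasLeftTrace f a) (hb : HasLeftTrace f b) :
    a = b :=
  haveI := neBot_nhdsWithin_inf_ae volume (isOpen_Iio (a := (0 : ℝ))) (x := 0) (by simp)
  tendsto_nhds_unique ha hb

theorem tendsto_prim_zero {E : Type*} [NormedAddCommGroup E] [NormedSpace ℝ E] (a : E) {g : ℝ → E}
    (hg : LocallyIntegrable g) : Tendsto (prim a g) (𝓝 0) (𝓝 a) := by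
  simpa only [prim_zero] using (continuous_prim a hg).tendsto 0

namespace IsHalfLinePrimitive

theorem hasRightTrace {f g : L2} {a b : ℂ} (h : IsHalfLinePrimitive f g a b) :
    HasRightTrace f a := by
  refine ((tendsto_prim_zero a h.locallyIntegrable).mono_left
    (inf_le_left.trans nhdsWithin_le_nhds)).congr' ?_
  filter_upwards [mem_inf_of_right h.ae_eq_of_pos, mem_inf_of_left self_mem_nhdsWithin]
    with x hx hx0 using (hx hx0).symm

theorem hasLeftTrace {f g : L2} {a b : ℂ} (h : IsHalfLinePrimitive f g a b) :
    HasLeftTrace f b := by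
  refine ((tendsto_prim_zero b h.locallyIntegrable).mono_left
    (inf_le_left.trans nhdsWithin_le_nhds)).congr' ?_
  filter_upwards [mem_inf_of_right h.ae_eq_of_neg, mem_inf_of_left self_mem_nhdsWithin]
    with x hx hx0 using (hx hx0).symm

end IsHalfLinePrimitive

end Traces

section SupBound

variable {E : Type*} [NormedAddCommGroup E]

theorem intervalIntegral_norm_le_mul_norm (f : Lp E 2 (volume : Measure ℝ)) (x : ℝ) {s : ℝ}
    (hs : 0 < s) : ∫ t in x..(x + s ^ 2), ‖f t‖ ≤ s * ‖f‖ := by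
  have hf := (Lp.memLp f).norm
  have hnorm : ‖hf.toLp _‖ = ‖f‖ := by rw [Lp.norm_toLp, eLpNorm_norm, Lp.norm_def]
  have hfin : volume (Ioc x (x + s ^ 2)) ≠ ⊤ := measure_Ioc_lt_top.ne
  have hinner := L2.inner_indicatorConstLp_one (𝕜 := ℝ) measurableSet_Ioc hfin (hf.toLp _)
  have hcongr : ∫ t in Ioc x (x + s ^ 2), hf.toLp _ t = ∫ t in x..(x + s ^ 2), ‖f t‖ := by
    rw [intervalIntegral.integral_of_le (by nlinarith)]
    exact setIntegral_congr_ae measurableSet_Ioc (hf.coeFn_toLp.mono fun _ ht _ => ht)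
  rw [← hcongr, ← hinner]
  refine (real_inner_le_norm _ _).trans_eq ?_
  rw [norm_indicatorConstLp two_ne_zero ENNReal.ofNat_ne_top, hnorm, norm_one, one_mul,
    Real.volume_real_Ioc_of_le (by nlinarith), add_sub_cancel_left, ENNReal.toReal_ofNat,
    ← Real.sqrt_eq_rpow, Real.sqrt_sq hs.le]

variable [NormedSpace ℝ E]

theorem norm_prim_sub_prim_le (a : E) {g : Lp E 2 (volume : Measure ℝ)}
    (hg : LocallyIntegrable g) {s : ℝ} (hs : 0 < s) {x y t : ℝ} (hy : y ∈ Icc x (x + s ^ 2))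
    (ht : t ∈ Icc x (x + s ^ 2)) : ‖prim a g y - prim a g t‖ ≤ s * ‖g‖ := by
  rw [prim_sub_prim a hg]
  refine intervalIntegral.norm_integral_le_integral_norm_uIoc.trans
    (le_trans ?_ (intervalIntegral_norm_le_mul_norm g x hs))
  rw [intervalIntegral.integral_of_le (by nlinarith)]
  exact setIntegral_mono_set (intervalIntegrable_of_locallyIntegrable (locallyIntegrable_norm hg)
    x (x + s ^ 2)).1 (Eventually.of_forall fun _ => norm_nonneg _)
    (Ioc_subset_Ioc (le_min ht.1 hy.1) (max_le ht.2 hy.2)).eventuallyLE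

/-- Averaging `‖prim a g y‖ ≤ ‖f t‖ + s‖g‖` over the points `t` of an interval of length `s ^ 2`. -/
theorem norm_prim_le_of_ae_eq_prim {f g : Lp E 2 (volume : Measure ℝ)} {a : E}
    (hg : LocallyIntegrable g) {s : ℝ} (hs : 0 < s) {x y : ℝ} (hy : y ∈ Icc x (x + s ^ 2))
    (hf : ∀ᵐ t, t ∈ Ioc x (x + s ^ 2) → f t = prim a g t) :
    ‖prim a g y‖ ≤ s⁻¹ * ‖f‖ + s * ‖g‖ := by
  have hle : x ≤ x + s ^ 2 := by nlinarith
  have hcont := (continuous_prim a hg).norm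
  have hpoint (t : ℝ) (ht : t ∈ Icc x (x + s ^ 2)) : ‖prim a g y‖ ≤ ‖prim a g t‖ + s * ‖g‖ := by
    linarith [norm_le_norm_add_norm_sub' (prim a g y) (prim a g t),
      norm_prim_sub_prim_le a hg hs hy ht]
  have havg : s ^ 2 * ‖prim a g y‖ ≤ (∫ t in x..(x + s ^ 2), ‖prim a g t‖) + s * (s ^ 2 * ‖g‖) := by
    simpa [intervalIntegral.integral_add (hcont.intervalIntegrable _ _)
      (intervalIntegrable_const (μ := volume))] using intervalIntegral.integral_mono_on hle
        (intervalIntegrable_const (μ := volume) (c := ‖prim a g y‖))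
        ((hcont.add continuous_const).intervalIntegrable _ _) hpoint
  have hcongr : ∫ t in x..(x + s ^ 2), ‖prim a g t‖ = ∫ t in x..(x + s ^ 2), ‖f t‖ := by
    refine intervalIntegral.integral_congr_ae (hf.mono fun t ht hts => ?_)
    rw [ht (uIoc_of_le hle ▸ hts)]
  have hfinal : s ^ 2 * ‖prim a g y‖ ≤ s ^ 2 * (s⁻¹ * ‖f‖ + s * ‖g‖) :=
    calc s ^ 2 * ‖prim a g y‖ ≤ s * ‖f‖ + s * (s ^ 2 * ‖g‖) := by
          linarith [intervalIntegral_norm_le_mul_norm f x hs]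
      _ = s ^ 2 * (s⁻¹ * ‖f‖ + s * ‖g‖) := by field_simp
  exact le_of_mul_le_mul_left hfinal (by positivity)

namespace IsHalfLinePrimitive

variable {f g : Lp E 2 (volume : Measure ℝ)} {a b : E} (h : IsHalfLinePrimitive f g a b)
include h

theorem norm_prim_le_of_nonneg {s : ℝ} (hs : 0 < s) {x : ℝ} (hx : 0 ≤ x) :
    ‖prim a g x‖ ≤ s⁻¹ * ‖f‖ + s * ‖g‖ :=
  norm_prim_le_of_ae_eq_prim h.locallyIntegrable hs ⟨le_rfl, by nlinarith⟩
    (h.ae_eq_of_pos.mono fun _ ht hts => ht (hx.trans_lt hts.1))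

theorem norm_prim_le_of_nonpos {s : ℝ} (hs : 0 < s) {x : ℝ} (hx : x ≤ 0) :
    ‖prim b g x‖ ≤ s⁻¹ * ‖f‖ + s * ‖g‖ := by
  refine norm_prim_le_of_ae_eq_prim h.locallyIntegrable hs (x := x - s ^ 2)
    ⟨by nlinarith, by linarith⟩ ?_
  filter_upwards [h.ae_eq_of_neg, Measure.ae_ne volume 0] with t ht ht0 hts
  exact ht (lt_of_le_of_ne (by linarith [hts.2]) ht0)

theorem ae_norm_le {s : ℝ} (hs : 0 < s) : ∀ᵐ x, ‖f x‖ ≤ s⁻¹ * ‖f‖ + s * ‖g‖ := by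
  filter_upwards [h.ae_eq_of_pos, h.ae_eq_of_neg, Measure.ae_ne volume 0] with x hpos hneg hx
  rcases lt_or_gt_of_ne hx with hx | hx
  · exact (hneg hx).symm ▸ h.norm_prim_le_of_nonpos hs hx.le
  · exact (hpos hx).symm ▸ h.norm_prim_le_of_nonneg hs hx.le

end IsHalfLinePrimitive

end SupBound

section Green

theorem integrable_conj_mul (f g : L2) : Integrable fun x => (starRingEnd ℂ) (f x) * g x := by
  simpa only [RCLike.inner_apply, mul_comm] using L2.integrable_inner (𝕜 := ℂ) f g

theorem inner_eq_integral_conj_mul (f g : L2) :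
    inner ℂ f g = ∫ x, (starRingEnd ℂ) (f x) * g x := by
  simp only [MeasureTheory.L2.inner_def, RCLike.inner_apply, mul_comm]

theorem IsHalfLinePrimitive.green {f g h k : L2} {a b c d : ℂ} (hf : IsHalfLinePrimitive f g a b)
    (hh : IsHalfLinePrimitive h k c d) :
    inner ℂ f k + inner ℂ g h = (starRingEnd ℂ) b * d - (starRingEnd ℂ) a * c := by
  rw [inner_eq_integral_conj_mul, inner_eq_integral_conj_mul,
    ← integral_add (integrable_conj_mul f k) (integrable_conj_mul g h)]
  exact (hf.bilin hh ((ContinuousLinearMap.mul ℝ ℂ).comp (Complex.conjCLE : ℂ →L[ℝ] ℂ)))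
    |>.integral_eq_sub (integrable_conj_mul f h)
      ((integrable_conj_mul f k).add (integrable_conj_mul g h))

end Green

/-! ### Coercive forms -/

section Coercive

open scoped InnerProduct

variable {X : Type*} [NormedAddCommGroup X] [InnerProductSpace ℂ X] [CompleteSpace X]

theorem exists_isSelfAdjoint_inner_eq {Y : Type*} [NormedAddCommGroup Y] [InnerProductSpace ℂ Y]
    [CompleteSpace Y] (D T : X →L[ℂ] Y) (l : X →L[ℂ] ℂ) (a b : ℝ) :
    ∃ A : X →L[ℂ] X, IsSelfAdjoint A ∧ ∀ u v, inner ℂ u (A v) =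
      inner ℂ (D u) (D v) + a * inner ℂ (T u) (T v) - b * ((starRingEnd ℂ) (l u) * l v) := by
  refine ⟨D† ∘L D + (a : ℂ) • (T† ∘L T) - (b : ℂ) • (l† ∘L l), ?_, fun u v => ?_⟩
  · exact ((isSelfAdjoint_adjoint_comp_self D).add (.smul (Complex.conj_ofReal a)
      (isSelfAdjoint_adjoint_comp_self T))).sub (.smul (Complex.conj_ofReal b)
      (isSelfAdjoint_adjoint_comp_self l))
  · simp only [sub_apply, add_apply, smul_apply, ContinuousLinearMap.comp_apply, inner_sub_right,
      inner_add_right, inner_smul_right, ContinuousLinearMap.adjoint_inner_right,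
      RCLike.inner_apply']

theorem algebraMap_le_of_forall_mul_norm_sq_le {A : X →L[ℂ] X} (hA : IsSelfAdjoint A) {c : ℝ}
    (hcA : ∀ u, c * ‖u‖ ^ 2 ≤ (inner ℂ (A u) u).re) : algebraMap ℝ (X →L[ℂ] X) c ≤ A := by
  rw [ContinuousLinearMap.le_def, ContinuousLinearMap.isPositive_def]
  refine ⟨(hA.sub (IsSelfAdjoint.algebraMap _ (IsSelfAdjoint.all c))).isSymmetric, fun u => ?_⟩
  have hc : inner ℂ (algebraMap ℝ (X →L[ℂ] X) c u) u = ((c * ‖u‖ ^ 2 : ℝ) : ℂ) := by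
    rw [Algebra.algebraMap_eq_smul_one, smul_apply, one_apply_eq_self, ← Complex.coe_smul,
      inner_smul_left, Complex.conj_ofReal, inner_self_eq_norm_sq_to_K]
    push_cast
    rfl
  rw [ContinuousLinearMap.reApplyInnerSelf_apply, sub_apply, inner_sub_left, hc]
  simpa [← Complex.ofReal_pow] using hcA u

/-- The isomorphism is the square root of `A`. -/
theorem exists_continuousLinearEquiv_inner_eq {A : X →L[ℂ] X} (hA : IsSelfAdjoint A) {c : ℝ}
    (hc : 0 < c) (hcA : ∀ u, c * ‖u‖ ^ 2 ≤ (inner ℂ (A u) u).re) :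
    ∃ S : X ≃L[ℂ] X, ∀ u v, inner ℂ (S u) (S v) = inner ℂ u (A v) := by
  have hle := algebraMap_le_of_forall_mul_norm_sq_le hA hcA
  have hpos : (0 : X →L[ℂ] X) ≤ A := by
    simpa using algebraMap_le_of_forall_mul_norm_sq_le hA (c := 0) fun u =>
      (by simp only [zero_mul]; exact (by positivity : 0 ≤ c * ‖u‖ ^ 2).trans (hcA u))
  have hunit : IsUnit (CFC.sqrt A) := (CFC.isUnit_sqrt_iff A hpos).mpr
    (CStarAlgebra.isUnit_of_le _ hle (isStrictlyPositive_algebraMap hc))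
  have hsqrt : IsSelfAdjoint (CFC.sqrt A) := .of_nonneg (CFC.sqrt_nonneg A)
  refine ⟨ContinuousLinearEquiv.unitsEquiv ℂ X hunit.unit, fun u v => ?_⟩
  change inner ℂ (CFC.sqrt A u) (CFC.sqrt A v) = _
  rw [← ContinuousLinearMap.adjoint_inner_right, ← ContinuousLinearMap.star_eq_adjoint,
    hsqrt.star_eq, ← mul_apply_eq_comp, CFC.sqrt_mul_sqrt_self A hpos]

end Coercive

/-! ### Test functions -/

/-- A continuous function with compact support, as an element of `L²(ℝ)`. -/
def testFunction (φ : ℝ → ℝ) (hφ : Continuous φ) (hc : HasCompactSupport φ) : L2 :=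
  ((Complex.continuous_ofReal.comp hφ).memLp_of_hasCompactSupport
    (hc.comp_left Complex.ofReal_zero)).toLp _

theorem coeFn_testFunction {φ : ℝ → ℝ} (hφ : Continuous φ) (hc : HasCompactSupport φ) :
    testFunction φ hφ hc =ᵐ[volume] fun x => (φ x : ℂ) := MemLp.coeFn_toLp _

theorem inner_testFunction {φ : ℝ → ℝ} (hφ : Continuous φ) (hc : HasCompactSupport φ) (f : L2) :
    inner ℂ (testFunction φ hφ hc) f = ∫ x, φ x • f x := by
  rw [inner_eq_integral_conj_mul]
  refine integral_congr_ae ?_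
  filter_upwards [coeFn_testFunction hφ hc] with x hx
  rw [hx, Complex.conj_ofReal, Complex.real_smul]

theorem isWeakDeriv_iff_inner {f g : L2} : IsWeakDeriv f g ↔
    ∀ (φ : ℝ → ℝ) (hφ : ContDiff ℝ ∞ φ) (hc : HasCompactSupport φ), tsupport φ ⊆ {0}ᶜ →
      inner ℂ (testFunction (deriv φ) (hφ.continuous_deriv (by simp)) hc.deriv) f =
        -inner ℂ (testFunction φ hφ.continuous hc) g := by
  simp only [inner_testFunction]
  rfl

theorem isHalfLinePrimitive_testFunction {φ : ℝ → ℝ} (hφ : ContDiff ℝ 1 φ)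
    (hc : HasCompactSupport φ) :
    IsHalfLinePrimitive (testFunction φ hφ.continuous hc)
      (testFunction (deriv φ) hφ.continuous_deriv_one hc.deriv) (φ 0) (φ 0) := by
  have hderiv : deriv (fun x => (φ x : ℂ)) = fun x => ((deriv φ x : ℝ) : ℂ) :=
    funext fun x => (hφ.differentiable one_ne_zero x).hasDerivAt.ofReal_comp.deriv
  refine (isHalfLinePrimitive_of_contDiff (Complex.ofRealCLM.contDiff.comp hφ)).congr
    (coeFn_testFunction hφ.continuous hc).symm ?_
  exact hderiv.eventuallyEq.trans (coeFn_testFunction hφ.continuous_deriv_one hc.deriv).symm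

theorem isClosed_energySubmodule : IsClosed (energySubmodule : Set (WithLp 2 (L2 × L2))) := by
  change IsClosed {p | IsWeakDeriv (WithLp.fstL 2 ℂ L2 L2 p) (WithLp.sndL 2 ℂ L2 L2 p)}
  simp only [isWeakDeriv_iff_inner, Set.ofPred_forall]
  exact isClosed_iInter fun φ => isClosed_iInter fun hφ => isClosed_iInter fun hc =>
    isClosed_iInter fun _ => isClosed_eq (by fun_prop) (by fun_prop)

instance : CompleteSpace Q := isClosed_energySubmodule.completeSpace_coe

/-! ### The energy space and its quadratic form -/

namespace Q

/-- The weak derivative on `ℝ ∖ {0}` of an element of the energy space. -/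
def weakDeriv : Q →L[ℂ] L2 := (WithLp.sndL 2 ℂ L2 L2).comp energySubmodule.subtypeL

theorem isWeakDeriv (u : Q) : IsWeakDeriv u.toL2 (weakDeriv u) := u.2

theorem exists_of_isWeakDeriv {f g : L2} (h : IsWeakDeriv f g) :
    ∃ u : Q, u.toL2 = f ∧ weakDeriv u = g :=
  ⟨⟨WithLp.toLp 2 (f, g), h⟩, rfl, rfl⟩

theorem norm_sq_eq (u : Q) : ‖u‖ ^ 2 = ‖u.toL2‖ ^ 2 + ‖weakDeriv u‖ ^ 2 :=
  WithLp.prod_norm_sq_eq_of_L2 (u : WithLp 2 (L2 × L2))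

theorem norm_toL2_le (u : Q) : ‖u.toL2‖ ≤ ‖u‖ :=
  le_of_sq_le_sq (by rw [norm_sq_eq]; exact le_add_of_nonneg_right (sq_nonneg _)) (norm_nonneg u)

theorem norm_weakDeriv_le (u : Q) : ‖weakDeriv u‖ ≤ ‖u‖ :=
  le_of_sq_le_sq (by rw [norm_sq_eq]; exact le_add_of_nonneg_left (sq_nonneg _)) (norm_nonneg u)

theorem toL2_injective : Function.Injective toL2 := by
  refine (injective_iff_map_eq_zero toL2).mpr fun u hu => ?_
  have hderiv : weakDeriv u = 0 := (hu ▸ isWeakDeriv u).eq_zero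
  rw [← norm_eq_zero, ← sq_eq_zero_iff, norm_sq_eq, hu, hderiv]
  simp

theorem exists_hasRightTrace (u : Q) : ∃ a, HasRightTrace u.toL2 a :=
  let ⟨a, _, h⟩ := (isWeakDeriv u).exists_isHalfLinePrimitive
  ⟨a, h.hasRightTrace⟩

theorem exists_hasLeftTrace (u : Q) : ∃ b, HasLeftTrace u.toL2 b :=
  let ⟨_, b, h⟩ := (isWeakDeriv u).exists_isHalfLinePrimitive
  ⟨b, h.hasLeftTrace⟩

/-- The boundary value `u(0+)`. -/
def rightTrace : Q →ₗ[ℂ] ℂ where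
  toFun u := (exists_hasRightTrace u).choose
  map_add' u v := (exists_hasRightTrace (u + v)).choose_spec.unique <| by
    rw [map_add]
    exact tendsto_add_of_le_ae inf_le_right (exists_hasRightTrace u).choose_spec
      (exists_hasRightTrace v).choose_spec
  map_smul' c u := (exists_hasRightTrace (c • u)).choose_spec.unique <| by
    rw [map_smul]
    exact tendsto_smul_of_le_ae inf_le_right c (exists_hasRightTrace u).choose_spec

/-- The boundary value `u(0-)`. -/
def leftTrace : Q →ₗ[ℂ] ℂ where
  toFun u := (exists_hasLeftTrace u).choose
  map_add' u v := (exists_hasLeftTrace (u + v)).choose_spec.unique <| by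
    rw [map_add]
    exact tendsto_add_of_le_ae inf_le_right (exists_hasLeftTrace u).choose_spec
      (exists_hasLeftTrace v).choose_spec
  map_smul' c u := (exists_hasLeftTrace (c • u)).choose_spec.unique <| by
    rw [map_smul]
    exact tendsto_smul_of_le_ae inf_le_right c (exists_hasLeftTrace u).choose_spec

theorem hasRightTrace (u : Q) : HasRightTrace u.toL2 (rightTrace u) :=
  (exists_hasRightTrace u).choose_spec

theorem hasLeftTrace (u : Q) : HasLeftTrace u.toL2 (leftTrace u) :=
  (exists_hasLeftTrace u).choose_spec

theorem isHalfLinePrimitive (u : Q) :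
    IsHalfLinePrimitive u.toL2 (weakDeriv u) (rightTrace u) (leftTrace u) := by
  obtain ⟨a, b, h⟩ := (isWeakDeriv u).exists_isHalfLinePrimitive
  rwa [(hasRightTrace u).unique h.hasRightTrace, (hasLeftTrace u).unique h.hasLeftTrace]

theorem exists_of_isHalfLinePrimitive {f g : L2} {a b : ℂ} (h : IsHalfLinePrimitive f g a b) :
    ∃ u : Q, u.toL2 = f ∧ weakDeriv u = g ∧ rightTrace u = a ∧ leftTrace u = b := by
  obtain ⟨u, rfl, hu⟩ := exists_of_isWeakDeriv h.isWeakDeriv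
  exact ⟨u, rfl, hu, (hasRightTrace u).unique h.hasRightTrace,
    (hasLeftTrace u).unique h.hasLeftTrace⟩

theorem norm_rightTrace_le (u : Q) {s : ℝ} (hs : 0 < s) :
    ‖rightTrace u‖ ≤ s⁻¹ * ‖u.toL2‖ + s * ‖u‖ := by
  have h := (isHalfLinePrimitive u).norm_prim_le_of_nonneg hs le_rfl
  rw [prim_zero] at h
  exact h.trans (by gcongr; exact norm_weakDeriv_le u)

theorem norm_leftTrace_le (u : Q) {s : ℝ} (hs : 0 < s) :
    ‖leftTrace u‖ ≤ s⁻¹ * ‖u.toL2‖ + s * ‖u‖ := by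
  have h := (isHalfLinePrimitive u).norm_prim_le_of_nonpos hs le_rfl
  rw [prim_zero] at h
  exact h.trans (by gcongr; exact norm_weakDeriv_le u)

theorem norm_rightTrace_sub_leftTrace_le (u : Q) {s : ℝ} (hs : 0 < s) :
    ‖rightTrace u - leftTrace u‖ ≤ 2 * (s⁻¹ * ‖u.toL2‖ + s * ‖u‖) := by
  linarith [norm_sub_le (rightTrace u) (leftTrace u), norm_rightTrace_le u hs,
    norm_leftTrace_le u hs]

/-- The jump `u(0+) - u(0-)`. -/
def jump : Q →L[ℂ] ℂ :=
  (rightTrace - leftTrace).mkContinuous 4 fun u => by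
    have h := norm_rightTrace_sub_leftTrace_le u one_pos
    rw [inv_one, one_mul, one_mul] at h
    rw [LinearMap.sub_apply]
    linarith [norm_toL2_le u]

theorem jump_apply (u : Q) : jump u = rightTrace u - leftTrace u := rfl

theorem norm_jump_sq_le (u : Q) {r : ℝ} (hr : 0 < r) :
    ‖jump u‖ ^ 2 ≤ 8 * (r⁻¹ * ‖u.toL2‖ ^ 2 + r * ‖u‖ ^ 2) := by
  have hs : 0 < √r := Real.sqrt_pos.mpr hr
  calc ‖jump u‖ ^ 2 ≤ (2 * ((√r)⁻¹ * ‖u.toL2‖ + √r * ‖u‖)) ^ 2 :=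
        pow_le_pow_left₀ (norm_nonneg _) (norm_rightTrace_sub_leftTrace_le u hs) 2
    _ ≤ 8 * (((√r)⁻¹ * ‖u.toL2‖) ^ 2 + (√r * ‖u‖) ^ 2) := by
        nlinarith [sq_nonneg ((√r)⁻¹ * ‖u.toL2‖ - √r * ‖u‖)]
    _ = 8 * (r⁻¹ * ‖u.toL2‖ ^ 2 + r * ‖u‖ ^ 2) := by
        rw [mul_pow, mul_pow, inv_pow, Real.sq_sqrt hr.le]

theorem abs_inv_mul_norm_jump_sq_le {γ : ℝ} (hγ : γ ≠ 0) (u : Q) :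
    |γ|⁻¹ * ‖jump u‖ ^ 2 ≤ 128 * γ⁻¹ ^ 2 * ‖u.toL2‖ ^ 2 + 1 / 2 * ‖u‖ ^ 2 := by
  have hγ' : 0 < |γ| := abs_pos.mpr hγ
  calc |γ|⁻¹ * ‖jump u‖ ^ 2
      ≤ |γ|⁻¹ * (8 * ((|γ| / 16)⁻¹ * ‖u.toL2‖ ^ 2 + |γ| / 16 * ‖u‖ ^ 2)) := by
        gcongr
        exact norm_jump_sq_le u (div_pos hγ' (by norm_num))
    _ = 128 * |γ|⁻¹ ^ 2 * ‖u.toL2‖ ^ 2 + 1 / 2 * ‖u‖ ^ 2 := by field_simp; ring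
    _ = 128 * γ⁻¹ ^ 2 * ‖u.toL2‖ ^ 2 + 1 / 2 * ‖u‖ ^ 2 := by rw [← abs_inv, sq_abs]

/-- The sesquilinear form `⟨u', v'⟩ + m⟨u, v⟩ - γ⁻¹ [u]^* [v]` of `H_γ + m`, with `[·]` the jump
at the origin. -/
def form (γ m : ℝ) (u v : Q) : ℂ :=
  inner ℂ (weakDeriv u) (weakDeriv v) + m * inner ℂ u.toL2 v.toL2 -
    (γ⁻¹ : ℝ) * ((starRingEnd ℂ) (jump u) * jump v)

theorem form_self (γ m : ℝ) (u : Q) :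
    form γ m u u = ((‖weakDeriv u‖ ^ 2 + m * ‖u.toL2‖ ^ 2 - γ⁻¹ * ‖jump u‖ ^ 2 : ℝ) : ℂ) := by
  rw [form, inner_self_eq_norm_sq_to_K, inner_self_eq_norm_sq_to_K, mul_comm _ (jump u),
    Complex.mul_conj, Complex.normSq_eq_norm_sq]
  push_cast
  rfl

/-- A shift `m` for which the form of `H_γ + m` is coercive. -/
def shift (γ : ℝ) : ℝ := 1 + 128 * γ⁻¹ ^ 2

theorem half_norm_sq_le_form {γ : ℝ} (hγ : γ ≠ 0) (u : Q) :
    1 / 2 * ‖u‖ ^ 2 ≤ (form γ (shift γ) u u).re := by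
  have habs : γ⁻¹ * ‖jump u‖ ^ 2 ≤ |γ|⁻¹ * ‖jump u‖ ^ 2 := by
    rw [← abs_inv]
    gcongr
    exact le_abs_self _
  rw [form_self, Complex.ofReal_re, shift]
  linarith [abs_inv_mul_norm_jump_sq_le hγ u, norm_sq_eq u]

theorem exists_continuousLinearEquiv_inner_eq_form {γ : ℝ} (hγ : γ ≠ 0) :
    ∃ S : Q ≃L[ℂ] Q, ∀ u v, inner ℂ (S u) (S v) = form γ (shift γ) u v := by
  obtain ⟨A, hA, hform⟩ := exists_isSelfAdjoint_inner_eq weakDeriv toL2 jump (shift γ) γ⁻¹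
  obtain ⟨S, hS⟩ := exists_continuousLinearEquiv_inner_eq hA one_half_pos fun u => by
    rw [show inner ℂ (A u) u = inner ℂ u (A u) from hA.isSymmetric u u, hform]
    exact half_norm_sq_le_form hγ u
  exact ⟨S, fun u v => (hS u v).trans (hform u v)⟩

theorem exists_testFunction {φ : ℝ → ℝ} (hφ : ContDiff ℝ 1 φ) (hc : HasCompactSupport φ) :
    ∃ u : Q, u.toL2 = testFunction φ hφ.continuous hc ∧
      weakDeriv u = testFunction (deriv φ) hφ.continuous_deriv_one hc.deriv ∧
      rightTrace u = φ 0 ∧ leftTrace u = φ 0 :=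
  exists_of_isHalfLinePrimitive (isHalfLinePrimitive_testFunction hφ hc)

theorem exists_traces_eq (a b : ℂ) : ∃ v : Q, rightTrace v = a ∧ leftTrace v = b := by
  let bump : ContDiffBump (0 : ℝ) := ⟨1, 2, one_pos, one_lt_two⟩
  obtain ⟨u, -, -, hu⟩ := exists_testFunction (φ := bump) bump.contDiff bump.hasCompactSupport
  have hbump : bump 0 = 1 :=
    bump.one_of_mem_closedBall (Metric.mem_closedBall_self zero_le_one)
  obtain ⟨w, -, -, hw⟩ := exists_of_isHalfLinePrimitive <|
    (isHalfLinePrimitive u).indicator_Ioi.congr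
      (((Lp.memLp u.toL2).indicator measurableSet_Ioi).coeFn_toLp.symm)
      (((Lp.memLp (weakDeriv u)).indicator measurableSet_Ioi).coeFn_toLp.symm)
  refine ⟨b • u + (a - b) • w, ?_, ?_⟩ <;> simp [hu, hw, hbump]

theorem eq_zero_of_inner_toL2_eq_zero {h : L2} (H : ∀ v : Q, inner ℂ h v.toL2 = 0) : h = 0 := by
  refine IsWeakDeriv.eq_zero (isWeakDeriv_iff_inner.mpr fun φ hφ hc _ => ?_)
  obtain ⟨v, hv, -⟩ := exists_testFunction (hφ.of_le (by simp)) hc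
  rw [inner_zero_right, ← hv, inner_eq_zero_symm.mp (H v), neg_zero]

/-! ### The Hamiltonian and its form -/

theorem form_sub_inner {γ m : ℝ} {u : Q} {e : L2} {c d : ℂ}
    (h : IsHalfLinePrimitive (weakDeriv u) ((-e : L2) : ℝ → ℂ) c d) (v : Q) :
    form γ m u v - inner ℂ (e + (m : ℂ) • u.toL2) v.toL2 =
      (starRingEnd ℂ) d * leftTrace v - (starRingEnd ℂ) c * rightTrace v -
        (γ⁻¹ : ℝ) * ((starRingEnd ℂ) (jump u) * jump v) := by
  have hgreen := h.green (isHalfLinePrimitive v)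
  rw [inner_neg_left] at hgreen
  rw [form, inner_add_left, inner_smul_left, Complex.conj_ofReal]
  linear_combination hgreen

theorem isWeakDeriv_weakDeriv_of_form_eq_inner {γ m : ℝ} {u : Q} {e : L2}
    (h : ∀ v, form γ m u v = inner ℂ (e + (m : ℂ) • u.toL2) v.toL2) :
    IsWeakDeriv (weakDeriv u) (-e) := by
  refine isWeakDeriv_iff_inner.mpr fun φ hφ hc _ => ?_
  obtain ⟨v, hv, hv', hright, hleft⟩ := exists_testFunction (hφ.of_le (by simp)) hc
  have hjump : jump v = 0 := by rw [jump_apply, hright, hleft, sub_self]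
  have hinner : inner ℂ (weakDeriv u) (weakDeriv v) = inner ℂ e v.toL2 := by
    have hform := h v
    rw [form, hjump, inner_add_left, inner_smul_left, Complex.conj_ofReal] at hform
    linear_combination hform
  rw [inner_neg_right, neg_neg, ← hv, ← hv', ← inner_conj_symm, hinner, inner_conj_symm]

theorem form_eq_inner_iff {γ : ℝ} (hγ : γ ≠ 0) (m : ℝ) (u : Q) (e : L2) :
    (∀ v, form γ m u v = inner ℂ (e + (m : ℂ) • u.toL2) v.toL2) ↔
      ∃ c, IsHalfLinePrimitive (weakDeriv u) ((-e : L2) : ℝ → ℂ) c c ∧ jump u = -(γ : ℂ) * c := by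
  have hγ' : (γ : ℂ) ≠ 0 := Complex.ofReal_ne_zero.mpr hγ
  constructor
  · intro h
    obtain ⟨c, d, hcd⟩ := (isWeakDeriv_weakDeriv_of_form_eq_inner h).exists_isHalfLinePrimitive
    have hboundary (v : Q) : (starRingEnd ℂ) d * leftTrace v - (starRingEnd ℂ) c * rightTrace v =
        (γ⁻¹ : ℝ) * ((starRingEnd ℂ) (jump u) * jump v) := by
      rw [← sub_eq_zero, ← form_sub_inner hcd v, h v, sub_self]
    obtain ⟨v, hv⟩ := exists_traces_eq 1 1
    obtain ⟨w, hw⟩ := exists_traces_eq 1 0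
    have hd : d = c := (starRingEnd ℂ).injective <| by
      simpa [jump_apply v, hv, sub_eq_zero] using hboundary v
    have hc : -c = (γ⁻¹ : ℝ) * jump u := by
      simpa [jump_apply w, hw] using congrArg (starRingEnd ℂ) (hboundary w)
    refine ⟨c, hd ▸ hcd, ?_⟩
    rw [neg_mul, ← mul_neg, hc, Complex.ofReal_inv, mul_inv_cancel_left₀ hγ']
  · rintro ⟨c, hc, hjump⟩ v
    rw [← sub_eq_zero, form_sub_inner hc, hjump, jump_apply, map_mul, map_neg, Complex.conj_ofReal,
      Complex.ofReal_inv]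
    field_simp
    ring

theorem mem_hamiltonianGraph_iff {γ : ℝ} (hγ : γ ≠ 0) (m : ℝ) (f e : L2) :
    (f, e) ∈ hamiltonianGraph γ ↔
      ∃ u : Q, u.toL2 = f ∧ ∀ v, form γ m u v = inner ℂ (e + (m : ℂ) • f) v.toL2 := by
  constructor
  · rintro ⟨g, hg, hg', a, b, c, ha, hb, hc, hc', h⟩
    obtain ⟨u, rfl, rfl⟩ := exists_of_isWeakDeriv hg
    obtain ⟨c₁, c₂, hp⟩ := hg'.exists_isHalfLinePrimitive
    obtain rfl := hp.hasRightTrace.unique hc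
    obtain rfl := hp.hasLeftTrace.unique hc'
    refine ⟨u, rfl, (form_eq_inner_iff hγ m u e).mpr ⟨_, hp, ?_⟩⟩
    rw [jump_apply, (hasRightTrace u).unique ha, (hasLeftTrace u).unique hb, h]
  · rintro ⟨u, rfl, hu⟩
    obtain ⟨c, hc, hjump⟩ := (form_eq_inner_iff hγ m u e).mp hu
    exact ⟨weakDeriv u, isWeakDeriv u, hc.isWeakDeriv, _, _, c, hasRightTrace u, hasLeftTrace u,
      hc.hasRightTrace, hc.hasLeftTrace, hjump⟩

end Q

/-- The energy space with the inner product given by the form of `H_γ + m` is `Q` itself, through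
the isomorphism `S`, and the propagator acts isometrically on it. -/
theorem exists_isGroupPair_hamiltonian {γ : ℝ} (hγ : γ ≠ 0) :
    ∃ (S : Q ≃L[ℂ] Q) (J : Q →L[ℂ] L2) (U : ℝ → Q →L[ℂ] Q), (∀ u, J (S u) = u.toL2) ∧
      (∀ u v, inner ℂ (S u) (S v) = Q.form γ (Q.shift γ) u v) ∧
      IsGroupPair (Q.shift γ) J U (propagator (hamiltonian γ)) := by
  obtain ⟨S, hS⟩ := Q.exists_continuousLinearEquiv_inner_eq_form hγ
  let J : Q →L[ℂ] L2 := Q.toL2 ∘L (S.symm : Q →L[ℂ] Q)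
  have hJS (u : Q) : J (S u) = u.toL2 := congrArg Q.toL2 (S.symm_apply_apply u)
  have hrange (f h : L2) : f = J (J.adjoint h) ↔
      ∃ u : Q, u.toL2 = f ∧ ∀ v, Q.form γ (Q.shift γ) u v = inner ℂ h v.toL2 := by
    constructor
    · rintro rfl
      refine ⟨S.symm (J.adjoint h), rfl, fun v => ?_⟩
      rw [← hS, S.apply_symm_apply, ContinuousLinearMap.adjoint_inner_left, hJS]
    · rintro ⟨u, rfl, hu⟩
      have hSu : S u = J.adjoint h := by
        refine ext_inner_right ℂ (S.surjective.forall.mpr fun v => ?_)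
        rw [hS, hu, ContinuousLinearMap.adjoint_inner_left, hJS]
      rw [← hJS, hSu]
  obtain ⟨U, hU⟩ := exists_isGroupPair_propagator (H := hamiltonian γ) (m := Q.shift γ) (J := J)
    (Q.toL2_injective.comp S.symm.injective)
    (fun f hf => Q.eq_zero_of_inner_toL2_eq_zero fun v => by rw [← hJS, hf])
    (fun f e => by rw [graph_hamiltonian, Q.mem_hamiltonianGraph_iff hγ (Q.shift γ), hrange])
  exact ⟨S, J, U, hJS, hS, hU⟩

/-! ### Superposition operators -/

theorem integrable_real_inner (f g : L2) : Integrable fun x => inner ℝ (f x) (g x) :=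
  (L2.integrable_inner (𝕜 := ℂ) f g).re

theorem re_inner_eq_integral (f g : L2) :
    (inner ℂ f g : ℂ).re = ∫ x, inner ℝ (f x) (g x) := by
  rw [MeasureTheory.L2.inner_def]
  exact (integral_re (L2.integrable_inner (𝕜 := ℂ) f g)).symm

theorem norm_sq_eq_integral (f : L2) : ‖f‖ ^ 2 = ∫ x, ‖f x‖ ^ 2 := by
  calc ‖f‖ ^ 2 = (inner ℂ f f : ℂ).re := norm_sq_eq_re_inner (𝕜 := ℂ) f
    _ = ∫ x, inner ℝ (f x) (f x) := re_inner_eq_integral f f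
    _ = ∫ x, ‖f x‖ ^ 2 := by simp only [real_inner_self_eq_norm_sq]

theorem Q.norm_le_mul_norm_add {u v : Q} {c r : ℝ} (hc : 0 ≤ c) (hr : 0 ≤ r)
    (h : ‖u.toL2‖ ≤ c * ‖v.toL2‖) (h' : ‖Q.weakDeriv u‖ ≤ c * ‖Q.weakDeriv v‖ + r) :
    ‖u‖ ≤ c * ‖v‖ + r := by
  refine le_of_sq_le_sq ?_ (by positivity)
  have hsq := pow_le_pow_left₀ (norm_nonneg _) h 2
  have hsq' := pow_le_pow_left₀ (norm_nonneg _) h' 2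
  have hcross : c * ‖Q.weakDeriv v‖ * r ≤ c * ‖v‖ * r := by
    gcongr
    exact Q.norm_weakDeriv_le v
  calc ‖u‖ ^ 2 ≤ (c * ‖v.toL2‖) ^ 2 + (c * ‖Q.weakDeriv v‖ + r) ^ 2 := by
        rw [Q.norm_sq_eq]
        exact add_le_add hsq hsq'
    _ = c ^ 2 * ‖v‖ ^ 2 + 2 * (c * ‖Q.weakDeriv v‖ * r) + r ^ 2 := by
        rw [Q.norm_sq_eq v]
        ring
    _ ≤ (c * ‖v‖ + r) ^ 2 := by linarith

/-- The potential energy `∫ G(f(x)) dx`. -/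
def potentialEnergy (G : ℂ → ℝ) (f : L2) : ℝ := ∫ x, G (f x)

/-- A gauge invariant nonlinearity `N` of class `C¹` with bounded and uniformly continuous
derivative, which is the gradient of the potential `G`. -/
structure IsTame (N : ℂ → ℂ) (G : ℂ → ℝ) (L : NNReal) : Prop where
  contDiff : ContDiff ℝ 1 N
  norm_fderiv_le : ∀ z, ‖fderiv ℝ N z‖ ≤ L
  uniformContinuous_fderiv : UniformContinuous (fderiv ℝ N)
  exists_eq_real_mul : ∀ z, ∃ k : ℝ, N z = k * z
  potential_zero : G 0 = 0
  hasFDerivAt_potential : ∀ z, HasFDerivAt G (innerSL ℝ (N z)) z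

namespace IsTame

variable {N : ℂ → ℂ} {G : ℂ → ℝ} {L : NNReal}

theorem map_zero (h : IsTame N G L) : N 0 = 0 := by
  obtain ⟨k, hk⟩ := h.exists_eq_real_mul 0
  rw [hk, mul_zero]

theorem lipschitzWith (h : IsTame N G L) : LipschitzWith L N :=
  lipschitzWith_of_nnnorm_fderiv_le (h.contDiff.differentiable one_ne_zero) h.norm_fderiv_le

theorem real_inner_I_mul (h : IsTame N G L) (z : ℂ) : inner ℝ z (Complex.I * N z) = 0 := by
  obtain ⟨k, hk⟩ := h.exists_eq_real_mul z
  rw [hk, Complex.inner]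
  simp only [Complex.mul_re, Complex.mul_im, Complex.I_re, Complex.I_im, Complex.conj_re,
    Complex.conj_im, Complex.ofReal_re, Complex.ofReal_im]
  ring

theorem abs_potential_sub_le (h : IsTame N G L) (z w : ℂ) :
    |G w - G z - inner ℝ (N z) (w - z)| ≤ L * ‖w - z‖ ^ 2 := by
  have hderiv (y : ℂ) : HasFDerivAt (fun y => G y - innerSL ℝ (N z) y)
      (innerSL ℝ (N y) - innerSL ℝ (N z)) y :=
    (h.hasFDerivAt_potential y).sub (innerSL ℝ (N z)).hasFDerivAt
  have hbound : ∀ y ∈ Metric.closedBall z ‖w - z‖,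
      ‖innerSL ℝ (N y) - innerSL ℝ (N z)‖ ≤ L * ‖w - z‖ := fun y hy => by
    rw [← map_sub, innerSL_apply_norm]
    exact (h.lipschitzWith.norm_sub_le y z).trans
      (mul_le_mul_of_nonneg_left (mem_closedBall_iff_norm.mp hy) L.coe_nonneg)
  have hmean := (convex_closedBall z ‖w - z‖).norm_image_sub_le_of_norm_hasFDerivWithin_le
    (fun y _ => (hderiv y).hasFDerivWithinAt) hbound
    (Metric.mem_closedBall_self (norm_nonneg _)) (mem_closedBall_iff_norm.mpr le_rfl)
  rw [Real.norm_eq_abs, innerSL_apply_apply, innerSL_apply_apply] at hmean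
  rwa [inner_sub_right, sq, ← mul_assoc, sub_sub_sub_comm]

theorem abs_potential_le (h : IsTame N G L) (z : ℂ) : |G z| ≤ L * ‖z‖ ^ 2 := by
  simpa [h.map_zero, h.potential_zero] using h.abs_potential_sub_le 0 z

theorem integrable_potential (h : IsTame N G L) (f : L2) : Integrable fun x => G (f x) := by
  have hG : Continuous G :=
    continuous_iff_continuousAt.mpr fun z => (h.hasFDerivAt_potential z).continuousAt
  exact Integrable.mono' (((Lp.memLp f).integrable_norm_pow two_ne_zero).const_mul (L : ℝ))
    (hG.comp_aestronglyMeasurable (Lp.aestronglyMeasurable f))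
    (.of_forall fun x => h.abs_potential_le (f x))

/-- The superposition operator `f ↦ N ∘ f` on `L²`. -/
def comp (h : IsTame N G L) (f : L2) : L2 := h.lipschitzWith.compLp h.map_zero f

theorem coeFn_comp (h : IsTame N G L) (f : L2) : h.comp f =ᵐ[volume] fun x => N (f x) :=
  h.lipschitzWith.coeFn_compLp h.map_zero f

theorem lipschitzWith_comp (h : IsTame N G L) : LipschitzWith L h.comp :=
  h.lipschitzWith.lipschitzWith_compLp h.map_zero

theorem norm_comp_le (h : IsTame N G L) (f : L2) : ‖h.comp f‖ ≤ L * ‖f‖ :=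
  h.lipschitzWith.norm_compLp_le h.map_zero f

theorem re_inner_I_smul_comp (h : IsTame N G L) (f : L2) :
    (inner ℂ f (Complex.I • h.comp f) : ℂ).re = 0 := by
  rw [re_inner_eq_integral]
  refine integral_eq_zero_of_ae ?_
  filter_upwards [h.coeFn_comp f, Lp.coeFn_smul Complex.I (h.comp f)] with x hx hsmul
  rw [hsmul, Pi.smul_apply, hx, smul_eq_mul, h.real_inner_I_mul, Pi.zero_apply]

theorem abs_potentialEnergy_sub_le (h : IsTame N G L) (f g : L2) :
    |potentialEnergy G g - potentialEnergy G f - (inner ℂ (h.comp f) (g - f) : ℂ).re| ≤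
      L * ‖g - f‖ ^ 2 := by
  have hsub : Integrable fun x => G (g x) - G (f x) :=
    (h.integrable_potential g).sub (h.integrable_potential f)
  have hinner := integrable_real_inner (h.comp f) (g - f)
  calc |potentialEnergy G g - potentialEnergy G f - (inner ℂ (h.comp f) (g - f) : ℂ).re|
      = ‖∫ x, (G (g x) - G (f x) - inner ℝ (h.comp f x) ((g - f : L2) x))‖ := by
        rw [Real.norm_eq_abs, re_inner_eq_integral, integral_sub hsub hinner,
          integral_sub (h.integrable_potential g) (h.integrable_potential f)]
        rfl
    _ ≤ ∫ x, ‖G (g x) - G (f x) - inner ℝ (h.comp f x) ((g - f : L2) x)‖ :=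
        norm_integral_le_integral_norm _
    _ ≤ ∫ x, L * ‖(g - f : L2) x‖ ^ 2 := by
        refine integral_mono_ae (hsub.sub hinner).norm
          (((Lp.memLp (g - f)).integrable_norm_pow two_ne_zero).const_mul (L : ℝ)) ?_
        filter_upwards [h.coeFn_comp f, Lp.coeFn_sub g f] with x hcomp hx
        rw [hcomp, hx, Pi.sub_apply, Real.norm_eq_abs]
        exact h.abs_potential_sub_le (f x) (g x)
    _ = L * ‖g - f‖ ^ 2 := by rw [integral_const_mul, norm_sq_eq_integral]

theorem norm_fderiv_apply_le (h : IsTame N G L) (z w : ℂ) : ‖fderiv ℝ N z w‖ ≤ L * ‖w‖ :=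
  ContinuousLinearMap.le_of_opNorm_le _ (h.norm_fderiv_le z) w

theorem memLp_fderiv (h : IsTame N G L) (f g : L2) :
    MemLp (fun x => fderiv ℝ N (f x) (g x)) 2 (volume : Measure ℝ) := by
  refine (Lp.memLp g).of_le_mul (c := L) ?_ (.of_forall fun x => h.norm_fderiv_apply_le _ _)
  exact (ContinuousLinearMap.id ℝ (ℂ →L[ℝ] ℂ)).aestronglyMeasurable_comp₂
    (h.uniformContinuous_fderiv.continuous.comp_aestronglyMeasurable (Lp.aestronglyMeasurable f))
    (Lp.aestronglyMeasurable g)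

/-- The function `N'(f) g`, which is the weak derivative of `N(f)` if `g` is that of `f`. -/
def compDeriv (h : IsTame N G L) (f g : L2) : L2 := (h.memLp_fderiv f g).toLp _

theorem coeFn_compDeriv (h : IsTame N G L) (f g : L2) :
    h.compDeriv f g =ᵐ[volume] fun x => fderiv ℝ N (f x) (g x) := MemLp.coeFn_toLp _

theorem compDeriv_add (h : IsTame N G L) (f g k : L2) :
    h.compDeriv f (g + k) = h.compDeriv f g + h.compDeriv f k := by
  refine Lp.ext ?_
  filter_upwards [h.coeFn_compDeriv f (g + k), h.coeFn_compDeriv f g, h.coeFn_compDeriv f k,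
    Lp.coeFn_add g k, Lp.coeFn_add (h.compDeriv f g) (h.compDeriv f k)] with x hgk hg hk hadd hadd'
  rw [hadd', hgk, hadd, Pi.add_apply, Pi.add_apply, hg, hk, _root_.map_add]

theorem norm_compDeriv_le (h : IsTame N G L) (f g : L2) : ‖h.compDeriv f g‖ ≤ L * ‖g‖ := by
  refine Lp.norm_le_mul_norm_of_ae_le_mul ?_
  filter_upwards [h.coeFn_compDeriv f g] with x hx
  rw [hx]
  exact h.norm_fderiv_apply_le _ _

theorem exists_norm_compDeriv_sub_le (h : IsTame N G L) {ε : ℝ} (hε : 0 < ε) :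
    ∃ δ > 0, ∀ f₁ f₂ g : L2, (∀ᵐ x, ‖f₁ x - f₂ x‖ ≤ δ) →
      ‖h.compDeriv f₁ g - h.compDeriv f₂ g‖ ≤ ε * ‖g‖ := by
  obtain ⟨δ, hδ, hN⟩ := Metric.uniformContinuous_iff_le.mp h.uniformContinuous_fderiv ε hε
  refine ⟨δ, hδ, fun f₁ f₂ g hf => Lp.norm_le_mul_norm_of_ae_le_mul ?_⟩
  filter_upwards [h.coeFn_compDeriv f₁ g, h.coeFn_compDeriv f₂ g,
    Lp.coeFn_sub (h.compDeriv f₁ g) (h.compDeriv f₂ g), hf] with x h₁ h₂ hsub hx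
  rw [hsub, Pi.sub_apply, h₁, h₂, ← sub_apply]
  exact ContinuousLinearMap.le_of_opNorm_le _
    (dist_eq_norm (fderiv ℝ N (f₁ x)) _ ▸ hN (dist_eq_norm (f₁ x) _ ▸ hx)) _

theorem isHalfLinePrimitive (h : IsTame N G L) {f g : L2} {a b : ℂ}
    (hp : IsHalfLinePrimitive f g a b) :
    IsHalfLinePrimitive (h.comp f) (h.compDeriv f g) (N a) (N b) :=
  (hp.contDiff_comp h.contDiff).congr (h.coeFn_comp f).symm (h.coeFn_compDeriv f g).symm

/-- The superposition operator `u ↦ N ∘ u` on the energy space. -/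
def compQ (h : IsTame N G L) (u : Q) : Q :=
  ⟨WithLp.toLp 2 (h.comp u.toL2, h.compDeriv u.toL2 (Q.weakDeriv u)),
    (h.isHalfLinePrimitive (Q.isHalfLinePrimitive u)).isWeakDeriv⟩

theorem toL2_compQ (h : IsTame N G L) (u : Q) : (h.compQ u).toL2 = h.comp u.toL2 := rfl

theorem weakDeriv_compQ (h : IsTame N G L) (u : Q) :
    Q.weakDeriv (h.compQ u) = h.compDeriv u.toL2 (Q.weakDeriv u) := rfl

theorem norm_compQ_le (h : IsTame N G L) (u : Q) : ‖h.compQ u‖ ≤ L * ‖u‖ := by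
  have hle := Q.norm_le_mul_norm_add (u := h.compQ u) (v := u) L.coe_nonneg le_rfl
    (h.norm_comp_le u.toL2) ((h.norm_compDeriv_le u.toL2 _).trans_eq (add_zero _).symm)
  rwa [add_zero] at hle

theorem exists_norm_compQ_sub_le (h : IsTame N G L) {ε : ℝ} (hε : 0 < ε) : ∃ δ > 0, ∀ u v : Q,
    (∀ᵐ x, ‖u.toL2 x - v.toL2 x‖ ≤ δ) → ‖h.compQ u - h.compQ v‖ ≤ L * ‖u - v‖ + ε * ‖v‖ := by
  obtain ⟨δ, hδ, hN⟩ := h.exists_norm_compDeriv_sub_le hε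
  refine ⟨δ, hδ, fun u v huv => Q.norm_le_mul_norm_add L.coe_nonneg (by positivity) ?_ ?_⟩
  · rw [map_sub, map_sub]
    exact h.lipschitzWith_comp.norm_sub_le u.toL2 v.toL2
  have hsplit : Q.weakDeriv (h.compQ u - h.compQ v) = h.compDeriv u.toL2 (Q.weakDeriv (u - v)) +
      (h.compDeriv u.toL2 (Q.weakDeriv v) - h.compDeriv v.toL2 (Q.weakDeriv v)) := by
    rw [map_sub, weakDeriv_compQ, weakDeriv_compQ, ← add_sub_assoc, ← h.compDeriv_add,
      ← _root_.map_add, sub_add_cancel]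
  rw [hsplit]
  refine (norm_add_le _ _).trans (add_le_add (h.norm_compDeriv_le _ _) ?_)
  exact (hN _ _ _ huv).trans (by gcongr; exact Q.norm_weakDeriv_le v)

end IsTame

/-! ### A differential equation whose right-hand side is Lipschitz in a weaker norm -/

theorem norm_integral_le_of_norm_le_exp {E : Type*} [NormedAddCommGroup E] [NormedSpace ℝ E]
    {g : ℝ → E} {L c t : ℝ} (ht : 0 ≤ t)
    (h : ∀ s ∈ Icc 0 t, ‖g s‖ ≤ L * (c * Real.exp (2 * L * s))) :
    ‖∫ s in (0 : ℝ)..t, g s‖ ≤ c / 2 * (Real.exp (2 * L * t) - 1) := by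
  have hcont : Continuous fun s => L * (c * Real.exp (2 * L * s)) := by fun_prop
  have hderiv (s : ℝ) : HasDerivAt (fun s => c / 2 * Real.exp (2 * L * s))
      (L * (c * Real.exp (2 * L * s))) s := by
    refine (((hasDerivAt_id s).const_mul (2 * L)).exp.const_mul (c / 2)).congr_deriv ?_
    simp only [id_eq]
    ring
  calc ‖∫ s in (0 : ℝ)..t, g s‖ ≤ ∫ s in (0 : ℝ)..t, L * (c * Real.exp (2 * L * s)) :=
        intervalIntegral.norm_integral_le_of_norm_le ht
          (.of_forall fun s hs => h s ⟨hs.1.le, hs.2⟩) (hcont.intervalIntegrable _ _)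
    _ = c / 2 * (Real.exp (2 * L * t) - 1) := by
        rw [intervalIntegral.integral_eq_sub_of_hasDerivAt (fun s _ => hderiv s)
          (hcont.intervalIntegrable _ _), mul_zero, Real.exp_zero]
        ring

section ODE

variable {X Y : Type*} [NormedAddCommGroup X] [NormedSpace ℝ X]
  [NormedAddCommGroup Y] [NormedSpace ℝ Y]

/-- A continuous time-dependent vector field on `X` that is Lipschitz for the weaker norm `‖J x‖`,
has linear growth, and is Lipschitz for the norm of `X` up to an error that is small if
`‖J x - J y‖` is. -/
structure IsWeaklyLipschitz (J : X →L[ℝ] Y) (F : ℝ → X → X) (L : ℝ) : Prop where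
  pos : 0 < L
  continuous : Continuous fun p : ℝ × X => F p.1 p.2
  norm_map_sub_le : ∀ s x y, ‖J (F s x) - J (F s y)‖ ≤ L * ‖J x - J y‖
  norm_le : ∀ s x, ‖F s x‖ ≤ L * ‖x‖
  norm_sub_le : ∀ ε > 0, ∀ M, ∃ δ > 0, ∀ s x y, ‖x‖ ≤ M → ‖y‖ ≤ M → ‖J x - J y‖ ≤ δ →
    ‖F s x - F s y‖ ≤ L * ‖x - y‖ + ε

/-- The Picard iterates of the equation `x' = F t x`, `x 0 = x₀`. -/
def picard (F : ℝ → X → X) (x₀ : X) : ℕ → ℝ → X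
  | 0 => fun _ => x₀
  | k + 1 => fun t => x₀ + ∫ s in (0 : ℝ)..t, F s (picard F x₀ k s)

namespace IsWeaklyLipschitz

variable {J : X →L[ℝ] Y} {F : ℝ → X → X} {L : ℝ}

theorem one_le_exp (h : IsWeaklyLipschitz J F L) {t : ℝ} (ht : 0 ≤ t) :
    1 ≤ Real.exp (2 * L * t) :=
  Real.one_le_exp (mul_nonneg (mul_nonneg zero_le_two h.pos.le) ht)

theorem exp_le_exp (h : IsWeaklyLipschitz J F L) {s t : ℝ} (hst : s ≤ t) :
    Real.exp (2 * L * s) ≤ Real.exp (2 * L * t) :=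
  Real.exp_le_exp.mpr (mul_le_mul_of_nonneg_left hst (mul_nonneg zero_le_two h.pos.le))

theorem continuous_picard (h : IsWeaklyLipschitz J F L) (x₀ : X) (k : ℕ) :
    Continuous (picard F x₀ k) := by
  induction k with
  | zero => exact continuous_const
  | succ k ih =>
    have hcont : Continuous fun s => F s (picard F x₀ k s) :=
      h.continuous.comp (continuous_id.prodMk ih)
    exact continuous_const.add
      (intervalIntegral.continuous_primitive (fun _ _ => hcont.intervalIntegrable _ _) 0)

theorem continuous_apply_picard (h : IsWeaklyLipschitz J F L) (x₀ : X) (k : ℕ) :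
    Continuous fun s => F s (picard F x₀ k s) :=
  h.continuous.comp (continuous_id.prodMk (h.continuous_picard x₀ k))

theorem picard_succ_sub (h : IsWeaklyLipschitz J F L) (x₀ : X) (k l : ℕ) (t : ℝ) :
    picard F x₀ (k + 1) t - picard F x₀ (l + 1) t =
      ∫ s in (0 : ℝ)..t, (F s (picard F x₀ k s) - F s (picard F x₀ l s)) := by
  rw [intervalIntegral.integral_sub ((h.continuous_apply_picard x₀ k).intervalIntegrable _ _)
    ((h.continuous_apply_picard x₀ l).intervalIntegrable _ _)]
  exact add_sub_add_left_eq_sub _ _ _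

theorem norm_picard_le (h : IsWeaklyLipschitz J F L) (x₀ : X) (k : ℕ) {t : ℝ} (ht : 0 ≤ t) :
    ‖picard F x₀ k t‖ ≤ ‖x₀‖ * Real.exp (2 * L * t) := by
  induction k generalizing t with
  | zero => exact le_mul_of_one_le_right (norm_nonneg _) (h.one_le_exp ht)
  | succ k ih =>
    have h_int := norm_integral_le_of_norm_le_exp (g := fun s => F s (picard F x₀ k s)) ht
      fun s hs => (h.norm_le s _).trans (mul_le_mul_of_nonneg_left (ih hs.1) h.pos.le)
    have hexp := mul_le_mul_of_nonneg_left (h.one_le_exp ht) (norm_nonneg x₀)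
    exact (norm_add_le _ _).trans (by linarith)

theorem norm_picard_sub_picard_le (h : IsWeaklyLipschitz J F L) (x₀ : X) (k l : ℕ) {t : ℝ}
    (ht : 0 ≤ t) :
    ‖picard F x₀ k t - picard F x₀ l t‖ ≤ 2 * ‖x₀‖ * Real.exp (2 * L * t) := by
  linarith [_root_.norm_sub_le (picard F x₀ k t) (picard F x₀ l t), h.norm_picard_le x₀ k ht,
    h.norm_picard_le x₀ l ht]

theorem norm_map_picard_sub_le [CompleteSpace X] [CompleteSpace Y] (h : IsWeaklyLipschitz J F L)
    (x₀ : X) (k n : ℕ) {t : ℝ} (ht : 0 ≤ t) :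
    ‖J (picard F x₀ (k + n) t) - J (picard F x₀ k t)‖ ≤
      ‖J‖ * (2 * ‖x₀‖) * (1 / 2) ^ k * Real.exp (2 * L * t) := by
  induction k generalizing t with
  | zero =>
    rw [← map_sub, pow_zero, mul_one, mul_assoc]
    exact J.le_opNorm_of_le (h.norm_picard_sub_picard_le x₀ _ _ ht)
  | succ k ih =>
    have hcont : Continuous fun s => F s (picard F x₀ (k + n) s) - F s (picard F x₀ k s) :=
      (h.continuous_apply_picard x₀ (k + n)).sub (h.continuous_apply_picard x₀ k)
    rw [← map_sub, Nat.add_right_comm, h.picard_succ_sub,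
      ← J.intervalIntegral_comp_comm (hcont.intervalIntegrable 0 t)]
    refine (norm_integral_le_of_norm_le_exp (L := L) (c := ‖J‖ * (2 * ‖x₀‖) * (1 / 2) ^ k) ht
      fun s hs => ?_).trans ?_
    · rw [map_sub]
      exact (h.norm_map_sub_le s _ _).trans (mul_le_mul_of_nonneg_left (ih hs.1) h.pos.le)
    · have hnonneg : 0 ≤ ‖J‖ * (2 * ‖x₀‖) * (1 / 2) ^ k := by positivity
      rw [pow_succ]
      linarith

theorem exists_forall_norm_map_picard_sub_le [CompleteSpace X] [CompleteSpace Y]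
    (h : IsWeaklyLipschitz J F L) (x₀ : X) (T : ℝ) {δ : ℝ} (hδ : 0 < δ) :
    ∃ k₀, ∀ k ≥ k₀, ∀ n, ∀ t ∈ Icc 0 T,
      ‖J (picard F x₀ (k + n) t) - J (picard F x₀ k t)‖ ≤ δ := by
  have hlim := ((tendsto_pow_atTop_nhds_zero_of_lt_one one_half_pos.le one_half_lt_one).const_mul
    (‖J‖ * (2 * ‖x₀‖))).mul_const (Real.exp (2 * L * T))
  rw [mul_zero, zero_mul] at hlim
  obtain ⟨k₀, hk₀⟩ := eventually_atTop.mp (hlim.eventually (gt_mem_nhds hδ))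
  refine ⟨k₀, fun k hk n t ht => (h.norm_map_picard_sub_le x₀ k n ht.1).trans ?_⟩
  exact (mul_le_mul_of_nonneg_left (h.exp_le_exp ht.2) (by positivity)).trans (hk₀ k hk).le

/-- Once the iterates are close in the weak norm, the difference of successive ones is halved in
the weighted norm at each step, up to the error allowed by `norm_sub_le`. -/
theorem exists_forall_norm_picard_sub_le [CompleteSpace X] [CompleteSpace Y]
    (h : IsWeaklyLipschitz J F L) (x₀ : X) (T : ℝ) {η : ℝ} (hη : 0 < η) :
    ∃ k₀, ∀ i, ∀ k ≥ k₀ + i, ∀ n, ∀ t ∈ Icc 0 T,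
      ‖picard F x₀ (k + n) t - picard F x₀ k t‖ ≤
        (2 * ‖x₀‖ * (1 / 2) ^ i + η) * Real.exp (2 * L * t) := by
  have hL := h.pos
  obtain ⟨δ, hδ, hF⟩ := h.norm_sub_le (L * η) (by positivity) (‖x₀‖ * Real.exp (2 * L * T))
  obtain ⟨k₀, hk₀⟩ := h.exists_forall_norm_map_picard_sub_le x₀ T hδ
  have hbound (k : ℕ) : ∀ s ∈ Icc 0 T, ‖picard F x₀ k s‖ ≤ ‖x₀‖ * Real.exp (2 * L * T) :=
    fun s hs => (h.norm_picard_le x₀ k hs.1).trans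
      (mul_le_mul_of_nonneg_left (h.exp_le_exp hs.2) (norm_nonneg _))
  refine ⟨k₀, fun i => ?_⟩
  induction i with
  | zero =>
    intro k _ n t ht
    rw [pow_zero, mul_one, add_mul]
    exact (h.norm_picard_sub_picard_le x₀ _ _ ht.1).trans
      (le_add_of_nonneg_right (by positivity))
  | succ i ih =>
    intro k hk n t ht
    obtain ⟨k, rfl⟩ := Nat.exists_eq_add_one_of_ne_zero (show k ≠ 0 by omega)
    rw [Nat.add_right_comm, h.picard_succ_sub]
    refine (norm_integral_le_of_norm_le_exp (L := L) (c := 2 * ‖x₀‖ * (1 / 2) ^ i + η + η) ht.1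
      fun s hs => ?_).trans ?_
    · have hsT : s ∈ Icc 0 T := ⟨hs.1, hs.2.trans ht.2⟩
      have hη' := mul_le_mul_of_nonneg_left (h.one_le_exp hs.1) (mul_nonneg hL.le hη.le)
      have hstep := mul_le_mul_of_nonneg_left (ih k (by omega) n s hsT) hL.le
      exact (hF s _ _ (hbound _ s hsT) (hbound _ s hsT) (hk₀ k (by omega) n s hsT)).trans
        (by linarith)
    · have hnonneg : 0 ≤ 2 * ‖x₀‖ * (1 / 2) ^ i + η + η := by positivity
      rw [pow_succ]
      linarith

theorem uniformCauchySeqOn_picard [CompleteSpace X] [CompleteSpace Y] (h : IsWeaklyLipschitz J F L)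
    (x₀ : X) (T : ℝ) : UniformCauchySeqOn (picard F x₀) atTop (Icc 0 T) := by
  refine Metric.uniformCauchySeqOn_iff.mpr fun ε hε => ?_
  let E := Real.exp (2 * L * T)
  have hE : 0 < E := Real.exp_pos _
  obtain ⟨k₀, hk₀⟩ := h.exists_forall_norm_picard_sub_le x₀ T (show 0 < ε / (6 * E) by positivity)
  have hlim := (tendsto_pow_atTop_nhds_zero_of_lt_one one_half_pos.le one_half_lt_one).const_mul
    (2 * ‖x₀‖)
  rw [mul_zero] at hlim
  obtain ⟨i, hi⟩ := (hlim.eventually (gt_mem_nhds (show 0 < ε / (6 * E) by positivity))).exists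
  have hclose (n : ℕ) : ∀ t ∈ Icc 0 T,
      dist (picard F x₀ (k₀ + i + n) t) (picard F x₀ (k₀ + i) t) ≤ ε / 3 := fun t ht => by
    rw [dist_eq_norm]
    calc _ ≤ (2 * ‖x₀‖ * (1 / 2) ^ i + ε / (6 * E)) * Real.exp (2 * L * t) :=
          hk₀ i _ le_rfl n t ht
      _ ≤ (ε / (6 * E) + ε / (6 * E)) * E := by
          gcongr
          exact h.exp_le_exp ht.2
      _ = ε / 3 := by field_simp; norm_num
  refine ⟨k₀ + i, fun k hk l hl t ht => ?_⟩
  obtain ⟨a, rfl⟩ := Nat.exists_eq_add_of_le hk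
  obtain ⟨b, rfl⟩ := Nat.exists_eq_add_of_le hl
  linarith [dist_triangle_right (picard F x₀ (k₀ + i + a) t) (picard F x₀ (k₀ + i + b) t)
    (picard F x₀ (k₀ + i) t), hclose a t ht, hclose b t ht]

theorem exists_tendsto_picard [CompleteSpace X] [CompleteSpace Y] (h : IsWeaklyLipschitz J F L)
    (x₀ : X) : ∃ v : ℝ → X, ContinuousOn v (Ici 0) ∧
      ∀ t, 0 ≤ t → Tendsto (fun k => picard F x₀ k t) atTop (𝓝 (v t)) := by
  have hlim (t : ℝ) (ht : 0 ≤ t) : ∃ y, Tendsto (fun k => picard F x₀ k t) atTop (𝓝 y) :=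
    cauchySeq_tendsto_of_complete
      ((h.uniformCauchySeqOn_picard x₀ t).cauchySeq (right_mem_Icc.mpr ht))
  choose! v hv using hlim
  have hcont (T : ℝ) : ContinuousOn v (Icc 0 T) :=
    ((h.uniformCauchySeqOn_picard x₀ T).tendstoUniformlyOn_of_tendsto fun t ht =>
      hv t ht.1).continuousOn (.of_forall fun k => (h.continuous_picard x₀ k).continuousOn)
  refine ⟨v, fun t ht => ?_, hv⟩
  exact (hcont (t + 1) t ⟨ht, (lt_add_one t).le⟩).mono_of_mem_nhdsWithin
    (inter_mem_nhdsWithin _ (Iic_mem_nhds (lt_add_one t)))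

theorem eq_add_integral_of_tendsto_picard (h : IsWeaklyLipschitz J F L) {x₀ : X} {v : ℝ → X}
    (hv : ∀ t, 0 ≤ t → Tendsto (fun k => picard F x₀ k t) atTop (𝓝 (v t))) {t : ℝ} (ht : 0 ≤ t) :
    v t = x₀ + ∫ s in (0 : ℝ)..t, F s (v s) := by
  have h_int : Tendsto (fun k => ∫ s in (0 : ℝ)..t, F s (picard F x₀ k s)) atTop
      (𝓝 (∫ s in (0 : ℝ)..t, F s (v s))) := by
    refine intervalIntegral.tendsto_integral_filter_of_dominated_convergence
      (fun _ => L * (‖x₀‖ * Real.exp (2 * L * t)))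
      (.of_forall fun k => (h.continuous_apply_picard x₀ k).aestronglyMeasurable)
      (.of_forall fun k => .of_forall fun s hs => ?_) intervalIntegrable_const
      (.of_forall fun s hs => ?_) <;> rw [uIoc_of_le ht] at hs
    · have hL := h.pos
      refine (h.norm_le s _).trans ?_
      gcongr
      exact (h.norm_picard_le x₀ k hs.1.le).trans (by gcongr; exact hs.2)
    · exact (h.continuous.tendsto (s, v s)).comp
        (tendsto_const_nhds.prodMk_nhds (hv s hs.1.le))
  exact tendsto_nhds_unique ((hv t ht).comp (tendsto_add_atTop_nat 1)) (h_int.const_add x₀)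

theorem exists_hasDerivAt [CompleteSpace X] [CompleteSpace Y] (h : IsWeaklyLipschitz J F L)
    (x₀ : X) : ∃ w f : ℝ → X, w 0 = x₀ ∧ Continuous f ∧ (∀ t, HasDerivAt w (f t) t) ∧
      ∀ t, 0 ≤ t → f t = F t (w t) := by
  obtain ⟨v, hvc, hv⟩ := h.exists_tendsto_picard x₀
  let f : ℝ → X := fun t => F (max t 0) (v (max t 0))
  have hmax : Continuous fun t : ℝ => max t 0 := by fun_prop
  have hf : Continuous f :=
    h.continuous.comp (hmax.prodMk (hvc.comp_continuous hmax fun t => le_max_right t 0))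
  have hfv (t : ℝ) (ht : 0 ≤ t) : f t = F t (v t) := by simp only [f, max_eq_left ht]
  refine ⟨fun t => x₀ + ∫ s in (0 : ℝ)..t, f s, f, by simp, hf,
    fun t => (hf.integral_hasStrictDerivAt 0 t).hasDerivAt.const_add x₀, fun t ht => ?_⟩
  rw [hfv t ht, h.eq_add_integral_of_tendsto_picard hv ht,
    intervalIntegral.integral_congr fun s hs => (hfv s ((uIcc_of_le ht ▸ hs).1)).symm]

end IsWeaklyLipschitz

end ODE

/-! ### Conservation laws -/

section Evolution

open scoped InnerProduct

variable {X Y : Type*} [NormedAddCommGroup X] [InnerProductSpace ℂ X]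
  [NormedAddCommGroup Y] [InnerProductSpace ℂ Y]

/-- A nonlinear operator `n` on `Y` that conserves the norm, has the potential `e`, and lifts along
`J` to an operator `N` on `X` that is Lipschitz up to an error controlled by the norm `‖J x‖`. -/
structure IsPotentialOp (J : X →L[ℂ] Y) (N : X → X) (n : Y → Y) (e : Y → ℝ) (L : ℝ) : Prop where
  pos : 0 < L
  map_apply : ∀ x, J (N x) = n (J x)
  norm_target_sub_le : ∀ f g, ‖n f - n g‖ ≤ L * ‖f - g‖
  norm_le : ∀ x, ‖N x‖ ≤ L * ‖x‖
  norm_sub_le : ∀ ε > 0, ∀ M, ∃ δ > 0, ∀ x y, ‖x‖ ≤ M → ‖y‖ ≤ M → ‖J x - J y‖ ≤ δ →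
    ‖N x - N y‖ ≤ L * ‖x - y‖ + ε
  re_inner_I_smul : ∀ f, (inner ℂ f (Complex.I • n f) : ℂ).re = 0
  abs_potential_sub_le : ∀ f g, |e g - e f - (inner ℂ (n f) (g - f) : ℂ).re| ≤ L * ‖g - f‖ ^ 2

/-- The equation `ψ' = i (A ψ + lam N ψ)`, where `iA` generates `U`, written for `t ≥ 0` in the
interaction picture `w t = U (-t) (ψ t)`; the function `f` is the derivative of `w`. -/
structure IsInteractionSolution (U : ℝ → X →L[ℂ] X) (N : X → X) (lam : ℝ) (w f : ℝ → X) :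
    Prop where
  continuous_deriv : Continuous f
  hasDerivAt : ∀ t, HasDerivAt w (f t) t
  apply_deriv : ∀ t, 0 ≤ t → U t (f t) = (Complex.I * lam) • N (U t (w t))

theorem IsIsometricGroup.hasDerivAt_apply_of_eq_zero {U : ℝ → X →L[ℂ] X}
    (hU : IsIsometricGroup U) {v : ℝ → X} {v' : X} {t : ℝ} (hv : HasDerivAt v v' t)
    (hvt : v t = 0) : HasDerivAt (fun s => U s (v s)) (U t v') t := by
  rw [hasDerivAt_iff_isLittleO] at hv ⊢
  have hremainder : (fun s => U s (v s - v t - (s - t) • v')) =o[𝓝 t] fun s => s - t :=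
    Asymptotics.isLittleO_norm_left.mp
      ((Asymptotics.isLittleO_norm_left.mpr hv).congr_left fun s => (hU.norm_map _ _).symm)
  have hlinear : (fun s => (s - t) • (U s v' - U t v')) =o[𝓝 t] fun s => s - t := by
    have hzero : (fun s => U s v' - U t v') =o[𝓝 t] fun _ => (1 : ℝ) :=
      (Asymptotics.isLittleO_one_iff ℝ).mpr
        (tendsto_sub_nhds_zero_iff.mpr ((hU.continuous v').tendsto t))
    simpa only [smul_eq_mul, mul_one] using
      (Asymptotics.isBigO_refl (fun s : ℝ => s - t) (𝓝 t)).smul_isLittleO hzero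
  refine (hremainder.add hlinear).congr_left fun s => ?_
  have hsmul (r : ℝ) : U s (r • v') = r • U s v' := map_real_smul (U s) (U s).continuous r v'
  rw [hvt, map_sub, map_sub, hsmul, _root_.map_zero, _root_.map_zero, smul_sub]
  abel

theorem hasDerivAt_norm_sq {w : ℝ → X} {w' : X} {t : ℝ} (hw : HasDerivAt w w' t) :
    HasDerivAt (fun s => ‖w s‖ ^ 2) (2 * (inner ℂ (w t) w' : ℂ).re) t := by
  let _ : InnerProductSpace ℝ X := InnerProductSpace.rclikeToReal ℂ X
  exact hw.norm_sq

section Completeness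

variable [CompleteSpace X] [CompleteSpace Y]

theorem inner_adjoint_apply_self (J : X →L[ℂ] Y) (x : X) :
    inner ℂ x ((J†) (J x)) = ((‖J x‖ ^ 2 : ℝ) : ℂ) := by
  rw [ContinuousLinearMap.adjoint_inner_right, inner_self_eq_norm_sq_to_K]
  push_cast
  rfl

theorem norm_map_sq_le_norm_mul_norm_adjoint (J : X →L[ℂ] Y) (x : X) :
    ‖J x‖ ^ 2 ≤ ‖x‖ * ‖(J†) (J x)‖ := by
  refine le_of_eq_of_le ?_ (norm_inner_le_norm (𝕜 := ℂ) x ((J†) (J x)))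
  rw [inner_adjoint_apply_self, Complex.norm_real, Real.norm_of_nonneg (by positivity)]

theorem IsGroupPair.hasDerivAt_adjoint_map {m : ℝ} {J : X →L[ℂ] Y} {U : ℝ → X →L[ℂ] X}
    {V : ℝ → Y →L[ℂ] Y} (hp : IsGroupPair m J U V) {w : ℝ → X} {w' : X} {t : ℝ}
    (hw : HasDerivAt w w' t) :
    HasDerivAt (fun s => (J†) (J (U s (w s))))
      (-(Complex.I • (U t (w t) - (m : ℂ) • (J†) (J (U t (w t))))) + (J†) (J (U t w'))) t := by
  have hcomm (s : ℝ) (x : X) : (J†) (J (U s x)) = U s ((J†) (J x)) :=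
    (hp.source.apply_comm s x).symm
  have hgroup := hp.source.hasDerivAt_of_hasDerivAt_zero (hp.source.hasDerivAt_zero (w t)) t
  have hincrement : HasDerivAt (fun s => (J† ∘L J) (w s) - (J† ∘L J) (w t)) ((J† ∘L J) w') t :=
    (((J† ∘L J).restrictScalars ℝ).hasFDerivAt.comp_hasDerivAt t hw).sub_const _
  have hsum := hgroup.add (hp.source.hasDerivAt_apply_of_eq_zero hincrement (sub_self _))
  refine (hsum.congr_of_eventuallyEq (.of_forall fun s => ?_)).congr_deriv ?_
  · simp only [Pi.add_apply, map_sub, add_sub_cancel, hcomm, ContinuousLinearMap.comp_apply]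
  · simp only [map_neg, map_smul, map_sub, hcomm, ContinuousLinearMap.comp_apply]

end Completeness

namespace IsPotentialOp

variable {J : X →L[ℂ] Y} {N : X → X} {n : Y → Y} {e : Y → ℝ} {L : ℝ}

theorem im_inner_apply (hN : IsPotentialOp J N n e L) (f : Y) : (inner ℂ f (n f) : ℂ).im = 0 := by
  simpa only [inner_smul_right, Complex.I_mul_re, neg_eq_zero] using hN.re_inner_I_smul f

theorem re_inner_apply_I_smul (hN : IsPotentialOp J N n e L) (f : Y) :
    (inner ℂ (n f) (Complex.I • f) : ℂ).re = 0 := by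
  rw [inner_smul_right, Complex.I_mul_re, ← inner_conj_symm, Complex.conj_im, hN.im_inner_apply,
    neg_zero, neg_zero]

theorem continuous (hN : IsPotentialOp J N n e L) : Continuous N := by
  refine continuous_iff_continuousAt.mpr fun x => Metric.tendsto_nhds.mpr fun ε hε => ?_
  obtain ⟨δ, hδ, hδN⟩ := hN.norm_sub_le (ε / 2) (half_pos hε) (‖x‖ + 1)
  have hmap : ∀ᶠ y in 𝓝 x, ‖J y - J x‖ < δ :=
    (show Continuous fun y => ‖J y - J x‖ by fun_prop).tendsto x |>.eventually
      (gt_mem_nhds (by rwa [sub_self, norm_zero]))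
  have hdist : ∀ᶠ y in 𝓝 x, L * ‖y - x‖ < ε / 2 :=
    (show Continuous fun y => L * ‖y - x‖ by fun_prop).tendsto x |>.eventually
      (gt_mem_nhds (by rw [sub_self, norm_zero, mul_zero]; exact half_pos hε))
  have hnorm : ∀ᶠ y in 𝓝 x, ‖y‖ < ‖x‖ + 1 :=
    (continuous_norm.tendsto x).eventually (gt_mem_nhds (lt_add_one _))
  filter_upwards [hmap, hdist, hnorm] with y hmapy hdisty hnormy
  rw [dist_eq_norm]
  linarith [hδN y x hnormy.le (lt_add_one _).le hmapy.le]

variable [CompleteSpace X] [CompleteSpace Y]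

theorem hasDerivAt_potential (hN : IsPotentialOp J N n e L) {ψ : ℝ → X} {z' : X} {t : ℝ}
    (hψ : ContinuousAt ψ t) (hz : HasDerivAt (fun s => (J†) (J (ψ s))) z' t) :
    HasDerivAt (fun s => e (J (ψ s))) (inner ℂ (N (ψ t)) z' : ℂ).re t := by
  have hlinear : HasDerivAt (fun s => (inner ℂ (N (ψ t)) ((J†) (J (ψ s))) : ℂ).re)
      (inner ℂ (N (ψ t)) z' : ℂ).re t := by
    simpa using! Complex.reCLM.hasFDerivAt.comp_hasDerivAt t
      ((hasDerivAt_const t (N (ψ t))).inner ℂ hz)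
  rw [hasDerivAt_iff_isLittleO] at hlinear ⊢
  have hproduct : (fun s => L * (‖ψ s - ψ t‖ * ‖(J†) (J (ψ s)) - (J†) (J (ψ t))‖)) =o[𝓝 t]
      fun s => s - t := by
    have hzero : (fun s => ‖ψ s - ψ t‖) =o[𝓝 t] fun _ => (1 : ℝ) :=
      ((Asymptotics.isLittleO_one_iff ℝ).mpr (tendsto_sub_nhds_zero_iff.mpr hψ)).norm_left
    simpa only [one_mul] using (hzero.mul_isBigO hz.isBigO_sub.norm_left).const_mul_left L
  have hremainder : (fun s => e (J (ψ s)) - e (J (ψ t)) -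
      (inner ℂ (n (J (ψ t))) (J (ψ s) - J (ψ t)) : ℂ).re) =o[𝓝 t] fun s => s - t := by
    refine (Asymptotics.IsBigO.of_norm_le fun s => ?_).trans_isLittleO hproduct
    refine (hN.abs_potential_sub_le _ _).trans (mul_le_mul_of_nonneg_left ?_ hN.pos.le)
    simpa only [map_sub] using norm_map_sq_le_norm_mul_norm_adjoint J (ψ s - ψ t)
  refine (hremainder.add hlinear).congr_left fun s => ?_
  simp only [ContinuousLinearMap.adjoint_inner_right, hN.map_apply, inner_sub_right, Complex.sub_re]
  abel

variable {m : ℝ} {U : ℝ → X →L[ℂ] X} {V : ℝ → Y →L[ℂ] Y}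

theorem isWeaklyLipschitz (hN : IsPotentialOp J N n e L) (hp : IsGroupPair m J U V) (c : ℂ) :
    IsWeaklyLipschitz (J.restrictScalars ℝ) (fun s x => U (-s) (c • N (U s x)))
      ((‖c‖ + 1) * L) where
  pos := mul_pos (by positivity) hN.pos
  continuous := hp.source.continuous_uncurry.comp (continuous_fst.neg.prodMk
    ((hN.continuous.comp hp.source.continuous_uncurry).const_smul c))
  norm_map_sub_le s x y := by
    simp only [ContinuousLinearMap.coe_restrictScalars']
    rw [hp.map_apply, hp.map_apply, ← map_sub, hp.target.norm_map, map_smul, map_smul, ← smul_sub,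
      norm_smul, hN.map_apply, hN.map_apply, mul_assoc, hp.map_apply, hp.map_apply]
    refine mul_le_mul (le_add_of_nonneg_right zero_le_one)
      ((hN.norm_target_sub_le _ _).trans_eq ?_) (norm_nonneg _) (by positivity)
    rw [← map_sub, hp.target.norm_map]
  norm_le s x := by
    rw [hp.source.norm_map, norm_smul, mul_assoc]
    refine mul_le_mul (le_add_of_nonneg_right zero_le_one) ((hN.norm_le _).trans_eq ?_)
      (norm_nonneg _) (by positivity)
    rw [hp.source.norm_map]
  norm_sub_le ε hε M := by
    obtain ⟨δ, hδ, hδN⟩ := hN.norm_sub_le (ε / (‖c‖ + 1)) (by positivity) M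
    refine ⟨δ, hδ, fun s x y hx hy hxy => ?_⟩
    have hN_sub := hδN (U s x) (U s y) (by rwa [hp.source.norm_map]) (by rwa [hp.source.norm_map])
      (by rwa [hp.map_apply, hp.map_apply, ← map_sub, hp.target.norm_map])
    rw [← map_sub, hp.source.norm_map] at hN_sub
    calc ‖U (-s) (c • N (U s x)) - U (-s) (c • N (U s y))‖
        = ‖c‖ * ‖N (U s x) - N (U s y)‖ := by
          rw [← map_sub, hp.source.norm_map, ← smul_sub, norm_smul]
      _ ≤ (‖c‖ + 1) * (L * ‖x - y‖ + ε / (‖c‖ + 1)) :=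
          mul_le_mul (le_add_of_nonneg_right zero_le_one) hN_sub (norm_nonneg _) (by positivity)
      _ = (‖c‖ + 1) * L * ‖x - y‖ + ε := by
          rw [mul_add, mul_assoc, mul_div_cancel₀ _ (by positivity)]

theorem exists_isInteractionSolution (hN : IsPotentialOp J N n e L) (hp : IsGroupPair m J U V)
    (lam : ℝ) (x₀ : X) : ∃ w f, w 0 = x₀ ∧ IsInteractionSolution U N lam w f := by
  obtain ⟨w, f, hw₀, hf, hw, hfw⟩ :=
    (hN.isWeaklyLipschitz hp (Complex.I * lam)).exists_hasDerivAt x₀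
  exact ⟨w, f, hw₀, hf, hw, fun t ht => by rw [hfw t ht, hp.source.apply_neg_apply]⟩

end IsPotentialOp

namespace IsInteractionSolution

variable {J : X →L[ℂ] Y} {N : X → X} {n : Y → Y} {e : Y → ℝ} {L m lam : ℝ}
  {U : ℝ → X →L[ℂ] X} {V : ℝ → Y →L[ℂ] Y} {w f : ℝ → X}

theorem continuous (h : IsInteractionSolution U N lam w f) (hU : IsIsometricGroup U) :
    Continuous fun t => U t (w t) :=
  hU.continuous_uncurry.comp (continuous_id.prodMk
    (continuous_iff_continuousAt.mpr fun t => (h.hasDerivAt t).continuousAt))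

theorem re_inner_deriv (h : IsInteractionSolution U N lam w f) (hU : IsIsometricGroup U) {t : ℝ}
    (ht : 0 ≤ t) :
    (inner ℂ (w t) (f t) : ℂ).re = -(lam * (inner ℂ (U t (w t)) (N (U t (w t))) : ℂ).im) := by
  rw [← hU.inner_map_map t, h.apply_deriv t ht, inner_smul_right, mul_comm Complex.I, mul_assoc,
    Complex.re_ofReal_mul, Complex.I_mul_re, mul_neg]

variable [CompleteSpace X] [CompleteSpace Y]

theorem duhamel (h : IsInteractionSolution U N lam w f) (hp : IsGroupPair m J U V)
    (hN : ∀ x, J (N x) = n (J x)) {t : ℝ} (ht : 0 ≤ t) :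
    J (U t (w t)) = V t (J (w 0)) +
      (Complex.I * lam) • ∫ s in (0 : ℝ)..t, V (t - s) (n (J (U s (w s)))) := by
  have h_int := h.continuous_deriv.intervalIntegrable (μ := volume) 0 t
  have hw : w t = w 0 + ∫ s in (0 : ℝ)..t, f s := by
    rw [intervalIntegral.integral_eq_sub_of_hasDerivAt (fun s _ => h.hasDerivAt s) h_int]
    abel
  have hcomm : V t (J (∫ s in (0 : ℝ)..t, f s)) = ∫ s in (0 : ℝ)..t, V t (J (f s)) :=
    (((V t ∘L J).restrictScalars ℝ).intervalIntegral_comp_comm h_int).symm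
  rw [hp.map_apply, hw, map_add, map_add, hcomm, ← intervalIntegral.integral_smul]
  congr 1
  refine intervalIntegral.integral_congr fun s hs => ?_
  rw [uIcc_of_le ht] at hs
  calc V t (J (f s)) = V (t - s) (V s (J (f s))) := by rw [hp.target.apply_apply, sub_add_cancel]
    _ = (Complex.I * lam) • V (t - s) (n (J (U s (w s)))) := by
      rw [← hp.map_apply, h.apply_deriv s hs.1, map_smul, map_smul, hN]

theorem norm_map_eq (h : IsInteractionSolution U N lam w f) (hp : IsGroupPair m J U V)
    (hN : IsPotentialOp J N n e L) {t : ℝ} (ht : 0 ≤ t) : ‖J (U t (w t))‖ = ‖J (w 0)‖ := by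
  have hderiv (s : ℝ) :
      HasDerivAt (fun s => ‖J (w s)‖ ^ 2) (2 * (inner ℂ (J (w s)) (J (f s)) : ℂ).re) s :=
    hasDerivAt_norm_sq ((J.restrictScalars ℝ).hasFDerivAt.comp_hasDerivAt s (h.hasDerivAt s))
  have hzero (s : ℝ) (hs : 0 ≤ s) : (inner ℂ (J (w s)) (J (f s)) : ℂ).re = 0 := by
    rw [← hp.target.inner_map_map s, ← hp.map_apply, ← hp.map_apply, h.apply_deriv s hs, map_smul,
      hN.map_apply, mul_comm, mul_smul, inner_smul_right, Complex.re_ofReal_mul,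
      hN.re_inner_I_smul, mul_zero]
  have hconst := constant_of_has_deriv_right_zero
    (fun s _ => (hderiv s).continuousAt.continuousWithinAt)
    (fun s hs => ((hderiv s).congr_deriv (by rw [hzero s hs.1, mul_zero])).hasDerivWithinAt)
    t (right_mem_Icc.mpr ht)
  rw [hp.map_apply, hp.target.norm_map]
  exact (sq_eq_sq₀ (norm_nonneg _) (norm_nonneg _)).mp hconst

theorem re_inner_deriv_potential (h : IsInteractionSolution U N lam w f)
    (hN : IsPotentialOp J N n e L) {t : ℝ} (ht : 0 ≤ t) :
    (inner ℂ (N (U t (w t))) (-(Complex.I • (U t (w t) - (m : ℂ) • (J†) (J (U t (w t))))) +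
      (J†) (J (U t (f t)))) : ℂ).re = -(inner ℂ (U t (w t)) (N (U t (w t))) : ℂ).im := by
  have hmass :
      (inner ℂ (N (U t (w t))) (Complex.I • (m : ℂ) • (J†) (J (U t (w t)))) : ℂ).re = 0 := by
    rw [smul_comm, inner_smul_right, Complex.re_ofReal_mul, ← map_smul,
      ContinuousLinearMap.adjoint_inner_right, hN.map_apply, hN.re_inner_apply_I_smul, mul_zero]
  have hnonlinear : (inner ℂ (N (U t (w t))) ((J†) (J (U t (f t)))) : ℂ).re = 0 := by
    rw [h.apply_deriv t ht, map_smul, map_smul, inner_smul_right, inner_adjoint_apply_self,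
      mul_comm Complex.I, mul_assoc, Complex.re_ofReal_mul, Complex.I_mul_re, Complex.ofReal_im,
      neg_zero, mul_zero]
  have hlinear : (inner ℂ (N (U t (w t))) (Complex.I • U t (w t)) : ℂ).re =
      (inner ℂ (U t (w t)) (N (U t (w t))) : ℂ).im := by
    rw [inner_smul_right, Complex.I_mul_re, ← inner_conj_symm, Complex.conj_im, neg_neg]
  rw [inner_add_right, inner_neg_right, smul_sub, inner_sub_right, Complex.add_re, Complex.neg_re,
    Complex.sub_re, hmass, hnonlinear, hlinear, sub_zero, add_zero]

theorem energy_eq (h : IsInteractionSolution U N lam w f) (hp : IsGroupPair m J U V)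
    (hN : IsPotentialOp J N n e L) {t : ℝ} (ht : 0 ≤ t) :
    ‖U t (w t)‖ ^ 2 / 2 - lam * e (J (U t (w t))) = ‖w 0‖ ^ 2 / 2 - lam * e (J (w 0)) := by
  have hderiv (s : ℝ) := ((hasDerivAt_norm_sq (h.hasDerivAt s)).div_const 2).sub
    ((hN.hasDerivAt_potential (h.continuous hp.source.toIsIsometricGroup).continuousAt
      (hp.hasDerivAt_adjoint_map (h.hasDerivAt s))).const_mul lam)
  have hconst := constant_of_has_deriv_right_zero
    (fun s _ => (hderiv s).continuousAt.continuousWithinAt)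
    (fun s hs => ((hderiv s).congr_deriv (by
      rw [h.re_inner_deriv hp.source.toIsIsometricGroup hs.1, h.re_inner_deriv_potential hN hs.1]
      ring)).hasDerivWithinAt) t (right_mem_Icc.mpr ht)
  simpa only [Pi.sub_apply, hp.source.norm_map, hp.source.zero_apply] using hconst

theorem contDiff_adjoint_map (h : IsInteractionSolution U N lam w f) (hp : IsGroupPair m J U V) :
    ContDiff ℝ 1 fun t => (J†) (J (U t (w t))) := by
  have hderiv (t : ℝ) := hp.hasDerivAt_adjoint_map (h.hasDerivAt t)
  refine contDiff_one_iff_deriv.mpr ⟨fun t => (hderiv t).differentiableAt, ?_⟩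
  rw [funext fun t => (hderiv t).deriv]
  have hψ := h.continuous hp.source.toIsIsometricGroup
  have hf : Continuous fun t => U t (f t) :=
    hp.source.continuous_uncurry.comp (continuous_id.prodMk h.continuous_deriv)
  have hR : Continuous fun x => (J†) (J x) := (J†).continuous.comp J.continuous
  exact ((hψ.sub ((hR.comp hψ).const_smul _)).const_smul _).neg.add (hR.comp hf)

end IsInteractionSolution

end Evolution

/-! ### The truncated power nonlinearity -/

theorem norm_sq_rpow (μ : ℝ) (z : ℂ) : (‖z‖ ^ 2) ^ μ = ‖z‖ ^ (2 * μ) := by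
  rw [Real.rpow_mul (norm_nonneg z), Real.rpow_two]

/-- The power nonlinearity `|z|^{2μ} z`, written through the smooth function `|z|²`. -/
def powerFun (μ : ℝ) (z : ℂ) : ℂ := ((‖z‖ ^ 2) ^ μ : ℝ) • z

theorem hasFDerivAt_norm_sq (z : ℂ) : HasFDerivAt (fun z : ℂ => ‖z‖ ^ 2) (2 • innerSL ℝ z) z :=
  (hasStrictFDerivAt_norm_sq z).hasFDerivAt

theorem tendsto_norm_sq_rpow_zero {μ : ℝ} (hμ : 0 < μ) :
    Tendsto (fun z : ℂ => (‖z‖ ^ 2) ^ μ) (𝓝 0) (𝓝 0) := by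
  have hcont : Continuous fun z : ℂ => (‖z‖ ^ 2) ^ μ :=
    (continuous_norm.pow 2).rpow_const fun _ => .inr hμ.le
  simpa [Real.zero_rpow hμ.ne'] using hcont.tendsto 0

theorem hasFDerivAt_powerFun_zero {μ : ℝ} (hμ : 0 < μ) :
    HasFDerivAt (powerFun μ) (0 : ℂ →L[ℝ] ℂ) 0 := by
  rw [hasFDerivAt_iff_isLittleO]
  have hsmul := ((Asymptotics.isLittleO_one_iff ℝ).mpr
    (tendsto_norm_sq_rpow_zero hμ)).smul_isBigO (Asymptotics.isBigO_refl (fun z : ℂ => z) (𝓝 0))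
  simpa [powerFun] using hsmul

theorem hasFDerivAt_powerFun (μ : ℝ) {z : ℂ} (hz : z ≠ 0) :
    HasFDerivAt (powerFun μ) (((‖z‖ ^ 2) ^ μ : ℝ) • ContinuousLinearMap.id ℝ ℂ +
      ((μ * (‖z‖ ^ 2) ^ (μ - 1)) • (2 • innerSL ℝ z)).smulRight z) z :=
  ((hasFDerivAt_norm_sq z).rpow_const (.inl (by positivity))).smul (hasFDerivAt_id z)

theorem norm_two_nsmul_innerSL (z : ℂ) : ‖2 • innerSL ℝ z‖ = 2 * ‖z‖ := by
  rw [← Nat.cast_smul_eq_nsmul ℝ, norm_smul, innerSL_apply_norm, Nat.cast_ofNat,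
    Real.norm_ofNat]

theorem norm_fderiv_powerFun_le {μ : ℝ} (hμ : 0 < μ) (z : ℂ) :
    ‖fderiv ℝ (powerFun μ) z‖ ≤ (1 + 2 * μ) * (‖z‖ ^ 2) ^ μ := by
  rcases eq_or_ne z 0 with rfl | hz
  · rw [(hasFDerivAt_powerFun_zero hμ).fderiv, norm_zero]
    positivity
  have hidentity : ‖((‖z‖ ^ 2) ^ μ : ℝ) • ContinuousLinearMap.id ℝ ℂ‖ ≤ (‖z‖ ^ 2) ^ μ := by
    rw [norm_smul, Real.norm_of_nonneg (by positivity)]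
    exact mul_le_of_le_one_right (by positivity) ContinuousLinearMap.norm_id_le
  have hradial : ‖((μ * (‖z‖ ^ 2) ^ (μ - 1)) • (2 • innerSL ℝ z)).smulRight z‖ =
      2 * μ * (‖z‖ ^ 2) ^ μ := by
    calc ‖((μ * (‖z‖ ^ 2) ^ (μ - 1)) • (2 • innerSL ℝ z)).smulRight z‖
        = μ * (‖z‖ ^ 2) ^ (μ - 1) * (2 * ‖z‖) * ‖z‖ := by
          rw [ContinuousLinearMap.norm_smulRight_apply, norm_smul, norm_two_nsmul_innerSL,
            Real.norm_of_nonneg (by positivity)]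
      _ = 2 * μ * ((‖z‖ ^ 2) ^ (μ - 1) * ‖z‖ ^ 2) := by ring
      _ = 2 * μ * (‖z‖ ^ 2) ^ μ := by
          rw [← Real.rpow_add_one (by positivity), sub_add_cancel]
  rw [(hasFDerivAt_powerFun μ hz).fderiv]
  linarith [norm_add_le (((‖z‖ ^ 2) ^ μ : ℝ) • ContinuousLinearMap.id ℝ ℂ)
    (((μ * (‖z‖ ^ 2) ^ (μ - 1)) • (2 • innerSL ℝ z)).smulRight z)]

theorem contDiffAt_powerFun (μ : ℝ) {z : ℂ} (hz : z ≠ 0) : ContDiffAt ℝ 1 (powerFun μ) z :=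
  ((contDiff_norm_sq ℝ).contDiffAt.rpow_const_of_ne (by positivity)).smul contDiffAt_id

theorem contDiff_powerFun {μ : ℝ} (hμ : 0 < μ) : ContDiff ℝ 1 (powerFun μ) := by
  refine contDiff_one_iff_fderiv.mpr ⟨fun z => ?_, continuous_iff_continuousAt.mpr fun z => ?_⟩
  all_goals rcases eq_or_ne z 0 with rfl | hz
  · exact (hasFDerivAt_powerFun_zero hμ).differentiableAt
  · exact (hasFDerivAt_powerFun μ hz).differentiableAt
  · rw [ContinuousAt, (hasFDerivAt_powerFun_zero hμ).fderiv]
    refine squeeze_zero_norm (norm_fderiv_powerFun_le hμ) ?_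
    simpa only [mul_zero] using (tendsto_norm_sq_rpow_zero hμ).const_mul (1 + 2 * μ)
  · exact (contDiffAt_powerFun μ hz).continuousAt_fderiv one_ne_zero

/-- A smooth cut-off in the variable `s = |z|²`, equal to `1` for `s ≤ K²` and to `0` for
`2K² ≤ s`, provided that `K ≠ 0`. -/
def cutoff (K s : ℝ) : ℝ := Real.smoothTransition (2 - s / K ^ 2)

/-- The power nonlinearity multiplied by a cut-off, so that it is the power nonlinearity for
`|z| ≤ K` and vanishes for `√2 K ≤ |z|`. -/
def truncFun (μ K : ℝ) (z : ℂ) : ℂ := cutoff K (‖z‖ ^ 2) • powerFun μ z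

/-- The function with gradient `truncFun μ K` that vanishes at `0`. -/
def truncPotential (μ K : ℝ) (z : ℂ) : ℝ :=
  (1 / 2) * ∫ s in (0 : ℝ)..(‖z‖ ^ 2), cutoff K s * s ^ μ

theorem contDiff_cutoff (K : ℝ) : ContDiff ℝ 1 (cutoff K) :=
  Real.smoothTransition.contDiff.comp (by fun_prop)

theorem continuous_cutoff_mul_rpow {μ : ℝ} (hμ : 0 < μ) (K : ℝ) :
    Continuous fun s : ℝ => cutoff K s * s ^ μ :=
  (contDiff_cutoff K).continuous.mul (continuous_id.rpow_const fun _ => .inr hμ.le)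

theorem cutoff_norm_sq_eq_one {K : ℝ} (hK : 0 < K) {z : ℂ} (hz : ‖z‖ ≤ K) :
    cutoff K (‖z‖ ^ 2) = 1 := by
  refine Real.smoothTransition.one_of_one_le ?_
  have hle : ‖z‖ ^ 2 / K ^ 2 ≤ 1 := div_le_one_of_le₀ (by gcongr) (by positivity)
  linarith

theorem cutoff_norm_sq_eq_zero {K : ℝ} (hK : 0 < K) {z : ℂ} (hz : 2 * K < ‖z‖) :
    cutoff K (‖z‖ ^ 2) = 0 := by
  refine Real.smoothTransition.zero_of_nonpos ?_
  rw [sub_nonpos, le_div_iff₀ (by positivity)]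
  nlinarith

theorem contDiff_truncFun {μ : ℝ} (hμ : 0 < μ) (K : ℝ) : ContDiff ℝ 1 (truncFun μ K) :=
  ((contDiff_cutoff K).comp (contDiff_norm_sq ℝ)).smul (contDiff_powerFun hμ)

theorem hasCompactSupport_truncFun (μ : ℝ) {K : ℝ} (hK : 0 < K) :
    HasCompactSupport (truncFun μ K) := by
  refine .intro (isCompact_closedBall (0 : ℂ) (2 * K)) fun z hz => ?_
  rw [mem_closedBall_zero_iff, not_le] at hz
  rw [truncFun, cutoff_norm_sq_eq_zero hK hz, zero_smul]

theorem hasFDerivAt_truncPotential {μ : ℝ} (hμ : 0 < μ) (K : ℝ) (z : ℂ) :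
    HasFDerivAt (truncPotential μ K) (innerSL ℝ (truncFun μ K z)) z := by
  have hprimitive := ((continuous_cutoff_mul_rpow hμ K).integral_hasStrictDerivAt 0
    (‖z‖ ^ 2)).hasDerivAt.comp_hasFDerivAt z (hasFDerivAt_norm_sq z)
  refine (hprimitive.const_mul (1 / 2)).congr_fderiv (ContinuousLinearMap.ext fun w => ?_)
  simp only [truncFun, powerFun, smul_smul, innerSL_apply_apply, inner_smul_left, smul_apply,
    smul_eq_mul, nsmul_eq_mul, RCLike.conj_to_real]
  push_cast
  ring

theorem exists_isTame_truncFun {μ : ℝ} (hμ : 0 < μ) {K : ℝ} (hK : 0 < K) :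
    ∃ L : NNReal, 0 < L ∧ IsTame (truncFun μ K) (truncPotential μ K) L := by
  have hcont := (contDiff_truncFun hμ K).continuous_fderiv one_ne_zero
  have hsupp := (hasCompactSupport_truncFun μ hK).fderiv (𝕜 := ℝ)
  obtain ⟨C, hC⟩ := hsupp.exists_bound_of_continuous hcont
  refine ⟨⟨max C 1, by positivity⟩, NNReal.coe_pos.mp (lt_max_of_lt_right one_pos), ?_⟩
  exact
    { contDiff := contDiff_truncFun hμ K
      norm_fderiv_le := fun z => (hC z).trans (le_max_left _ _)
      uniformContinuous_fderiv := hsupp.uniformContinuous_of_continuous hcont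
      exists_eq_real_mul := fun z => ⟨cutoff K (‖z‖ ^ 2) * (‖z‖ ^ 2) ^ μ, by
        rw [truncFun, powerFun, smul_smul, Complex.real_smul]⟩
      potential_zero := by
        rw [truncPotential, norm_zero, zero_pow two_ne_zero, intervalIntegral.integral_same,
          mul_zero]
      hasFDerivAt_potential := hasFDerivAt_truncPotential hμ K }

theorem truncFun_eq {K : ℝ} (hK : 0 < K) (μ : ℝ) {z : ℂ} (hz : ‖z‖ ≤ K) :
    truncFun μ K z = (‖z‖ ^ (2 * μ) : ℝ) • z := by
  rw [truncFun, cutoff_norm_sq_eq_one hK hz, one_smul, powerFun, norm_sq_rpow]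

theorem truncPotential_nonneg (μ K : ℝ) (z : ℂ) : 0 ≤ truncPotential μ K z :=
  mul_nonneg one_half_pos.le (intervalIntegral.integral_nonneg (by positivity) fun _ hs =>
    mul_nonneg (Real.smoothTransition.nonneg _) (Real.rpow_nonneg hs.1 _))

theorem truncPotential_le {μ : ℝ} (hμ : 0 < μ) (K : ℝ) (z : ℂ) :
    truncPotential μ K z ≤ ‖z‖ ^ (2 * μ) * ‖z‖ ^ 2 := by
  have h_int : ∫ s in (0 : ℝ)..(‖z‖ ^ 2), cutoff K s * s ^ μ ≤
      ∫ _ in (0 : ℝ)..(‖z‖ ^ 2), (‖z‖ ^ 2) ^ μ := by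
    refine intervalIntegral.integral_mono_on (by positivity)
      ((continuous_cutoff_mul_rpow hμ K).intervalIntegrable _ _) (by simp) fun s hs => ?_
    calc cutoff K s * s ^ μ ≤ s ^ μ :=
          mul_le_of_le_one_left (Real.rpow_nonneg hs.1 _) (Real.smoothTransition.le_one _)
      _ ≤ (‖z‖ ^ 2) ^ μ := Real.rpow_le_rpow hs.1 hs.2 hμ.le
  rw [intervalIntegral.integral_const, smul_eq_mul, sub_zero, norm_sq_rpow] at h_int
  have hnonneg : 0 ≤ ‖z‖ ^ 2 * ‖z‖ ^ (2 * μ) := by positivity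
  rw [truncPotential]
  linarith

theorem potentialEnergy_truncPotential_nonneg (μ K : ℝ) (f : L2) :
    0 ≤ potentialEnergy (truncPotential μ K) f :=
  integral_nonneg fun x => truncPotential_nonneg μ K (f x)

theorem potentialEnergy_truncPotential_le {μ K k : ℝ} (hμ : 0 < μ) (hK : 0 < K) {f : L2}
    (hf : ∀ᵐ x, ‖f x‖ ≤ k) :
    potentialEnergy (truncPotential μ K) f ≤ k ^ (2 * μ) * ‖f‖ ^ 2 := by
  obtain ⟨L, -, hL⟩ := exists_isTame_truncFun hμ hK
  rw [potentialEnergy, norm_sq_eq_integral, ← integral_const_mul]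
  refine integral_mono_ae (hL.integrable_potential f)
    (((Lp.memLp f).integrable_norm_pow two_ne_zero).const_mul _) ?_
  filter_upwards [hf] with x hx
  refine (truncPotential_le hμ K (f x)).trans ?_
  gcongr

theorem nonlinearity_eq_comp {μ K : ℝ} {L : NNReal} {G : ℂ → ℝ} (hK : 0 < K)
    (h : IsTame (truncFun μ K) G L) {f : L2} (hf : ∀ᵐ x, ‖f x‖ ≤ K) :
    nonlinearity μ f = h.comp f := by
  have hcomp : h.comp f =ᵐ[volume] fun x => (‖f x‖ ^ (2 * μ) : ℝ) • f x := by
    filter_upwards [hf, h.coeFn_comp f] with x hx hfx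
    rw [hfx, truncFun_eq hK μ hx]
  have hmem := (memLp_congr_ae hcomp).mp (Lp.memLp (h.comp f))
  rw [nonlinearity, dif_pos hmem]
  exact Lp.ext (hmem.coeFn_toLp.trans hcomp.symm)

/-! ### The a priori bound -/

theorem Q.ae_norm_le (u : Q) : ∀ᵐ x, ‖u.toL2 x‖ ≤ 2 * √(‖u.toL2‖ * ‖u‖) := by
  rcases eq_or_ne u.toL2 0 with hu | hu
  · rw [hu]
    filter_upwards [Lp.coeFn_zero ℂ 2 (volume : Measure ℝ)] with x hx
    rw [hx, Pi.zero_apply, norm_zero]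
    positivity
  have hp : 0 < √‖u.toL2‖ := Real.sqrt_pos.mpr (norm_pos_iff.mpr hu)
  have hq : 0 < √‖u‖ := hp.trans_le (Real.sqrt_le_sqrt (Q.norm_toL2_le u))
  have hfunction : (√‖u.toL2‖ / √‖u‖)⁻¹ * ‖u.toL2‖ = √‖u.toL2‖ * √‖u‖ := by
    nth_rewrite 2 [← Real.mul_self_sqrt (norm_nonneg u.toL2)]
    field_simp
  have hderiv : √‖u.toL2‖ / √‖u‖ * ‖Q.weakDeriv u‖ ≤ √‖u.toL2‖ * √‖u‖ := by
    calc √‖u.toL2‖ / √‖u‖ * ‖Q.weakDeriv u‖ ≤ √‖u.toL2‖ / √‖u‖ * (√‖u‖ * √‖u‖) := by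
          rw [Real.mul_self_sqrt (norm_nonneg u)]
          gcongr
          exact Q.norm_weakDeriv_le u
      _ = √‖u.toL2‖ * √‖u‖ := by field_simp
  filter_upwards [(Q.isHalfLinePrimitive u).ae_norm_le (div_pos hp hq)] with x hx
  rw [Real.sqrt_mul (norm_nonneg _)]
  linarith

theorem potentialEnergy_truncPotential_toL2_le {μ K : ℝ} (hμ : 0 < μ) (hK : 0 < K) (u : Q) :
    potentialEnergy (truncPotential μ K) u.toL2 ≤
      (4 * ‖u.toL2‖) ^ μ * ‖u‖ ^ μ * ‖u.toL2‖ ^ 2 := by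
  refine (potentialEnergy_truncPotential_le hμ hK u.ae_norm_le).trans_eq ?_
  rw [Real.rpow_mul (by positivity), Real.rpow_two, mul_pow, Real.sq_sqrt (by positivity),
    ← Real.mul_rpow (by positivity) (by positivity)]
  ring_nf

theorem le_max_one_rpow_of_sq_le {A B μ ρ : ℝ} (hA : 0 ≤ A) (hμ₀ : 0 ≤ μ) (hμ : μ < 2)
    (h : ρ ^ 2 ≤ A + B * ρ ^ μ) : ρ ≤ max 1 ((A + B) ^ (2 - μ)⁻¹) := by
  rcases le_total ρ 1 with hρ | hρ
  · exact le_max_of_le_left hρ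
  have hρ₀ : 0 < ρ := one_pos.trans_le hρ
  have hone : 1 ≤ ρ ^ μ := Real.one_le_rpow hρ hμ₀
  have hpow : ρ ^ (2 - μ) ≤ A + B := by
    refine le_of_mul_le_mul_right ?_ (one_pos.trans_le hone)
    rw [← Real.rpow_add hρ₀, sub_add_cancel, Real.rpow_two]
    nlinarith
  refine le_max_of_le_right ?_
  calc ρ = (ρ ^ (2 - μ)) ^ (2 - μ)⁻¹ :=
        (Real.rpow_rpow_inv hρ₀.le (sub_ne_zero.mpr hμ.ne')).symm
    _ ≤ (A + B) ^ (2 - μ)⁻¹ :=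
        Real.rpow_le_rpow (by positivity) hpow (inv_nonneg.mpr (sub_nonneg.mpr hμ.le))

section Energy

variable {γ lam μ K : ℝ} {S : Q ≃L[ℂ] Q} {ψ₀ φ : Q}

theorem norm_sq_le_of_energy_eq (hγ : γ ≠ 0)
    (hS : ∀ u v, inner ℂ (S u) (S v) = Q.form γ (Q.shift γ) u v)
    (henergy : ‖S φ‖ ^ 2 / 2 - lam * potentialEnergy (truncPotential μ K) φ.toL2 =
      ‖S ψ₀‖ ^ 2 / 2 - lam * potentialEnergy (truncPotential μ K) ψ₀.toL2) :
    ‖φ‖ ^ 2 ≤ 2 * ‖S ψ₀‖ ^ 2 + 4 * (|lam| * (potentialEnergy (truncPotential μ K) ψ₀.toL2 +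
      potentialEnergy (truncPotential μ K) φ.toL2)) := by
  have hform : ‖S φ‖ ^ 2 = (Q.form γ (Q.shift γ) φ φ).re := by
    rw [← hS]
    exact (inner_self_eq_norm_sq (𝕜 := ℂ) (S φ)).symm
  have hφ := mul_le_mul_of_nonneg_right (le_abs_self lam)
    (potentialEnergy_truncPotential_nonneg μ K φ.toL2)
  have hψ₀ := mul_le_mul_of_nonneg_right (neg_le_abs lam)
    (potentialEnergy_truncPotential_nonneg μ K ψ₀.toL2)
  linarith [Q.half_norm_sq_le_form hγ φ]

theorem exists_bound_of_energy_eq (hγ : γ ≠ 0) (lam : ℝ) (hμ₀ : 0 < μ) (hμ : μ < 2)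
    (hS : ∀ u v, inner ℂ (S u) (S v) = Q.form γ (Q.shift γ) u v) (ψ₀ : Q) :
    ∃ K > 0, ∀ K' > 0, ∀ φ : Q, ‖φ.toL2‖ = ‖ψ₀.toL2‖ →
      ‖S φ‖ ^ 2 / 2 - lam * potentialEnergy (truncPotential μ K') φ.toL2 =
        ‖S ψ₀‖ ^ 2 / 2 - lam * potentialEnergy (truncPotential μ K') ψ₀.toL2 →
      ∀ᵐ x, ‖φ.toL2 x‖ ≤ K := by
  set c : ℝ := 4 * (|lam| * ((4 * ‖ψ₀.toL2‖) ^ μ * ‖ψ₀.toL2‖ ^ 2))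
  set A : ℝ := 2 * ‖S ψ₀‖ ^ 2 + c * ‖ψ₀‖ ^ μ
  refine ⟨2 * √(‖ψ₀.toL2‖ * max 1 ((A + c) ^ (2 - μ)⁻¹)) + 1, by positivity,
    fun K' hK' φ hmass henergy => ?_⟩
  have hsq : ‖φ‖ ^ 2 ≤ A + c * ‖φ‖ ^ μ := by
    calc ‖φ‖ ^ 2 ≤ 2 * ‖S ψ₀‖ ^ 2 +
          4 * (|lam| * (potentialEnergy (truncPotential μ K') ψ₀.toL2 +
            potentialEnergy (truncPotential μ K') φ.toL2)) :=
          norm_sq_le_of_energy_eq hγ hS henergy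
      _ ≤ 2 * ‖S ψ₀‖ ^ 2 + 4 * (|lam| *
          ((4 * ‖ψ₀.toL2‖) ^ μ * ‖ψ₀‖ ^ μ * ‖ψ₀.toL2‖ ^ 2 +
            (4 * ‖ψ₀.toL2‖) ^ μ * ‖φ‖ ^ μ * ‖ψ₀.toL2‖ ^ 2)) := by
          gcongr
          · exact potentialEnergy_truncPotential_toL2_le hμ₀ hK' ψ₀
          · simpa only [hmass] using potentialEnergy_truncPotential_toL2_le hμ₀ hK' φ
      _ = A + c * ‖φ‖ ^ μ := by ring
  have hnorm := le_max_one_rpow_of_sq_le (by positivity) hμ₀.le hμ hsq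
  filter_upwards [φ.ae_norm_le] with x hx
  rw [hmass] at hx
  calc ‖φ.toL2 x‖ ≤ 2 * √(‖ψ₀.toL2‖ * ‖φ‖) := hx
    _ ≤ 2 * √(‖ψ₀.toL2‖ * max 1 ((A + c) ^ (2 - μ)⁻¹)) := by gcongr
    _ ≤ _ := le_add_of_nonneg_right zero_le_one

end Energy

/-! ### Global existence -/

theorem IsPotentialOp.conj {X X' Y : Type*} [NormedAddCommGroup X] [InnerProductSpace ℂ X]
    [NormedAddCommGroup X'] [InnerProductSpace ℂ X'] [NormedAddCommGroup Y]
    [InnerProductSpace ℂ Y] {J : X →L[ℂ] Y} {J' : X' →L[ℂ] Y} {N : X → X} {n : Y → Y} {e : Y → ℝ}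
    {L : ℝ} (hN : IsPotentialOp J N n e L) (S : X ≃L[ℂ] X') (hJ : ∀ u, J' (S u) = J u) :
    IsPotentialOp J' (fun x => S (N (S.symm x))) n e
      (L * (1 + ‖(S : X →L[ℂ] X')‖ * ‖(S.symm : X' →L[ℂ] X)‖)) := by
  set a := ‖(S : X →L[ℂ] X')‖
  set b := ‖(S.symm : X' →L[ℂ] X)‖
  have hL := hN.pos
  have ha : 0 ≤ a := norm_nonneg _
  have hb : 0 ≤ b := norm_nonneg _
  have hS (u : X) : ‖S u‖ ≤ a * ‖u‖ := (S : X →L[ℂ] X').le_opNorm u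
  have hS' (x : X') : ‖S.symm x‖ ≤ b * ‖x‖ := (S.symm : X' →L[ℂ] X).le_opNorm x
  have hJ' (x : X') : J' x = J (S.symm x) := by rw [← hJ, S.apply_symm_apply]
  have hle : L ≤ L * (1 + a * b) := le_mul_of_one_le_right hL.le (by nlinarith)
  refine
    { pos := by positivity
      map_apply := fun x => by rw [hJ, hN.map_apply, hJ']
      norm_target_sub_le := fun f g => (hN.norm_target_sub_le f g).trans (by gcongr)
      norm_le := fun x => ?_
      norm_sub_le := fun ε hε M => ?_
      re_inner_I_smul := hN.re_inner_I_smul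
      abs_potential_sub_le := fun f g => (hN.abs_potential_sub_le f g).trans (by gcongr) }
  · calc ‖S (N (S.symm x))‖ ≤ a * (L * (b * ‖x‖)) := by
          refine (hS _).trans ?_
          gcongr
          exact (hN.norm_le _).trans (by gcongr; exact hS' x)
      _ ≤ L * (1 + a * b) * ‖x‖ := by nlinarith [mul_nonneg hL.le (norm_nonneg x)]
  · obtain ⟨δ, hδ, hsub⟩ := hN.norm_sub_le (ε / (a + 1)) (by positivity) (b * M)
    refine ⟨δ, hδ, fun x y hx hy hxy => ?_⟩
    have hε' : a * (ε / (a + 1)) ≤ ε := by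
      rw [mul_div_assoc', div_le_iff₀ (by positivity)]
      nlinarith
    calc ‖S (N (S.symm x)) - S (N (S.symm y))‖
        ≤ a * (L * (b * ‖x - y‖) + ε / (a + 1)) := by
          rw [← map_sub]
          refine (hS _).trans ?_
          gcongr
          refine (hsub _ _ ((hS' x).trans (by gcongr)) ((hS' y).trans (by gcongr))
            (by rwa [← hJ', ← hJ'])).trans ?_
          gcongr
          rw [← map_sub]
          exact hS' _
      _ ≤ L * (1 + a * b) * ‖x - y‖ + ε := by nlinarith [mul_nonneg hL.le (norm_nonneg (x - y))]

theorem Q.exists_ae_norm_sub_le (M : ℝ) {δ : ℝ} (hδ : 0 < δ) : ∃ η > 0, ∀ u v : Q,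
    ‖u‖ ≤ M → ‖v‖ ≤ M → ‖u.toL2 - v.toL2‖ ≤ η → ∀ᵐ x, ‖u.toL2 x - v.toL2 x‖ ≤ δ := by
  refine ⟨δ ^ 2 / (8 * (|M| + 1)), by positivity, fun u v hu hv huv => ?_⟩
  have hnorm : ‖u - v‖ ≤ 2 * (|M| + 1) := by linarith [norm_sub_le u v, le_abs_self M]
  filter_upwards [(u - v).ae_norm_le, Lp.coeFn_sub u.toL2 v.toL2] with x hx hsub
  rw [map_sub, hsub, Pi.sub_apply] at hx
  calc ‖u.toL2 x - v.toL2 x‖ ≤ 2 * √(‖u.toL2 - v.toL2‖ * ‖u - v‖) := hx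
    _ ≤ 2 * √(δ ^ 2 / (8 * (|M| + 1)) * (2 * (|M| + 1))) := by gcongr
    _ = 2 * √((δ / 2) ^ 2) := by
        congr 2
        field_simp
        norm_num
    _ = δ := by
        rw [Real.sqrt_sq (by positivity)]
        ring

theorem IsTame.isPotentialOp {N : ℂ → ℂ} {G : ℂ → ℝ} {L : NNReal} (h : IsTame N G L)
    (hL : 0 < L) : IsPotentialOp Q.toL2 h.compQ h.comp (potentialEnergy G) L where
  pos := hL
  map_apply := h.toL2_compQ
  norm_target_sub_le := h.lipschitzWith_comp.norm_sub_le
  norm_le := h.norm_compQ_le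
  norm_sub_le ε hε M := by
    obtain ⟨δ, hδ, hcompQ⟩ := h.exists_norm_compQ_sub_le (ε := ε / (|M| + 1)) (by positivity)
    obtain ⟨η, hη, hclose⟩ := Q.exists_ae_norm_sub_le M hδ
    refine ⟨η, hη, fun u v hu hv huv => (hcompQ u v (hclose u v hu hv huv)).trans ?_⟩
    gcongr
    rw [div_mul_eq_mul_div, div_le_iff₀ (by positivity)]
    gcongr
    linarith [le_abs_self M]
  re_inner_I_smul := h.re_inner_I_smul_comp
  abs_potential_sub_le := h.abs_potentialEnergy_sub_le

theorem contDiff_innerSL_comp {X Z : Type*} [NormedAddCommGroup X] [InnerProductSpace ℂ X]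
    [NormedAddCommGroup Z] [NormedSpace ℂ Z] (A : Z →L[ℂ] X) {f : ℝ → X} {n : ℕ∞ω}
    (hf : ContDiff ℝ n f) : ContDiff ℝ n fun t => (innerSL ℂ (f t)).comp A := by
  have hlinear : IsBoundedLinearMap ℝ fun x : X => (innerSL ℂ x).comp A := by
    refine IsLinearMap.with_bound ⟨fun x y => ?_, fun c x => ?_⟩ ‖A‖ fun x => ?_
    · rw [map_add, ContinuousLinearMap.add_comp]
    · ext z
      change inner ℂ (c • x) (A z) = c • inner ℂ x (A z)
      rw [← Complex.coe_smul, inner_smul_left, Complex.conj_ofReal, Complex.real_smul]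
    · refine ((innerSL ℂ x).opNorm_comp_le A).trans_eq ?_
      rw [innerSL_apply_norm, mul_comm]
  exact hlinear.contDiff.comp hf

open scoped InnerProduct in
theorem toDual_eq_innerSL_comp {S : Q ≃L[ℂ] Q} {J : Q →L[ℂ] L2} (hJ : ∀ u, J (S u) = u.toL2)
    (u : Q) : Q.toDual u = (innerSL ℂ ((J†) (J (S u)))).comp (S : Q →L[ℂ] Q) := by
  ext v
  change inner ℂ u.toL2 v.toL2 = inner ℂ ((J†) (J (S u))) (S v)
  rw [ContinuousLinearMap.adjoint_inner_left, hJ, hJ]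

theorem exists_isWeakSolution_top {γ μ : ℝ} (hγ : γ ≠ 0) (lam : ℝ) (hμ₀ : 0 < μ) (hμ : μ < 2)
    (ψ₀ : Q) : ∃ Ψ : ℝ → Q, IsWeakSolution γ lam μ ψ₀ ⊤ Ψ ∧
      ContDiff ℝ 1 fun t => Q.toDual (Ψ t) := by
  obtain ⟨S, J, U, hJ, hS, hp⟩ := exists_isGroupPair_hamiltonian hγ
  obtain ⟨K, hK, hbound⟩ := exists_bound_of_energy_eq hγ lam hμ₀ hμ hS ψ₀
  obtain ⟨L, hL, hTame⟩ := exists_isTame_truncFun hμ₀ hK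
  have hN := (hTame.isPotentialOp hL).conj S hJ
  obtain ⟨w, f, hw₀, hw⟩ := hN.exists_isInteractionSolution hp lam (S ψ₀)
  set Ψ : ℝ → Q := fun t => S.symm (U t (w t))
  have hSΨ (t : ℝ) : S (Ψ t) = U t (w t) := S.apply_symm_apply _
  have hJΨ (t : ℝ) : J (U t (w t)) = (Ψ t).toL2 := by rw [← hSΨ, hJ]
  have hsup (t : ℝ) (ht : 0 ≤ t) : ∀ᵐ x, ‖(Ψ t).toL2 x‖ ≤ K := by
    refine hbound K hK (Ψ t) ?_ ?_
    · simpa only [hJΨ, hw₀, hJ] using hw.norm_map_eq hp hN ht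
    · simpa only [hJΨ, hw₀, hJ, hSΨ] using hw.energy_eq hp hN ht
  refine ⟨Ψ, ⟨EReal.coe_lt_top 0, ?_, fun t ht => ?_⟩, ?_⟩
  · exact (S.symm.continuous.comp (hw.continuous hp.source.toIsIsometricGroup)).continuousOn
  · have hduhamel := hw.duhamel hp hN.map_apply ht.1
    simp only [hJΨ, hw₀, hJ] at hduhamel
    rw [hduhamel]
    congr 2
    refine intervalIntegral.integral_congr fun s hs => ?_
    rw [uIcc_of_le ht.1] at hs
    exact congrArg _ (nonlinearity_eq_comp hK hTame (hsup s hs.1)).symm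
  · simp only [toDual_eq_innerSL_comp hJ, hSΨ]
    exact contDiff_innerSL_comp (S : Q →L[ℂ] Q) (hw.contDiff_adjoint_map hp)

/-! ### Uniqueness -/

theorem eq_zero_of_le_mul_integral {d : ℝ → ℝ} {C t : ℝ} (hd : Continuous d) (hd₀ : ∀ s, 0 ≤ d s)
    (hle : ∀ s ∈ Icc 0 t, d s ≤ C * ∫ r in (0 : ℝ)..s, d r) : ∀ s ∈ Icc 0 t, d s = 0 := by
  intro s hs
  have hderiv (s : ℝ) : HasDerivAt (fun s => ∫ r in (0 : ℝ)..s, d r) (d s) s :=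
    (hd.integral_hasStrictDerivAt 0 s).hasDerivAt
  have hnonneg (s : ℝ) (hs : 0 ≤ s) : 0 ≤ ∫ r in (0 : ℝ)..s, d r :=
    intervalIntegral.integral_nonneg hs fun r _ => hd₀ r
  have hgronwall := norm_le_gronwallBound_of_norm_deriv_right_le (δ := 0) (K := C) (ε := 0)
    (fun s _ => (hderiv s).continuousAt.continuousWithinAt)
    (fun s _ => (hderiv s).hasDerivWithinAt)
    (by rw [intervalIntegral.integral_same, norm_zero])
    (fun s hs => by
      rw [Real.norm_of_nonneg (hd₀ s), Real.norm_of_nonneg (hnonneg s hs.1), add_zero]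
      exact hle s (Ico_subset_Icc_self hs)) s hs
  rw [gronwallBound_ε0_δ0, norm_le_zero_iff] at hgronwall
  refine le_antisymm ?_ (hd₀ s)
  simpa only [hgronwall, mul_zero] using hle s hs

section Duhamel

variable {Y : Type*} [NormedAddCommGroup Y] [NormedSpace ℂ Y] {V : ℝ → Y →L[ℂ] Y} {n : Y → Y}
  {L : NNReal} {f g : ℝ → Y} {t : ℝ}

theorem IsIsometricGroup.intervalIntegrable_duhamel (hV : IsIsometricGroup V) (hn : Continuous n)
    (ht : 0 ≤ t) (hf : ContinuousOn f (Icc 0 t)) :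
    IntervalIntegrable (fun r => V (t - r) (n (f r))) volume 0 t :=
  ContinuousOn.intervalIntegrable_of_Icc ht <| hV.continuous_uncurry.comp_continuousOn <|
    (continuousOn_const.sub continuousOn_id).prodMk (hn.comp_continuousOn hf)

theorem IsIsometricGroup.norm_integral_duhamel_sub_le (hV : IsIsometricGroup V)
    (hn : LipschitzWith L n) (ht : 0 ≤ t) (hf : ContinuousOn f (Icc 0 t))
    (hg : ContinuousOn g (Icc 0 t)) :
    ‖(∫ r in (0 : ℝ)..t, V (t - r) (n (f r))) - ∫ r in (0 : ℝ)..t, V (t - r) (n (g r))‖ ≤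
      L * ∫ r in (0 : ℝ)..t, ‖f r - g r‖ := by
  rw [← intervalIntegral.integral_sub (hV.intervalIntegrable_duhamel hn.continuous ht hf)
    (hV.intervalIntegrable_duhamel hn.continuous ht hg), ← intervalIntegral.integral_const_mul]
  refine intervalIntegral.norm_integral_le_of_norm_le ht (.of_forall fun r _ => ?_)
    (((hf.sub hg).norm.intervalIntegrable_of_Icc ht).const_mul _)
  rw [← map_sub, hV.norm_map]
  exact hn.norm_sub_le _ _

theorem eqOn_of_duhamel (hV : IsIsometricGroup V) (hn : LipschitzWith L n) (c : ℂ) (y₀ : Y)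
    (hf : ContinuousOn f (Icc 0 t)) (hg : ContinuousOn g (Icc 0 t))
    (hfd : ∀ s ∈ Icc 0 t, f s = V s y₀ + c • ∫ r in (0 : ℝ)..s, V (s - r) (n (f r)))
    (hgd : ∀ s ∈ Icc 0 t, g s = V s y₀ + c • ∫ r in (0 : ℝ)..s, V (s - r) (n (g r))) :
    EqOn f g (Icc 0 t) := by
  intro s hs
  have ht : 0 ≤ t := hs.1.trans hs.2
  set d : ℝ → ℝ := IccExtend ht ((Icc 0 t).domRestrict fun s => ‖f s - g s‖)
  have hd (s : ℝ) (hs : s ∈ Icc 0 t) : d s = ‖f s - g s‖ := IccExtend_of_mem _ _ hs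
  have hle (s : ℝ) (hs : s ∈ Icc 0 t) : d s ≤ ‖c‖ * L * ∫ r in (0 : ℝ)..s, d r := by
    have hsub : Icc 0 s ⊆ Icc 0 t := Icc_subset_Icc_right hs.2
    have h_int : ∫ r in (0 : ℝ)..s, d r = ∫ r in (0 : ℝ)..s, ‖f r - g r‖ := by
      refine intervalIntegral.integral_congr fun r hr => hd r (hsub ?_)
      rwa [uIcc_of_le hs.1] at hr
    rw [hd s hs, hfd s hs, hgd s hs, add_sub_add_left_eq_sub, ← smul_sub, norm_smul, mul_assoc,
      h_int]
    gcongr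
    exact hV.norm_integral_duhamel_sub_le hn hs.1 (hf.mono hsub) (hg.mono hsub)
  have hcont : Continuous d := (hf.sub hg).norm.domRestrict.Icc_extend'
  have hzero := eq_zero_of_le_mul_integral hcont (fun _ => norm_nonneg _) hle s hs
  rwa [hd s hs, norm_eq_zero, sub_eq_zero] at hzero

end Duhamel

theorem exists_isTame_forall_nonlinearity_eq_comp {μ : ℝ} (hμ : 0 < μ) (M : ℝ) :
    ∃ (N : ℂ → ℂ) (G : ℂ → ℝ) (L : NNReal) (h : IsTame N G L),
      ∀ u : Q, ‖u‖ ≤ M → nonlinearity μ u.toL2 = h.comp u.toL2 := by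
  have hK : 0 < 2 * |M| + 1 := by positivity
  obtain ⟨L, -, h⟩ := exists_isTame_truncFun hμ hK
  refine ⟨_, _, L, h, fun u hu => nonlinearity_eq_comp hK h ?_⟩
  have huM : ‖u‖ ≤ |M| := hu.trans (le_abs_self M)
  have hsqrt : √(‖u.toL2‖ * ‖u‖) ≤ |M| := by
    rw [Real.sqrt_le_left (abs_nonneg M), sq]
    gcongr
    exact (Q.norm_toL2_le u).trans huM
  filter_upwards [u.ae_norm_le] with x hx
  linarith

namespace IsWeakSolution

variable {γ lam μ : ℝ} {ψ₀ : Q} {T T' : EReal} {ψ ψ' : ℝ → Q}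

theorem duhamel_of_nonlinearity_eq {n : L2 → L2} (h : IsWeakSolution γ lam μ ψ₀ T ψ) {M t : ℝ}
    (hM : ∀ s ∈ Icc 0 t, ‖ψ s‖ ≤ M) (hn : ∀ u : Q, ‖u‖ ≤ M → nonlinearity μ u.toL2 = n u.toL2)
    (ht : t ∈ timeInterval T) :
    (ψ t).toL2 = propagator (hamiltonian γ) t ψ₀.toL2 + (Complex.I * lam) •
      ∫ s in (0 : ℝ)..t, propagator (hamiltonian γ) (t - s) (n (ψ s).toL2) := by
  rw [h.duhamel t ht]
  congr 2
  refine intervalIntegral.integral_congr fun s hs => congrArg _ (hn _ (hM s ?_))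
  rwa [uIcc_of_le ht.1] at hs

theorem eqOn (hγ : γ ≠ 0) (hμ : 0 < μ) (h : IsWeakSolution γ lam μ ψ₀ T ψ)
    (h' : IsWeakSolution γ lam μ ψ₀ T' ψ') (hT : T ≤ T') : EqOn ψ ψ' (timeInterval T) := by
  intro t ht
  obtain ⟨_, _, _, -, -, hp⟩ := exists_isGroupPair_hamiltonian hγ
  have hsub : Icc 0 t ⊆ timeInterval T := fun s hs =>
    ⟨hs.1, (EReal.coe_le_coe_iff.mpr hs.2).trans_lt ht.2⟩
  have hsub' : Icc 0 t ⊆ timeInterval T' := fun s hs => ⟨hs.1, (hsub hs).2.trans_le hT⟩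
  have hψ := h.continuousOn.mono hsub
  have hψ' := h'.continuousOn.mono hsub'
  obtain ⟨M, hM⟩ := isCompact_Icc.exists_bound_of_continuousOn hψ
  obtain ⟨M', hM'⟩ := isCompact_Icc.exists_bound_of_continuousOn hψ'
  obtain ⟨N, G, L, hTame, hN⟩ := exists_isTame_forall_nonlinearity_eq_comp hμ (max M M')
  refine Q.toL2_injective (eqOn_of_duhamel hp.target hTame.lipschitzWith_comp
    (Complex.I * lam) ψ₀.toL2 (Q.toL2.continuous.comp_continuousOn hψ)
    (Q.toL2.continuous.comp_continuousOn hψ')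
    (fun s hs => ?_) (fun s hs => ?_) (right_mem_Icc.mpr ht.1))
  · exact h.duhamel_of_nonlinearity_eq
      (fun r hr => (hM r ⟨hr.1, hr.2.trans hs.2⟩).trans (le_max_left _ _)) hN (hsub hs)
  · exact h'.duhamel_of_nonlinearity_eq
      (fun r hr => (hM' r ⟨hr.1, hr.2.trans hs.2⟩).trans (le_max_right _ _)) hN (hsub' hs)

end IsWeakSolution

theorem mainTheorem12_general (γ lam μ : ℝ) (hγ : γ ≠ 0) (hμ₀ : 0 < μ) (hμ : μ < 2) (ψ₀ : Q) :
    (∀ (T : EReal) (ψ : ℝ → Q), IsMaximalWeakSolution γ lam μ ψ₀ T ψ → T = ⊤) ∧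
    ∃ Ψ : ℝ → Q,
      IsWeakSolution γ lam μ ψ₀ ⊤ Ψ ∧
      ContDiffOn ℝ 1 (fun t => Q.toDual (Ψ t)) (Set.Ici 0) ∧
      ∀ (T : EReal) (ψ : ℝ → Q), IsWeakSolution γ lam μ ψ₀ T ψ →
        Set.EqOn ψ Ψ (timeInterval T) := by
  obtain ⟨Ψ, hΨ, hdual⟩ := exists_isWeakSolution_top hγ lam hμ₀ hμ ψ₀
  have hunique (T : EReal) (ψ : ℝ → Q) (hψ : IsWeakSolution γ lam μ ψ₀ T ψ) :
      EqOn ψ Ψ (timeInterval T) := hψ.eqOn hγ hμ₀ hΨ le_top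
  exact ⟨fun T ψ hψ => top_le_iff.mp (hψ.maximal ⊤ Ψ hΨ (hunique T ψ hψ.isWeakSolution).symm),
    Ψ, hΨ, hdual.contDiffOn, hunique⟩

end

end DeltaPrimeNLS

open DeltaPrimeNLS in
theorem mainTheorem12 (γ lam μ : ℝ) (hγ : 0 < γ) (hlam : 0 < lam) (hμ₀ : 0 < μ) (hμ : μ < 2)
    (ψ₀ : Q) :
    (∀ (T : EReal) (ψ : ℝ → Q), IsMaximalWeakSolution γ lam μ ψ₀ T ψ → T = ⊤) ∧
    ∃ Ψ : ℝ → Q,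
      IsWeakSolution γ lam μ ψ₀ ⊤ Ψ ∧
      ContDiffOn ℝ 1 (fun t => Q.toDual (Ψ t)) (Set.Ici 0) ∧
      ∀ (T : EReal) (ψ : ℝ → Q), IsWeakSolution γ lam μ ψ₀ T ψ →
        Set.EqOn ψ Ψ (timeInterval T) :=
  mainTheorem12_general γ lam μ hγ.ne' hμ₀ hμ ψ₀
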